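/- **Setting.** Let $\mathcal H$ be a separable infinite-dimensional complex Hilbert space, $\mathcal B(\mathcal H)$ its bounded operators. A *symmetrically normed ideal* is a two-sided ideal $\mathcal J\subseteq\mathcal B(\mathcal H)$ that is a Banach space for a norm with $\|axb\|_{\mathcal J}\le\|a\|\,\|x\|_{\mathcal J}\,\|b\|$ for $x\in\mathcal J$, $a,b\in\mathcal B(\mathcal H)$, normalized so that rank-one orthogonal projections in $\mathcal J$ have norm $1$. It is *arithmetically mean closed* if, for all compact $x,y$ with $\sum_{k=1}^n s_k(x)\le\sum_{k=1}^n s_k(y)$ for all $n$, $y\in\mathcal J$ implies $x\in\mathcal J$; here $s_1(x)\ge s_2(x)\ge\cdots$ are the singular values of $x$. Let $\mathrm U_{\mathcal J}$ be the group of unitary operators in $\mathbf 1+\mathcal J$, with the topology given by $\|u-v\|_{\mathcal J}$, and let $\mathfrak u_{\mathcal J}=\{x\in\mathcal J\mid x^*=-x\}$, a real Banach space for the norm of $\mathcal J$, with the commutator bracket. For $a\in\mathcal B(\mathcal H)$ put $\pi(u)=uau^*$ $(u\in\mathrm U_{\mathcal J})$, $\mathrm U_{\mathcal J}(a)=\{u\in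 \mathrm U_{\mathcal J}\mid uau^*=a\}$ and $\mathcal O_{\mathcal J}(a)=\pi(\mathrm U_{\mathcal J})$. If $a$ is normal, let $E(x)=\sum_\lambda p_\lambda xp_\lambda$ (strong operator convergence), where $p_\lambda$ is the orthogonal projection onto $\ker(a-\lambda\mathbf 1)$ and $\lambda$ runs over the eigenvalues of $a$. **Theorem.** Let $\mathcal J$ be an arithmetically mean closed symmetrically normed ideal and let $a$ be a compact normal operator on $\mathcal H$. Then $\mathrm U_{\mathcal J}$ carries a structure of real-analytic Banach–Lie group for which it is an embedded real-analytic submanifold of $\mathbf 1+\mathcal J$; its Lie algebra (the tangent space at $\mathbf 1$) is $\mathfrak u_{\mathcal J}$ with the commutator bracket; $\pi\colon \mathrm U_{\mathcal J}\to\mathcal B(\mathcal H)$ is real analytic with differential $\pi_{*\mathbf 1}(x)=xa-ax$ for $x\in\mathfrak u_{\mathcal J}$; and the following assertions hold for this structure. 1. $\mathrm U_{\mathcal J}(a)$ with its subspace topology is a Banach–Lie subgroup of $\mathrm U_{\mathcal J}$: it carries a structure of real-analytic Banach–Lie group such that the inclusion $\mathrm U_{\mathcal J}(a)\hookrightarrow\mathrm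 U_{\mathcal J}$ is a real-analytic (split) embedding. 2. The Lie algebra of $\mathrm U_{\mathcal J}(a)$ (its tangent space at $\mathbf 1$, as a subspace of $\mathfrak u_{\mathcal J}$) is the Lie subalgebra $\ker\pi_{*\mathbf 1}$ of $\mathfrak u_{\mathcal J}$, and it is complemented: as a topological direct sum, $$\mathfrak u_{\mathcal J}=\ker\pi_{*\mathbf 1}\oplus\ker(E|_{\mathfrak u_{\mathcal J}}).$$ 3. Endow $\mathcal O_{\mathcal J}(a)$ with the topology for which the bijection $\mathrm U_{\mathcal J}/\mathrm U_{\mathcal J}(a)\to\mathcal O_{\mathcal J}(a)$, $u\mathrm U_{\mathcal J}(a)\mapsto uau^*$, is a homeomorphism. Then $\mathcal O_{\mathcal J}(a)$ is Hausdorff and carries a structure of real-analytic Banach manifold, modelled on $\ker(E|_{\mathfrak u_{\mathcal J}})$, such that $\pi\colon\mathrm U_{\mathcal J}\to\mathcal O_{\mathcal J}(a)$ is a real-analytic (split) submersion and the transitive action $\mathrm U_{\mathcal J}\times\mathcal O_{\mathcal J}(a)\to\mathcal O_{\mathcal J}(a)$, $(u,b)\mapsto ubu^*$, is real analytic. -/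

import Mathlib

open scoped ContDiff Manifold InnerProductSpace
open Manifold

noncomputable section

/-! ### Singular values of operators -/

/-- The `k`-th singular value (`k = 0, 1, 2, …`) of a compact operator `x`, i.e. the `k`-th term of
the list of eigenvalues of `|x| = (x⋆ x)^(1/2)`, arranged in decreasing order and repeated according
to multiplicity (and continued by `0` if `x` has finite rank): it is the least `t ≥ 0` such that, counted
with multiplicity, at most `k` of the eigenvalues of `|x|` are greater than `t`. -/
def singularValue {H : Type*} [NormedAddCommGroup H] [InnerProductSpace ℂ H] [CompleteSpace H]
    (x : H →L[ℂ] H) (k : ℕ) : ℝ :=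
  sInf {t : ℝ | 0 ≤ t ∧
    Module.rank ℂ (⨆ μ : {μ : ℝ // t < μ},
      Module.End.eigenspace (CFC.abs x : H →L[ℂ] H).toLinearMap ((μ : ℝ) : ℂ) :
        Submodule ℂ H) ≤ (k : Cardinal)}

/-! ### The diagonal conditional expectation of a normal operator -/

section Expectation

variable {H : Type*} [NormedAddCommGroup H] [InnerProductSpace ℂ H]

/-- The eigenspace `ker (a - z)`; it is zero if `z` is not an eigenvalue of `a`. -/
def eigSpace (a : H →L[ℂ] H) (z : ℂ) : Submodule ℂ H := Module.End.eigenspace a.toLinearMap z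

theorem mem_eigSpace {a : H →L[ℂ] H} {z : ℂ} {ξ : H} : ξ ∈ eigSpace a z ↔ a ξ = z • ξ :=
  Module.End.mem_eigenspace_iff

variable [CompleteSpace H]

instance (a : H →L[ℂ] H) (z : ℂ) : CompleteSpace (eigSpace a z) := by
  have h : IsClosed (eigSpace a z : Set H) := by
    have e : (eigSpace a z : Set H) = {ξ | a ξ = z • ξ} := by
      ext ξ; exact mem_eigSpace
    rw [e]
    exact isClosed_eq a.continuous (continuous_const_smul z)
  exact h.completeSpace_coe

/-- The orthogonal projection `p_z` onto `ker (a - z)`. -/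
def eigProj (a : H →L[ℂ] H) (z : ℂ) : H →L[ℂ] H := (eigSpace a z).starProjection

theorem eigProj_mem (a : H →L[ℂ] H) (z : ℂ) (ξ : H) : eigProj a z ξ ∈ eigSpace a z :=
  Submodule.starProjection_apply_mem _ _

theorem norm_eigProj_le (a : H →L[ℂ] H) (z : ℂ) (ξ : H) : ‖eigProj a z ξ‖ ≤ ‖ξ‖ :=
  Submodule.norm_starProjection_apply_le _ _

theorem inner_eigProj_self (a : H →L[ℂ] H) (z : ℂ) (ξ : H) :
    RCLike.re (inner ℂ (eigProj a z ξ) ξ) = ‖eigProj a z ξ‖ ^ 2 := by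
  have h : inner ℂ (ξ - eigProj a z ξ) (eigProj a z ξ) = 0 :=
    Submodule.starProjection_inner_eq_zero ξ _ (eigProj_mem a z ξ)
  rw [inner_sub_left, sub_eq_zero] at h
  rw [inner_re_symm, h, inner_self_eq_norm_sq]

theorem orthogonalFamily_eigSpace (a : H →L[ℂ] H) (ha : IsStarNormal a) :
    OrthogonalFamily ℂ (fun z => eigSpace a z) fun z => (eigSpace a z).subtypeₗᵢ := by
  have key : ∀ (z : ℂ) (ξ : H), a ξ = z • ξ →
      ContinuousLinearMap.adjoint a ξ = (starRingEnd ℂ z) • ξ := by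
    intro z ξ hξ
    have hn : IsStarNormal (a - algebraMap ℂ (H →L[ℂ] H) z) := by
      refine ⟨?_⟩
      have h := ha.star_comm_self
      rw [star_sub, ← algebraMap_star_comm]
      exact ((h.sub_right (Algebra.commutes z _).symm).sub_left
        ((Algebra.commutes (star z) _)))
    have h0 : (a - algebraMap ℂ (H →L[ℂ] H) z) ξ = 0 := by
      simp [Algebra.algebraMap_eq_smul_one, hξ]
    have h1 := (ContinuousLinearMap.IsStarNormal.adjoint_apply_eq_zero_iff hn ξ).2 h0
    rw [← ContinuousLinearMap.star_eq_adjoint, star_sub, ← algebraMap_star_comm,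
      sub_apply, sub_eq_zero] at h1
    rw [← ContinuousLinearMap.star_eq_adjoint, h1]
    simp [Algebra.algebraMap_eq_smul_one]
  intro z w hzw ⟨ξ, hξ⟩ ⟨η, hη⟩
  rw [mem_eigSpace] at hξ hη
  change inner ℂ ξ η = 0
  have h1 : inner ℂ (ContinuousLinearMap.adjoint a ξ) η = inner ℂ ξ (a η) :=
    ContinuousLinearMap.adjoint_inner_left a η ξ
  rw [key z ξ hξ, hη, inner_smul_left, inner_smul_right, RingHomCompTriple.comp_apply] at h1
  have h2 : (z - w) * inner ℂ ξ η = 0 := by rw [sub_mul]; simpa using sub_eq_zero.2 h1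
  exact (mul_eq_zero.1 h2).resolve_left (sub_ne_zero.2 hzw)

theorem sum_norm_eigProj_sq_le (a : H →L[ℂ] H) (ha : IsStarNormal a) (ξ : H) (s : Finset ℂ) :
    ∑ z ∈ s, ‖eigProj a z ξ‖ ^ 2 ≤ ‖ξ‖ ^ 2 := by
  have h1 : ‖∑ z ∈ s, eigProj a z ξ‖ ^ 2 = ∑ z ∈ s, ‖eigProj a z ξ‖ ^ 2 :=
    (orthogonalFamily_eigSpace a ha).norm_sum (fun z => ⟨eigProj a z ξ, eigProj_mem a z ξ⟩) s
  have h2 : RCLike.re (inner ℂ (∑ z ∈ s, eigProj a z ξ) ξ) = ∑ z ∈ s, ‖eigProj a z ξ‖ ^ 2 := by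
    rw [sum_inner, map_sum]
    exact Finset.sum_congr rfl fun z _ => inner_eigProj_self a z ξ
  have h3 := (RCLike.re_le_norm _).trans (norm_inner_le_norm (𝕜 := ℂ) (∑ z ∈ s, eigProj a z ξ) ξ)
  rw [h2, ← h1] at h3
  rw [← h1]
  have h4 := norm_nonneg (∑ z ∈ s, eigProj a z ξ)
  have h5 := norm_nonneg ξ
  rcases h4.eq_or_lt with h | h
  · rw [← h, zero_pow two_ne_zero]; exact sq_nonneg _
  · have : ‖∑ z ∈ s, eigProj a z ξ‖ ≤ ‖ξ‖ := by
      rw [pow_two] at h3; exact le_of_mul_le_mul_left h3 h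
    gcongr

theorem sum_norm_block_sq_le (a : H →L[ℂ] H) (ha : IsStarNormal a) (x : H →L[ℂ] H) (ξ : H)
    (s : Finset ℂ) : ∑ z ∈ s, ‖eigProj a z (x (eigProj a z ξ))‖ ^ 2 ≤ (‖x‖ * ‖ξ‖) ^ 2 := by
  have h : ∀ z ∈ s, ‖eigProj a z (x (eigProj a z ξ))‖ ^ 2 ≤ ‖x‖ ^ 2 * ‖eigProj a z ξ‖ ^ 2 := by
    intro z _
    rw [← mul_pow]
    have := (norm_eigProj_le a z (x (eigProj a z ξ))).trans (x.le_opNorm _)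
    gcongr
  refine (Finset.sum_le_sum h).trans ?_
  rw [← Finset.mul_sum, mul_pow]
  have := sum_norm_eigProj_sq_le a ha ξ s
  gcongr

theorem summable_block (a : H →L[ℂ] H) (ha : IsStarNormal a) (x : H →L[ℂ] H) (ξ : H) :
    Summable fun z : ℂ => eigProj a z (x (eigProj a z ξ)) := by
  refine ((orthogonalFamily_eigSpace a ha).summable_iff_norm_sq_summable
    (fun z => ⟨eigProj a z (x (eigProj a z ξ)), eigProj_mem a z _⟩)).2 ?_
  exact summable_of_sum_le (fun z => by positivity) (sum_norm_block_sq_le a ha x ξ)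

theorem norm_tsum_block_le (a : H →L[ℂ] H) (ha : IsStarNormal a) (x : H →L[ℂ] H) (ξ : H) :
    ‖∑' z : ℂ, eigProj a z (x (eigProj a z ξ))‖ ≤ ‖x‖ * ‖ξ‖ := by
  refine le_of_tendsto (summable_block a ha x ξ).hasSum.norm (Filter.Eventually.of_forall fun s => ?_)
  have h1 : ‖∑ z ∈ s, eigProj a z (x (eigProj a z ξ))‖ ^ 2
      = ∑ z ∈ s, ‖eigProj a z (x (eigProj a z ξ))‖ ^ 2 :=
    (orthogonalFamily_eigSpace a ha).norm_sum
      (fun z => ⟨eigProj a z (x (eigProj a z ξ)), eigProj_mem a z _⟩) s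
  exact le_of_sq_le_sq (h1.le.trans (sum_norm_block_sq_le a ha x ξ s)) (by positivity)

/-- The diagonal conditional expectation `E(x) = ∑ p_z x p_z` of a normal operator `a`, where `p_z` is
the orthogonal projection onto `ker (a - z)`, the sum runs over all eigenvalues `z` of `a` (all other
`z` contribute `0`), and it converges in the strong operator topology. -/
def diagonalExpectation (a : H →L[ℂ] H) (ha : IsStarNormal a) :
    (H →L[ℂ] H) →ₗ[ℂ] (H →L[ℂ] H) where
  toFun x := LinearMap.mkContinuous
    { toFun := fun ξ => ∑' z : ℂ, eigProj a z (x (eigProj a z ξ))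
      map_add' := fun ξ η => by
        simp only [map_add]
        exact (summable_block a ha x ξ).tsum_add (summable_block a ha x η)
      map_smul' := fun c ξ => by
        simp only [map_smul, RingHom.id_apply]
        exact (summable_block a ha x ξ).tsum_const_smul c }
    ‖x‖ (norm_tsum_block_le a ha x)
  map_add' x y := by
    ext ξ
    simpa using (summable_block a ha x ξ).tsum_add (summable_block a ha y ξ)
  map_smul' c x := by
    ext ξ
    simpa using (summable_block a ha x ξ).tsum_const_smul c

theorem hasSum_diagonalExpectation (a : H →L[ℂ] H) (ha : IsStarNormal a) (x : H →L[ℂ] H) (ξ : H) :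
    HasSum (fun z : ℂ => eigProj a z (x (eigProj a z ξ))) (diagonalExpectation a ha x ξ) :=
  (summable_block a ha x ξ).hasSum

end Expectation

/-! ### Symmetrically normed ideals -/

/-- A symmetrically normed ideal of the algebra of bounded operators on `H`: a two-sided ideal which is
a Banach space for a norm satisfying `‖a x b‖_J ≤ ‖a‖ ‖x‖_J ‖b‖`, normalized on rank-one
projections. -/
structure SymmetricallyNormedIdeal (H : Type*) [NormedAddCommGroup H] [InnerProductSpace ℂ H]
    [CompleteSpace H] where
  /-- the underlying two-sided ideal -/
  ideal : Submodule ℂ (H →L[ℂ] H)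
  mul_mem_left : ∀ a x : H →L[ℂ] H, x ∈ ideal → a * x ∈ ideal
  mul_mem_right : ∀ x a : H →L[ℂ] H, x ∈ ideal → x * a ∈ ideal
  /-- the norm of the ideal -/
  idealNorm : Seminorm ℂ ideal
  eq_zero_of_idealNorm_eq_zero : ∀ x : ideal, idealNorm x = 0 → x = 0
  idealNorm_mul_mul_le : ∀ (a b : H →L[ℂ] H) (x : ideal),
    idealNorm ⟨a * (x : H →L[ℂ] H) * b, mul_mem_right _ b (mul_mem_left a _ x.2)⟩
      ≤ ‖a‖ * idealNorm x * ‖b‖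
  complete : ∀ s : ℕ → ideal,
    (∀ ε : ℝ, 0 < ε → ∃ N : ℕ, ∀ m ≥ N, ∀ n ≥ N, idealNorm (s m - s n) < ε) →
      ∃ x : ideal, ∀ ε : ℝ, 0 < ε → ∃ N : ℕ, ∀ n ≥ N, idealNorm (s n - x) < ε
  idealNorm_rankOne : ∀ (ξ : H) (hξ : InnerProductSpace.rankOne ℂ ξ ξ ∈ ideal), ‖ξ‖ = 1 →
    idealNorm ⟨InnerProductSpace.rankOne ℂ ξ ξ, hξ⟩ = 1

namespace SymmetricallyNormedIdeal

variable {H : Type*} [NormedAddCommGroup H] [InnerProductSpace ℂ H] [CompleteSpace H]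
  (J : SymmetricallyNormedIdeal H)

/-- The ideal `J` is arithmetically mean closed. -/
def IsArithmeticallyMeanClosed : Prop :=
  ∀ x y : H →L[ℂ] H, IsCompactOperator x → IsCompactOperator y →
    (∀ n : ℕ, ∑ k ∈ Finset.range n, singularValue x k ≤ ∑ k ∈ Finset.range n, singularValue y k) →
      y ∈ J.ideal → x ∈ J.ideal

/-- The ideal `J` as a complex Banach space with its own norm (and not with the operator norm). -/
def Space : Type _ := J.ideal

instance : AddCommGroup J.Space := inferInstanceAs (AddCommGroup J.ideal)

instance : Module ℂ J.Space := inferInstanceAs (Module ℂ J.ideal)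

instance : NormedAddCommGroup J.Space :=
  AddGroupNorm.toNormedAddCommGroup
    { toFun := fun x => J.idealNorm x
      map_zero' := map_zero J.idealNorm
      add_le' := map_add_le_add J.idealNorm
      neg' := map_neg_eq_map J.idealNorm
      eq_zero_of_map_eq_zero' := J.eq_zero_of_idealNorm_eq_zero }

theorem norm_def (x : J.Space) : ‖x‖ = J.idealNorm x := rfl

instance : NormedSpace ℂ J.Space where
  norm_smul_le c x := (map_smul_eq_mul J.idealNorm c x).le

instance : CompleteSpace J.Space := by
  refine Metric.complete_of_cauchySeq_tendsto fun s hs => ?_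
  rw [Metric.cauchySeq_iff] at hs
  obtain ⟨x, hx⟩ := J.complete s fun ε hε => by
    obtain ⟨N, hN⟩ := hs ε hε
    exact ⟨N, fun m hm n hn => by
      have h := hN m hm n hn
      rwa [dist_eq_norm] at h⟩
  refine ⟨(x : J.Space), Metric.tendsto_atTop.2 fun ε hε => ?_⟩
  obtain ⟨N, hN⟩ := hx ε hε
  exact ⟨N, fun n hn => (dist_eq_norm (s n) (show J.Space from x)).trans_lt (hN n hn)⟩

/-- The inclusion of the Banach space `J` into the space of all bounded operators. -/
def incl : J.Space →ₗ[ℂ] (H →L[ℂ] H) := J.ideal.subtype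

theorem incl_injective : Function.Injective J.incl := Subtype.val_injective

theorem incl_mem (x : J.Space) : J.incl x ∈ J.ideal := x.2

theorem norm_incl_le (x : J.Space) : ‖J.incl x‖ ≤ ‖x‖ := by
  refine ContinuousLinearMap.opNorm_le_of_unit_norm (norm_nonneg _) fun ξ hξ => ?_
  by_cases hη : J.incl x ξ = 0
  · simp [hη]
  have hη' : 0 < ‖J.incl x ξ‖ := norm_pos_iff.2 hη
  have hc : ((‖J.incl x ξ‖ : ℂ) ^ 2) ≠ 0 := pow_ne_zero 2 (by exact_mod_cast hη'.ne')
  have key : InnerProductSpace.rankOne ℂ ξ (J.incl x ξ) * J.incl x * InnerProductSpace.rankOne ℂ ξ ξ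
      = ((‖J.incl x ξ‖ : ℂ) ^ 2) • InnerProductSpace.rankOne ℂ ξ ξ := by
    ext ζ
    simp [smul_smul, mul_comm, inner_self_eq_norm_sq_to_K]
  have hmem : InnerProductSpace.rankOne ℂ ξ ξ ∈ J.ideal := by
    have h := J.mul_mem_right _ (InnerProductSpace.rankOne ℂ ξ ξ)
      (J.mul_mem_left (InnerProductSpace.rankOne ℂ ξ (J.incl x ξ)) _ (J.incl_mem x))
    rw [key] at h
    exact (J.ideal.smul_mem_iff hc).1 h
  have h1 := J.idealNorm_mul_mul_le (InnerProductSpace.rankOne ℂ ξ (J.incl x ξ))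
    (InnerProductSpace.rankOne ℂ ξ ξ) x
  have h2 : (⟨InnerProductSpace.rankOne ℂ ξ (J.incl x ξ) * J.incl x *
        InnerProductSpace.rankOne ℂ ξ ξ, J.mul_mem_right _ _ (J.mul_mem_left _ _ (J.incl_mem x))⟩ :
      J.ideal) = ((‖J.incl x ξ‖ : ℂ) ^ 2) • ⟨InnerProductSpace.rankOne ℂ ξ ξ, hmem⟩ :=
    Subtype.ext key
  have h3 : ‖J.incl x ξ‖ ^ 2 ≤ ‖J.incl x ξ‖ * ‖x‖ := by
    have h4 := (congrArg J.idealNorm h2).symm.le.trans h1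
    rw [map_smul_eq_mul, J.idealNorm_rankOne ξ hmem hξ] at h4
    simpa [hξ, norm_def] using h4
  rw [pow_two] at h3
  exact le_of_mul_le_mul_left h3 hη'

theorem continuous_incl : Continuous J.incl :=
  AddMonoidHomClass.continuous_of_bound J.incl 1 fun x => by simpa using J.norm_incl_le x

/-- The real Banach space `𝔲_J = {x ∈ J | x⋆ = -x}` of skew-adjoint elements of `J`. -/
def skew : Submodule ℝ J.Space where
  carrier := {x | star (J.incl x) = -J.incl x}
  add_mem' {x y} hx hy := by
    simp only [Set.mem_ofPred_eq, map_add, star_add] at *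
    rw [hx, hy]; abel
  zero_mem' := by simp
  smul_mem' c x hx := by
    have h : J.incl (c • x) = (c : ℂ) • J.incl x := J.incl.map_smul (c : ℂ) x
    simp only [Set.mem_ofPred_eq] at *
    rw [h, star_smul, hx]
    simp

instance : CompleteSpace J.skew := by
  have h : IsClosed (J.skew : Set J.Space) :=
    isClosed_eq J.continuous_incl.star J.continuous_incl.neg
  exact h.completeSpace_coe

/-! ### The unitary group `U_J`, its adjoint action, isotropy groups and orbits -/

/-- The unitary operators in `1 + J`, as a subgroup of the group of all unitary operators. -/
def unitarySubgroup : Subgroup (unitary (H →L[ℂ] H)) where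
  carrier := {u | (u : H →L[ℂ] H) - 1 ∈ J.ideal}
  one_mem' := by simp
  mul_mem' {u v} hu hv := by
    have h : ((u * v : unitary (H →L[ℂ] H)) : H →L[ℂ] H) - 1
        = (u : H →L[ℂ] H) * ((v : H →L[ℂ] H) - 1) + ((u : H →L[ℂ] H) - 1) := by
      push_cast; noncomm_ring
    simp only [Set.mem_ofPred_eq] at *
    rw [h]
    exact J.ideal.add_mem (J.mul_mem_left _ _ hv) hu
  inv_mem' {u} hu := by
    have h : ((u⁻¹ : unitary (H →L[ℂ] H)) : H →L[ℂ] H) - 1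
        = -(((u⁻¹ : unitary (H →L[ℂ] H)) : H →L[ℂ] H) * ((u : H →L[ℂ] H) - 1)) := by
      have h' : ((u⁻¹ : unitary (H →L[ℂ] H)) : H →L[ℂ] H) * (u : H →L[ℂ] H) = 1 := by
        exact congrArg (fun w : unitary (H →L[ℂ] H) => (w : H →L[ℂ] H)) (inv_mul_cancel u)
      rw [mul_sub, h']; simp
    simp only [Set.mem_ofPred_eq] at *
    rw [h]
    exact J.ideal.neg_mem (J.mul_mem_left _ _ hu)

/-- The group `U_J` of unitary operators in `1 + J`. Its topology, defined below, comes from the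
norm of `J`, and not from the operator norm. -/
def UnitaryGroup : Type _ := J.unitarySubgroup

instance : Group J.UnitaryGroup := inferInstanceAs (Group J.unitarySubgroup)

/-- The inclusion of `U_J` into the group of all unitary operators. -/
def toUnitary : J.UnitaryGroup →* unitary (H →L[ℂ] H) := J.unitarySubgroup.subtype

/-- The map `U_J → J`, `u ↦ u - 1`, which identifies `U_J` with a subset of the Banach space `J`. -/
def subOne (u : J.UnitaryGroup) : J.Space :=
  ⟨(J.toUnitary u : H →L[ℂ] H) - 1, u.2⟩

/-- The topology of `U_J` given by the distance `‖u - v‖_J`. -/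
instance : TopologicalSpace J.UnitaryGroup := TopologicalSpace.induced J.subOne inferInstance

/-- The adjoint action of `U_J` on bounded operators, `(u, b) ↦ u b u⋆`. -/
def adjointAction (u : J.UnitaryGroup) (b : H →L[ℂ] H) : H →L[ℂ] H :=
  (J.toUnitary u : H →L[ℂ] H) * b * star (J.toUnitary u : H →L[ℂ] H)

theorem adjointAction_one (b : H →L[ℂ] H) : J.adjointAction 1 b = b := by
  simp [adjointAction]

theorem adjointAction_mul (u v : J.UnitaryGroup) (b : H →L[ℂ] H) :
    J.adjointAction (u * v) b = J.adjointAction u (J.adjointAction v b) := by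
  simp [adjointAction, mul_assoc]

/-- The isotropy group `U_J(a) = {u ∈ U_J | u a u⋆ = a}`. As a subgroup of `U_J` it carries the
subspace topology. -/
def isotropy (a : H →L[ℂ] H) : Subgroup J.UnitaryGroup where
  carrier := {u | J.adjointAction u a = a}
  one_mem' := J.adjointAction_one a
  mul_mem' {u v} hu hv := by
    simp only [Set.mem_ofPred_eq] at *
    rw [J.adjointAction_mul, hv, hu]
  inv_mem' {u} hu := by
    simp only [Set.mem_ofPred_eq] at *
    conv_lhs => rw [← hu]
    rw [← J.adjointAction_mul, inv_mul_cancel, J.adjointAction_one]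

/-- The orbit `O_J(a) = {u a u⋆ | u ∈ U_J}`. Its topology, defined below, is the quotient topology
of `U_J / U_J(a)`, and not the one of the space of bounded operators. -/
def Orbit (a : H →L[ℂ] H) : Type _ := {b : H →L[ℂ] H // ∃ u : J.UnitaryGroup, J.adjointAction u a = b}

/-- The orbit map `U_J → O_J(a)`, `u ↦ u a u⋆`. -/
def orbitMap (a : H →L[ℂ] H) (u : J.UnitaryGroup) : J.Orbit a := ⟨J.adjointAction u a, u, rfl⟩

/-- The topology on the orbit for which the bijection `U_J / U_J(a) → O_J(a)` is a homeomorphism. -/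
instance (a : H →L[ℂ] H) : TopologicalSpace (J.Orbit a) :=
  TopologicalSpace.coinduced (J.orbitMap a) inferInstance

/-- The action of `U_J` on the orbit, `(u, b) ↦ u b u⋆`. -/
instance (a : H →L[ℂ] H) : MulAction J.UnitaryGroup (J.Orbit a) where
  smul u b := ⟨J.adjointAction u b.1, by
    obtain ⟨v, hv⟩ := b.2
    exact ⟨u * v, by rw [J.adjointAction_mul, hv]⟩⟩
  one_smul b := Subtype.ext (J.adjointAction_one b.1)
  mul_smul u v b := Subtype.ext (J.adjointAction_mul u v b.1)

/-! ### The Lie algebra `𝔲_J` and the kernel of the differential of the orbit map -/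

theorem commutator_mem (x y : J.Space) : J.incl x * J.incl y - J.incl y * J.incl x ∈ J.ideal :=
  J.ideal.sub_mem (J.mul_mem_left _ _ (J.incl_mem y)) (J.mul_mem_left _ _ (J.incl_mem x))

/-- The commutator bracket on `𝔲_J`. -/
instance : Bracket J.skew J.skew where
  bracket x y := ⟨⟨J.incl x * J.incl y - J.incl y * J.incl x, J.commutator_mem x y⟩, by
    have hx : star (J.incl x) = -J.incl x := x.2
    have hy : star (J.incl y) = -J.incl y := y.2
    change star (J.incl x * J.incl y - J.incl y * J.incl x)
      = -(J.incl x * J.incl y - J.incl y * J.incl x)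
    rw [star_sub, star_mul, star_mul, hx, hy]
    noncomm_ring⟩

theorem incl_bracket (x y : J.skew) :
    J.incl (⁅x, y⁆ : J.skew) = J.incl x * J.incl y - J.incl y * J.incl x := rfl

theorem skew_ext {x y : J.skew} (h : J.incl x = J.incl y) : x = y :=
  Subtype.ext (J.incl_injective h)

theorem incl_add (x y : J.skew) : J.incl (x + y : J.skew) = J.incl x + J.incl y :=
  J.incl.map_add x y

theorem incl_smul (c : ℝ) (x : J.skew) : J.incl (c • x : J.skew) = (c : ℂ) • J.incl x :=
  J.incl.map_smul (c : ℂ) x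

instance : LieRing J.skew where
  add_lie x y z := J.skew_ext <| by simp only [incl_bracket, incl_add]; noncomm_ring
  lie_add x y z := J.skew_ext <| by simp only [incl_bracket, incl_add]; noncomm_ring
  lie_self x := J.skew_ext <| by rw [incl_bracket, sub_self]; exact J.incl.map_zero.symm
  leibniz_lie x y z := J.skew_ext <| by simp only [incl_bracket, incl_add]; noncomm_ring

instance : LieAlgebra ℝ J.skew where
  lie_smul c x y := J.skew_ext <| by
    simp only [incl_bracket, incl_smul, mul_smul_comm, smul_mul_assoc, smul_sub]

/-- The map `δ_a : 𝔲_J → B(H)`, `x ↦ [x, a] = x a - a x`. -/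
def commutatorMap (a : H →L[ℂ] H) : J.skew →ₗ[ℝ] (H →L[ℂ] H) where
  toFun x := J.incl x * a - a * J.incl x
  map_add' x y := by simp only [incl_add]; noncomm_ring
  map_smul' c x := by
    simp only [incl_smul, mul_smul_comm, smul_mul_assoc, smul_sub, RingHom.id_apply]
    rfl

/-- The kernel of `δ_a : 𝔲_J → B(H)`, as a Lie subalgebra of `𝔲_J`. -/
def kerCommutator (a : H →L[ℂ] H) : LieSubalgebra ℝ J.skew where
  toSubmodule := LinearMap.ker (J.commutatorMap a)
  lie_mem' {x y} hx hy := by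
    have hx' : J.incl x * a - a * J.incl x = 0 := hx
    have hy' : J.incl y * a - a * J.incl y = 0 := hy
    change (J.incl x * J.incl y - J.incl y * J.incl x) * a
      - a * (J.incl x * J.incl y - J.incl y * J.incl x) = 0
    have e : (J.incl x * J.incl y - J.incl y * J.incl x) * a
        - a * (J.incl x * J.incl y - J.incl y * J.incl x)
        = (J.incl x * a - a * J.incl x) * J.incl y + J.incl x * (J.incl y * a - a * J.incl y)
          - ((J.incl y * a - a * J.incl y) * J.incl x
            + J.incl y * (J.incl x * a - a * J.incl x)) := by noncomm_ring
    rw [e, hx', hy']; simp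

/-- The kernel of the restriction to `𝔲_J` of the diagonal conditional expectation of `a`. -/
def kerExpectation (a : H →L[ℂ] H) (ha : IsStarNormal a) : Submodule ℝ J.skew where
  carrier := {x | diagonalExpectation a ha (J.incl x) = 0}
  add_mem' {x y} hx hy := by
    simp only [Set.mem_ofPred_eq] at *
    rw [incl_add, map_add, hx, hy, add_zero]
  zero_mem' := by
    change diagonalExpectation a ha (J.incl 0) = 0
    rw [map_zero, map_zero]
  smul_mem' c x hx := by
    simp only [Set.mem_ofPred_eq] at *
    rw [incl_smul, map_smul, hx, smul_zero]

end SymmetricallyNormedIdeal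

end

/-! Arithmetic mean closedness enters through one fact: the diagonal expectation `E` maps `J` into
itself. By Ky Fan's maximum principle, the sum of the first `n` singular values of a compact `x` is
the maximum of `Re ∑ ⟨f i, x (g i)⟩` over Bessel families `f`, `g` of `n` vectors, and a bound of
this form survives multiplication by contractions, averages and strong limits. A pinching `p x p +
(1 - p) x (1 - p)` is the average of `x` and its conjugate by the reflection `2 p - 1`. Hence `E`, a
strong limit of compressed iterated pinchings, does not increase these sums, and `E(x)` lies in `J`
whenever `x` does. A noncompact element of `J` forces `J` to be all of `B(H)`, so this case is
harmless. The closed graph theorem makes `E` continuous for the norm of `J`. As the eigenprojections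
of a compact normal `a` sum strongly to `1`, `E` restricts to a projection of `𝔲_J` onto the
commutant of `a`, and its range and kernel are the two summands of the splitting
(`isTopCompl_kerCommutator_kerExpectation`).

For the groups, write `u = 1 + v`. The Cayley transform `v ↦ v (1 + v / 2)⁻¹` is an analytic local
diffeomorphism of `J` which makes `1 + v` unitary exactly when the image is skew-adjoint, and which
preserves and reflects commutation with `a`. Its left translates are therefore slice charts for
`U_J` and for `U_J(a)` simultaneously. Product and inverse are restrictions of continuous real
polynomial maps of `J`; left-invariant fields are restrictions of the affine fields `v ↦ (1 + v) x`,
whose bracket at `0` is the commutator.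

For the orbit, let `p` and `q` be the projections of `𝔲_J` onto `ker E` and onto the commutant, and
let `c` be the inverse Cayley transform. By the inverse function theorem `x ↦ c(p x) c(q x)`
parametrizes `U_J` near `1`. The second factor lies in `U_J(a)`, so the orbit map depends on `p x`
only, and on a small enough domain it determines `p x` (`nonempty_homogeneousChart`). Thus `p x` is
a coordinate on the orbit near `a`; translating it by the group gives an atlas in which the orbit
map is a linear projection. -/

noncomputable section

/-! ### Factorization of operators and the modulus -/

section OperatorTheory

variable {H : Type*} [NormedAddCommGroup H] [InnerProductSpace ℂ H] [CompleteSpace H]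

/-- **Douglas' factorization lemma**: if `‖A ξ‖ ≤ ‖B ξ‖` for all `ξ`, then `A` is a left multiple
of `B`. -/
theorem exists_eq_mul_of_norm_apply_le {A B : H →L[ℂ] H} (h : ∀ ξ, ‖A ξ‖ ≤ ‖B ξ‖) :
    ∃ C : H →L[ℂ] H, A = C * B := by
  let M : Submodule ℂ H := (LinearMap.range B.toLinearMap).topologicalClosure
  have : CompleteSpace M :=
    (Submodule.isClosed_topologicalClosure (LinearMap.range B.toLinearMap)).completeSpace_coe
  let e : H →ₗ[ℂ] M := B.toLinearMap.codRestrict M fun ξ =>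
    Submodule.le_topologicalClosure _ ⟨ξ, rfl⟩
  have hd : DenseRange e := by
    intro y
    have hy : (y : H) ∈ closure (Set.range B) := y.2
    rw [Topology.IsInducing.subtypeVal.closure_eq_preimage_closure_image]
    convert! hy using 2
    rw [← Set.range_comp]
    rfl
  -- The assignment `B ξ ↦ A ξ` is well defined and contractive by `h`; it extends to the closure
  -- `M` of the range of `B`, and is continued by `0` on `Mᗮ`.
  refine ⟨(A.toLinearMap.extendOfNorm e) ∘L M.orthogonalProjectionOnto, ?_⟩
  ext ξ
  have h1 : M.orthogonalProjectionOnto (B ξ) = e ξ :=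
    M.orthogonalProjectionOnto_mem_subspace_eq_self (e ξ)
  have h2 := LinearMap.extendOfNorm_eq (f := A.toLinearMap) hd
    ⟨1, fun x => by simpa [e] using! h x⟩ ξ
  simp only [mul_apply_eq_comp, ContinuousLinearMap.comp_apply]
  rw [h1, h2]
  rfl

theorem inner_cfcAbs_apply (x : H →L[ℂ] H) (ξ η : H) :
    inner ℂ (CFC.abs x ξ) (CFC.abs x η) = inner ℂ (x ξ) (x η) := by
  have hs : star (CFC.abs x) = CFC.abs x := (CFC.abs_nonneg x).isSelfAdjoint.star_eq
  have h1 : inner ℂ (CFC.abs x ξ) (CFC.abs x η) = inner ℂ ((CFC.abs x * CFC.abs x) ξ) η := by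
    conv_rhs => rw [← hs]
    rw [hs, mul_apply_eq_comp]
    conv_rhs => rw [← hs, ContinuousLinearMap.star_eq_adjoint,
      ContinuousLinearMap.adjoint_inner_left, ← ContinuousLinearMap.star_eq_adjoint, hs]
  rw [h1, CFC.abs_mul_abs, mul_apply_eq_comp, ContinuousLinearMap.star_eq_adjoint,
    ContinuousLinearMap.adjoint_inner_left]

theorem norm_cfcAbs_apply (x : H →L[ℂ] H) (ξ : H) : ‖CFC.abs x ξ‖ = ‖x ξ‖ := by
  have h := inner_cfcAbs_apply x ξ ξ
  rw [inner_self_eq_norm_sq_to_K, inner_self_eq_norm_sq_to_K] at h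
  have h' : ‖CFC.abs x ξ‖ ^ 2 = ‖x ξ‖ ^ 2 := by exact_mod_cast h
  exact (pow_left_inj₀ (norm_nonneg _) (norm_nonneg _) two_ne_zero).1 h'

theorem exists_cfcAbs_eq_mul (x : H →L[ℂ] H) : ∃ w : H →L[ℂ] H, CFC.abs x = w * x :=
  exists_eq_mul_of_norm_apply_le fun ξ => (norm_cfcAbs_apply x ξ).le

theorem exists_eq_mul_cfcAbs (x : H →L[ℂ] H) : ∃ w : H →L[ℂ] H, x = w * CFC.abs x :=
  exists_eq_mul_of_norm_apply_le fun ξ => (norm_cfcAbs_apply x ξ).ge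

/-- Douglas' lemma replaces the polar decomposition: from `|x| = w x` and `x = u |x|` follows `x⋆ =
|x| u⋆ = w x u⋆`. Consequently every two-sided ideal is self-adjoint. -/
theorem exists_star_eq_mul_mul (x : H →L[ℂ] H) : ∃ u v : H →L[ℂ] H, star x = u * x * v := by
  obtain ⟨w, hw⟩ := exists_cfcAbs_eq_mul x
  obtain ⟨u, hu⟩ := exists_eq_mul_cfcAbs x
  refine ⟨w, star u, ?_⟩
  rw [← hw]
  conv_lhs => rw [hu]
  rw [star_mul, (CFC.abs_nonneg x).isSelfAdjoint.star_eq]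

omit [CompleteSpace H] in
theorem IsCompactOperator.mul_left {x : H →L[ℂ] H} (hx : IsCompactOperator x) (b : H →L[ℂ] H) :
    IsCompactOperator (b * x : H →L[ℂ] H) := hx.clm_comp b

theorem isCompactOperator_cfcAbs {x : H →L[ℂ] H} :
    IsCompactOperator (CFC.abs x : H →L[ℂ] H) ↔ IsCompactOperator x := by
  constructor
  · obtain ⟨w, hw⟩ := exists_eq_mul_cfcAbs x
    intro h
    rw [hw]
    exact h.mul_left w
  · obtain ⟨w, hw⟩ := exists_cfcAbs_eq_mul x
    intro h
    rw [hw]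
    exact h.mul_left w

namespace SymmetricallyNormedIdeal

variable (J : SymmetricallyNormedIdeal H)

theorem star_mem {x : H →L[ℂ] H} (hx : x ∈ J.ideal) : star x ∈ J.ideal := by
  obtain ⟨u, v, h⟩ := exists_star_eq_mul_mul x
  rw [h]
  exact J.mul_mem_right _ _ (J.mul_mem_left _ _ hx)

end SymmetricallyNormedIdeal

end OperatorTheory

/-! ### Singular values and Schmidt vectors of compact operators -/

section SingularValues

/-- The norm of a self-adjoint operator is its spectral radius, so it equals `|k|` for some `k` in
the spectrum. If `T ≠ 0`, compactness makes `k` an eigenvalue, and positivity excludes `k = -‖T‖`.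
-/
theorem exists_norm_eigenvector {E : Type*} [NormedAddCommGroup E] [InnerProductSpace ℂ E]
    [CompleteSpace E] [Nontrivial E] {T : E →L[ℂ] E} (hT : IsCompactOperator T)
    (hs : T.IsSymmetric) (hp : ∀ ξ, 0 ≤ RCLike.re (inner ℂ ξ (T ξ))) :
    ∃ e : E, ‖e‖ = 1 ∧ T e = (‖T‖ : ℂ) • e := by
  by_cases h0 : T = 0
  · obtain ⟨e, he⟩ := exists_norm_eq E zero_le_one
    exact ⟨e, he, by simp [h0]⟩
  obtain ⟨k, hk, hkn⟩ := spectrum.exists_nnnorm_eq_spectralRadius T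
  rw [T.spectralRadius_eq_nnnorm hs.isSelfAdjoint, ENNReal.coe_inj] at hkn
  have hkn' : ‖k‖ = ‖T‖ := congrArg NNReal.toReal hkn
  have hk0 : k ≠ 0 := by
    rw [← norm_pos_iff, hkn']
    exact norm_pos_iff.2 h0
  have hev := (hT.hasEigenvalue_iff_mem_spectrum hk0).2 hk
  have hreal : ((k.re : ℝ) : ℂ) = k := Complex.conj_eq_iff_re.1 (hs.conj_eigenvalue_eq_self hev)
  rw [← hreal] at hev
  have hnn : 0 ≤ k.re := eigenvalue_nonneg_of_nonneg (𝕜 := ℂ) hev hp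
  have hkT : k.re = ‖T‖ := by
    rw [← hkn', ← hreal]
    simp [abs_of_nonneg hnn]
  obtain ⟨v, hv⟩ := hev.exists_hasEigenvector
  have hv0 : ‖v‖ ≠ 0 := norm_ne_zero_iff.2 hv.2
  refine ⟨((‖v‖⁻¹ : ℝ) : ℂ) • v, ?_, ?_⟩
  · rw [norm_smul]
    simp [hv0]
  · have := hv.apply_eq_smul
    rw [map_smul, ← hkT, smul_comm]
    congr 1

variable {H : Type*} [NormedAddCommGroup H] [InnerProductSpace ℂ H] [CompleteSpace H]

/-- The inductive step of the spectral theorem: `Sᗮ` is invariant by symmetry and nonzero because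
`H` is infinite-dimensional, so the restriction of `T` to it attains its norm at an eigenvector. -/
theorem exists_eigenvector_orthogonal (hH : ¬ FiniteDimensional ℂ H) {T : H →L[ℂ] H}
    (hT : IsCompactOperator T) (hs : T.IsSymmetric) (hp : ∀ ξ, 0 ≤ RCLike.re (inner ℂ ξ (T ξ)))
    (S : Submodule ℂ H) [FiniteDimensional ℂ S] (hS : ∀ ξ ∈ S, T ξ ∈ S) :
    ∃ (e : H) (l : ℝ), e ∈ Sᗮ ∧ ‖e‖ = 1 ∧ 0 ≤ l ∧ T e = (l : ℂ) • e ∧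
      ∀ ξ ∈ Sᗮ, ‖T ξ‖ ≤ l * ‖ξ‖ := by
  have hinv : ∀ ξ ∈ Sᗮ, T ξ ∈ Sᗮ := by
    intro ξ hξ η hη
    rw [← hs.apply_clm η ξ]
    exact hξ _ (hS η hη)
  have : Nontrivial Sᗮ := by
    rw [Submodule.nontrivial_iff_ne_bot]
    intro h
    have h2 : S = ⊤ := Submodule.orthogonal_eq_bot_iff.1 h
    subst h2
    exact hH (Submodule.topEquiv.finiteDimensional)
  let R : Sᗮ →L[ℂ] Sᗮ := T.restrict hinv
  have hRc : IsCompactOperator R := hT.restrict' hinv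
  have hRs : R.IsSymmetric := hs.restrict_invariant hinv
  obtain ⟨e, he1, he2⟩ := exists_norm_eigenvector hRc hRs fun ξ => hp ξ
  refine ⟨e, ‖R‖, e.2, he1, R.opNorm_nonneg, congrArg Subtype.val he2, fun ξ hξ => ?_⟩
  exact R.le_opNorm ⟨ξ, hξ⟩

/-- The eigenvalues of a compact positive operator, in decreasing order. -/
theorem exists_eigenvector_sequence (hH : ¬ FiniteDimensional ℂ H) {T : H →L[ℂ] H}
    (hT : IsCompactOperator T) (hs : T.IsSymmetric)
    (hp : ∀ ξ, 0 ≤ RCLike.re (inner ℂ ξ (T ξ))) :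
    ∃ (e : ℕ → H) (l : ℕ → ℝ), Orthonormal ℂ e ∧ Antitone l ∧ (∀ k, 0 ≤ l k) ∧
      (∀ k, T (e k) = (l k : ℂ) • e k) ∧
      ∀ k ξ, (∀ i < k, inner ℂ (e i) ξ = 0) → ‖T ξ‖ ≤ l k * ‖ξ‖ := by
  -- The recursion runs over finite-dimensional invariant subspaces, each enlarged by a
  -- norm-attaining eigenvector of its orthogonal complement. It never stops; once the rank of `T`
  -- is exhausted the eigenvalues are `0`.
  let P := {S : Submodule ℂ H // FiniteDimensional ℂ S ∧ ∀ ξ ∈ S, T ξ ∈ S}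
  have step : ∀ S : P, ∃ (e : H) (l : ℝ), e ∈ S.1ᗮ ∧ ‖e‖ = 1 ∧ 0 ≤ l ∧ T e = (l : ℂ) • e ∧
      ∀ ξ ∈ S.1ᗮ, ‖T ξ‖ ≤ l * ‖ξ‖ := fun S => by
    have := S.2.1
    exact exists_eigenvector_orthogonal hH hT hs hp S.1 S.2.2
  choose e l h1 h2 h3 h4 h5 using step
  let next : P → P := fun S => ⟨S.1 ⊔ Submodule.span ℂ {e S}, by
    have := S.2.1
    infer_instance, by
    intro ξ hξ
    obtain ⟨y, hy, z, hz, rfl⟩ := Submodule.mem_sup.1 hξ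
    obtain ⟨c, rfl⟩ := Submodule.mem_span_singleton.1 hz
    rw [map_add, map_smul, h4]
    refine Submodule.add_mem_sup (S.2.2 y hy) ?_
    exact Submodule.smul_mem _ _ (Submodule.smul_mem _ _ (Submodule.mem_span_singleton_self _))⟩
  let s : ℕ → P := fun n => next^[n] ⟨⊥, inferInstance, by simp⟩
  have hsucc : ∀ n, s (n + 1) = next (s n) := fun n => Function.iterate_succ_apply' _ _ _
  have hmono : Monotone fun n => (s n).1 := monotone_nat_of_le_succ fun n => by
    rw [hsucc]
    exact le_sup_left
  have hmem : ∀ k n, k < n → e (s k) ∈ (s n).1 := by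
    intro k n hkn
    refine hmono (Nat.succ_le_of_lt hkn) ?_
    change e (s k) ∈ (s (k + 1)).1
    rw [hsucc]
    exact Submodule.mem_sup_right (Submodule.mem_span_singleton_self _)
  have horth : ∀ k n, k < n → inner ℂ (e (s k)) (e (s n)) = 0 := fun k n hkn =>
    h1 (s n) _ (hmem k n hkn)
  have hon : Orthonormal ℂ fun n => e (s n) := by
    refine ⟨fun n => h2 _, fun k n hkn => ?_⟩
    rcases lt_or_gt_of_ne hkn with h | h
    · exact horth k n h
    · exact inner_eq_zero_symm.1 (horth n k h)
  have hperp : ∀ k ξ, (∀ i < k, inner ℂ (e (s i)) ξ = 0) → ξ ∈ (s k).1ᗮ := by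
    intro k ξ hξ
    induction k with
    | zero => simp [s]
    | succ k ih =>
      rw [hsucc]
      change ξ ∈ ((s k).1 ⊔ Submodule.span ℂ {e (s k)})ᗮ
      rw [← Submodule.inf_orthogonal]
      exact ⟨ih fun i hi => hξ i (hi.trans (Nat.lt_succ_self k)),
        Submodule.mem_orthogonal_singleton_iff_inner_right.2 (hξ k (Nat.lt_succ_self k))⟩
  have hbound : ∀ k ξ, (∀ i < k, inner ℂ (e (s i)) ξ = 0) → ‖T ξ‖ ≤ l (s k) * ‖ξ‖ :=
    fun k ξ hξ => h5 _ _ (hperp k ξ hξ)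
  refine ⟨fun n => e (s n), fun n => l (s n), hon, antitone_nat_of_succ_le fun n => ?_,
    fun n => h3 _, fun n => h4 _, hbound⟩
  -- The bound at stage `n`, tested on the next eigenvector, gives the monotonicity of the
  -- eigenvalues.
  have h := hbound n (e (s (n + 1))) fun i hi => horth i (n + 1) (hi.trans (Nat.lt_succ_self n))
  rwa [h4, norm_smul, h2, mul_one, mul_one, Complex.norm_real, Real.norm_of_nonneg (h3 _)] at h

/-- An eigenvector for some `μ > l k`, minus its projection to the span of the first `k` vectors `e
i`, is still an eigenvector for `μ`, but `hb` bounds `|x|` by `l k` on it; so it vanishes and `l k`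
is admissible. A smaller `t` is not: the `k + 1` independent vectors `e 0, …, e k` belong to
eigenvalues greater than `t`. -/
theorem singularValue_eq_of_eigenvectors {x : H →L[ℂ] H} {e : ℕ → H} {l : ℕ → ℝ}
    (he : Orthonormal ℂ e) (hl : Antitone l) (hl0 : ∀ k, 0 ≤ l k)
    (hev : ∀ k, CFC.abs x (e k) = (l k : ℂ) • e k)
    (hb : ∀ k ξ, (∀ i < k, inner ℂ (e i) ξ = 0) → ‖CFC.abs x ξ‖ ≤ l k * ‖ξ‖) (k : ℕ) :
    singularValue x k = l k := by
  have hsa : (CFC.abs x : H →L[ℂ] H).IsSymmetric :=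
    (CFC.abs_nonneg x).isSelfAdjoint.isSymmetric
  refine IsLeast.csInf_eq ⟨⟨hl0 k, ?_⟩, ?_⟩
  · have hle : (⨆ μ : {μ : ℝ // l k < μ},
        Module.End.eigenspace (CFC.abs x : H →L[ℂ] H).toLinearMap ((μ : ℝ) : ℂ)) ≤
        Submodule.span ℂ (Set.range fun i : Fin k => e i) := by
      refine iSup_le fun ⟨μ, hμ⟩ η hη => ?_
      have hη' : CFC.abs x η = (μ : ℂ) • η := Module.End.mem_eigenspace_iff.1 hη
      let ξ := η - ∑ i : Fin k, (inner ℂ (e i) η) • e i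
      have hxe : ∀ i, (l i : ℂ) * inner ℂ (e i) η = μ * inner ℂ (e i) η := by
        intro i
        have h := hsa.apply_clm (e i) η
        rw [hev, hη', inner_smul_left, inner_smul_right] at h
        simpa using h
      have hξ : CFC.abs x ξ = (μ : ℂ) • ξ := by
        simp only [ξ, map_sub, map_sum, map_smul, hη', hev, smul_sub, Finset.smul_sum, smul_smul]
        congr 1
        refine Finset.sum_congr rfl fun i _ => ?_
        rw [mul_comm, hxe]
      have h0 := hb k ξ fun i hi => by
        simp only [ξ, inner_sub_right, inner_sum, inner_smul_right]
        rw [Finset.sum_eq_single (⟨i, hi⟩ : Fin k)]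
        · simp [inner_self_eq_norm_sq_to_K, he.1 i]
        · intro j _ hj
          rw [he.2 (i := i) (j := j) (by intro h; exact hj (Fin.ext h.symm)), mul_zero]
        · simp
      have hμ0 : 0 ≤ μ := (hl0 k).trans hμ.le
      rw [hξ, norm_smul, Complex.norm_real, Real.norm_of_nonneg hμ0] at h0
      have hξ0 : ξ = 0 := by
        by_contra hne
        exact absurd (le_of_mul_le_mul_right h0 (norm_pos_iff.2 hne)) (not_le.2 hμ)
      rw [sub_eq_zero.1 hξ0]
      exact Submodule.sum_mem _ fun i _ =>
        Submodule.smul_mem _ _ (Submodule.subset_span ⟨i, rfl⟩)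
    refine (Submodule.rank_mono hle).trans ((rank_span_le _).trans ?_)
    simpa using Cardinal.mk_range_le_lift (f := fun i : Fin k => e i)
  · rintro t ⟨ht0, ht⟩
    by_contra hlt
    rw [not_le] at hlt
    have hmem : ∀ i : Fin (k + 1), e i ∈ ⨆ μ : {μ : ℝ // t < μ},
        Module.End.eigenspace (CFC.abs x : H →L[ℂ] H).toLinearMap ((μ : ℝ) : ℂ) := fun i =>
      Submodule.mem_iSup_of_mem ⟨l i, hlt.trans_le (hl (Nat.lt_succ_iff.1 i.2))⟩
        (Module.End.mem_eigenspace_iff.2 (hev i))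
    have hli : LinearIndependent ℂ fun i : Fin (k + 1) => (⟨e i, hmem i⟩ :
        (⨆ μ : {μ : ℝ // t < μ},
          Module.End.eigenspace (CFC.abs x : H →L[ℂ] H).toLinearMap ((μ : ℝ) : ℂ) :
            Submodule ℂ H)) := by
      refine LinearIndependent.of_comp (Submodule.subtype _) ?_
      exact he.linearIndependent.comp (fun i : Fin (k + 1) => (i : ℕ)) Fin.val_injective
    have h := hli.cardinal_lift_le_rank
    rw [Cardinal.mk_fin, Cardinal.lift_natCast, Cardinal.lift_id'] at h
    exact absurd (Nat.cast_le.1 (h.trans ht)) (by simp)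

/-- Schmidt vectors of a compact operator. -/
theorem IsCompactOperator.exists_singularVectors (hH : ¬ FiniteDimensional ℂ H) {x : H →L[ℂ] H}
    (hx : IsCompactOperator x) :
    ∃ e : ℕ → H, Orthonormal ℂ e ∧ Antitone (singularValue x) ∧ (∀ k, 0 ≤ singularValue x k) ∧
      (∀ j k, inner ℂ (x (e j)) (x (e k)) = if j = k then (singularValue x k : ℂ) ^ 2 else 0) ∧
      (∀ k ξ, inner ℂ (e k) ξ = 0 → inner ℂ (x (e k)) (x ξ) = 0) ∧
      ∀ k ξ, (∀ i < k, inner ℂ (e i) ξ = 0) → ‖x ξ‖ ≤ singularValue x k * ‖ξ‖ := by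
  have hsa : (CFC.abs x : H →L[ℂ] H).IsSymmetric :=
    (CFC.abs_nonneg x).isSelfAdjoint.isSymmetric
  have hpos : (CFC.abs x : H →L[ℂ] H).IsPositive :=
    (ContinuousLinearMap.nonneg_iff_isPositive _).1 (CFC.abs_nonneg x)
  obtain ⟨e, l, he, hl, hl0, hev, hb⟩ := exists_eigenvector_sequence hH
    (isCompactOperator_cfcAbs.2 hx) hsa fun ξ => hpos.re_inner_nonneg_right ξ
  have hsv : singularValue x = l :=
    funext (singularValue_eq_of_eigenvectors he hl hl0 hev hb)
  have hperp : ∀ k ξ, inner ℂ (x (e k)) (x ξ) = (l k : ℂ) ^ 2 * inner ℂ (e k) ξ := by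
    intro k ξ
    rw [← inner_cfcAbs_apply, hev, inner_smul_left, ← hsa.apply_clm, hev, inner_smul_left]
    simp [pow_two, mul_assoc]
  rw [hsv]
  refine ⟨e, he, hl, hl0, fun j k => ?_, fun k ξ h => by rw [hperp, h, mul_zero],
    fun k ξ h => by rw [← norm_cfcAbs_apply]; exact hb k ξ h⟩
  rw [hperp, orthonormal_iff_ite.1 he j k]
  split_ifs with h <;> simp [h]

end SingularValues

/-! ### Ky Fan's maximum principle -/

section KyFan

variable {H : Type*} [NormedAddCommGroup H] [InnerProductSpace ℂ H]

/-- A finite family of vectors satisfying Bessel's inequality. -/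
def IsBesselFamily {n : ℕ} (f : Fin n → H) : Prop :=
  ∀ η : H, ∑ i, ‖inner ℂ (f i) η‖ ^ 2 ≤ ‖η‖ ^ 2

theorem IsBesselFamily.norm_le {n : ℕ} {f : Fin n → H} (hf : IsBesselFamily f) (i : Fin n) :
    ‖f i‖ ≤ 1 := by
  have h := (Finset.single_le_sum (f := fun j => ‖inner ℂ (f j) (f i)‖ ^ 2)
    (fun _ _ => by positivity) (Finset.mem_univ i)).trans (hf (f i))
  simp only [inner_self_eq_norm_sq_to_K, norm_pow] at h
  have h2 : ‖((‖f i‖ : ℝ) : ℂ)‖ = ‖f i‖ := by simp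
  erw [h2] at h
  by_contra hlt
  rw [not_le] at hlt
  have : ‖f i‖ ^ 2 < (‖f i‖ ^ 2) ^ 2 := by
    have h1 : 1 < ‖f i‖ ^ 2 := one_lt_pow₀ hlt two_ne_zero
    nlinarith
  linarith

theorem norm_eq_of_inner_self_eq {ξ : H} {t : ℝ} (ht : 0 ≤ t) (h : inner ℂ ξ ξ = (t : ℂ) ^ 2) :
    ‖ξ‖ = t := by
  have h1 := inner_self_eq_norm_sq (𝕜 := ℂ) ξ
  rw [h, ← Complex.ofReal_pow] at h1
  exact ((pow_left_inj₀ ht (norm_nonneg _) two_ne_zero).1 h1).symm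

theorem norm_sum_smul_sq_le {n : ℕ} {h : Fin n → H} (h1 : ∀ i, ‖h i‖ ≤ 1)
    (h2 : ∀ i j, i ≠ j → inner ℂ (h i) (h j) = 0) (c : Fin n → ℂ) :
    ‖∑ i, c i • h i‖ ^ 2 ≤ ∑ i, ‖c i‖ ^ 2 := by
  have e : ‖∑ i, c i • h i‖ ^ 2 = ∑ i, ‖c i‖ ^ 2 * ‖h i‖ ^ 2 := by
    have : ((‖∑ i, c i • h i‖ : ℝ) : ℂ) ^ 2 = ((∑ i, ‖c i‖ ^ 2 * ‖h i‖ ^ 2 : ℝ) : ℂ) := by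
      have h0 := inner_self_eq_norm_sq_to_K (𝕜 := ℂ) (∑ i, c i • h i)
      erw [← h0]
      simp only [sum_inner, inner_sum, inner_smul_left, inner_smul_right]
      push_cast
      refine Finset.sum_congr rfl fun i _ => ?_
      rw [Finset.sum_eq_single i]
      · have h3 := inner_self_eq_norm_sq_to_K (𝕜 := ℂ) (h i)
        have h4 : (starRingEnd ℂ) (c i) * c i = (‖c i‖ : ℂ) ^ 2 := Complex.conj_mul' (c i)
        rw [h3, ← mul_assoc, mul_comm (c i), h4]
        rfl
      · intro j _ hj
        rw [h2 j i hj]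
        simp
      · simp
    exact_mod_cast this
  rw [e]
  refine Finset.sum_le_sum fun i _ => ?_
  have := pow_le_one₀ (norm_nonneg _) (h1 i) (n := 2)
  nlinarith [sq_nonneg ‖c i‖]

/-- Cauchy–Schwarz for `η` and `∑ c i • h i`, whose inner product is `S`, gives `S ^ 2 ≤ S * ‖η‖ ^
2`. Zero vectors are allowed, as they occur among normalized images `x (e k)` when a singular value
vanishes. -/
theorem isBesselFamily_of_orthogonal {n : ℕ} {h : Fin n → H} (h1 : ∀ i, ‖h i‖ ≤ 1)
    (h2 : ∀ i j, i ≠ j → inner ℂ (h i) (h j) = 0) : IsBesselFamily h := by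
  intro η
  set c : Fin n → ℂ := fun i => inner ℂ (h i) η
  set S := ∑ i, ‖c i‖ ^ 2
  have hS : 0 ≤ S := Finset.sum_nonneg fun _ _ => by positivity
  have hle := norm_sum_smul_sq_le h1 h2 c
  have e : ‖inner ℂ (∑ i, c i • h i) η‖ = S := by
    have : inner ℂ (∑ i, c i • h i) η = ((S : ℝ) : ℂ) := by
      simp only [sum_inner, inner_smul_left, S]
      push_cast
      exact Finset.sum_congr rfl fun i _ => Complex.conj_mul' (c i)
    rw [this, Complex.norm_real, Real.norm_of_nonneg hS]
  have h3 := norm_inner_le_norm (𝕜 := ℂ) (∑ i, c i • h i) η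
  rw [e] at h3
  change S ≤ ‖η‖ ^ 2
  have h4 : S ^ 2 ≤ S * ‖η‖ ^ 2 := by
    calc S ^ 2 ≤ (‖∑ i, c i • h i‖ * ‖η‖) ^ 2 := by gcongr
      _ = ‖∑ i, c i • h i‖ ^ 2 * ‖η‖ ^ 2 := mul_pow _ _ _
      _ ≤ S * ‖η‖ ^ 2 := by gcongr
  rcases hS.eq_or_lt with h | h
  · rw [← h]; positivity
  · rw [pow_two] at h4
    exact le_of_mul_le_mul_left h4 h

theorem Orthonormal.isBesselFamily {n : ℕ} {h : Fin n → H} (hh : Orthonormal ℂ h) :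
    IsBesselFamily h :=
  isBesselFamily_of_orthogonal (fun i => (hh.1 i).le) fun _ _ hij => hh.2 hij

variable [CompleteSpace H]

/-- Contractions destroy orthonormality but keep Bessel's inequality. This is why Ky Fan's principle
is used with Bessel families. -/
theorem IsBesselFamily.map {n : ℕ} {f : Fin n → H} (hf : IsBesselFamily f) {b : H →L[ℂ] H}
    (hb : ∀ η, ‖star b η‖ ≤ ‖η‖) : IsBesselFamily fun i => b (f i) := by
  intro η
  have h : ∀ i, inner ℂ (b (f i)) η = inner ℂ (f i) (star b η) := fun i => by
    rw [ContinuousLinearMap.star_eq_adjoint, ContinuousLinearMap.adjoint_inner_right]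
  simp only [h]
  refine (hf _).trans ?_
  gcongr
  exact hb η

/-- The constant `C` dominates the sum of the first `n` singular values of `x`, expressed by means
of Ky Fan's maximum principle. -/
def KyFanBound (n : ℕ) (C : ℝ) (x : H →L[ℂ] H) : Prop :=
  ∀ f g : Fin n → H, IsBesselFamily f → IsBesselFamily g →
    ∑ i, RCLike.re (inner ℂ (f i) (x (g i))) ≤ C

theorem KyFanBound.mul_mul {n : ℕ} {C : ℝ} {x : H →L[ℂ] H} (hx : KyFanBound n C x)
    {b c : H →L[ℂ] H} (hb : ∀ η, ‖b η‖ ≤ ‖η‖) (hc : ∀ η, ‖star c η‖ ≤ ‖η‖) :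
    KyFanBound n C (b * x * c) := by
  intro f g hf hg
  have h := hx _ _ (hf.map (b := star b) (by simpa using hb)) (hg.map hc)
  convert! h using 3 with i
  rw [ContinuousLinearMap.star_eq_adjoint, ContinuousLinearMap.adjoint_inner_left]
  rfl

omit [CompleteSpace H] in
theorem KyFanBound.midpoint {n : ℕ} {C : ℝ} {x y z : H →L[ℂ] H} (hx : KyFanBound n C x)
    (hy : KyFanBound n C y) (hz : (2 : ℂ) • z = x + y) : KyFanBound n C z := by
  intro f g hf hg
  have h := add_le_add (hx f g hf hg) (hy f g hf hg)
  rw [← Finset.sum_add_distrib] at h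
  have e : ∀ i, RCLike.re (inner ℂ (f i) (x (g i))) + RCLike.re (inner ℂ (f i) (y (g i)))
      = 2 * RCLike.re (inner ℂ (f i) (z (g i))) := by
    intro i
    rw [← map_add, ← inner_add_right, ← add_apply, ← hz, smul_apply,
      inner_smul_right]
    simp
  simp only [e, ← Finset.mul_sum] at h
  linarith

omit [CompleteSpace H] in
theorem kyFanBound_of_tendsto {n : ℕ} {C : ℝ} {ι : Type*} {l : Filter ι} [l.NeBot]
    {y : ι → H →L[ℂ] H} {x : H →L[ℂ] H} (hy : ∀ i, KyFanBound n C (y i))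
    (h : ∀ ξ, Filter.Tendsto (fun i => y i ξ) l (nhds (x ξ))) : KyFanBound n C x := by
  intro f g hf hg
  refine le_of_tendsto (x := l) (tendsto_finsetSum _ fun i _ => ?_)
    (Filter.Eventually.of_forall fun j => hy j f g hf hg)
  exact (RCLike.continuous_re.tendsto _).comp (tendsto_const_nhds.inner (h (g i)))

/-- Write `x = ∑ (s k - s n) ⟨e k, ·⟩ h k + x'` with `k < n` and `‖x'‖ ≤ s n`. By the inequality of
the means and Bessel's inequality, the `k`-th rank-one term contributes at most `s k - s n`; each of
the `n` pairs contributes at most `s n` through `x'`. The total is `∑ s k`. -/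
theorem IsCompactOperator.kyFanBound (hH : ¬ FiniteDimensional ℂ H) {x : H →L[ℂ] H}
    (hx : IsCompactOperator x) (n : ℕ) :
    KyFanBound n (∑ k ∈ Finset.range n, singularValue x k) x := by
  obtain ⟨e, he, hanti, hs0, hin, hperp, hb⟩ := hx.exists_singularVectors hH
  set s := singularValue x
  intro f g hf hg
  have hxe : ∀ k, ‖x (e k)‖ = s k := by
    intro k
    exact norm_eq_of_inner_self_eq (hs0 k) ((hin k k).trans (if_pos rfl))
  -- If `s k = 0`, then `x (e k) = 0` and, the inverse of `0` being `0`, also `h k = 0`.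
  let h : Fin n → H := fun k => ((s k)⁻¹ : ℂ) • x (e k)
  have hsh : ∀ k : Fin n, (s k : ℂ) • h k = x (e k) := by
    intro k
    by_cases h0 : s k = 0
    · have : x (e k) = 0 := norm_eq_zero.1 ((hxe k).trans h0)
      rw [this, h0]
      simp
    · exact smul_inv_smul₀ (by exact_mod_cast h0) _
  have h1 : ∀ k, ‖h k‖ ≤ 1 := by
    intro k
    simp only [h, norm_smul, norm_inv, Complex.norm_real, hxe, Real.norm_of_nonneg (hs0 k)]
    exact inv_mul_le_one
  have h2 : ∀ i j, i ≠ j → inner ℂ (h i) (h j) = 0 := by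
    intro i j hij
    simp only [h, inner_smul_left, inner_smul_right, hin]
    rw [if_neg (by intro h; exact hij (Fin.ext h))]
    simp
  let r : H → H := fun ξ => ξ - ∑ k : Fin n, (inner ℂ (e k) ξ) • e k
  have hr0 : ∀ ξ, ∀ i < n, inner ℂ (e i) (r ξ) = 0 := by
    intro ξ i hi
    simp only [r, inner_sub_right, inner_sum, inner_smul_right]
    rw [Finset.sum_eq_single (⟨i, hi⟩ : Fin n)]
    · simp [inner_self_eq_norm_sq_to_K, he.1 i]
    · intro j _ hj
      rw [he.2 (i := i) (j := j) (by intro h; exact hj (Fin.ext h.symm)), mul_zero]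
    · simp
  have he' : Orthonormal ℂ fun k : Fin n => e k := he.comp _ Fin.val_injective
  have hrn : ∀ ξ, ‖r ξ‖ ^ 2 + ∑ k : Fin n, ‖inner ℂ (e k) ξ‖ ^ 2 = ‖ξ‖ ^ 2 := by
    intro ξ
    have hor : inner ℂ (r ξ) (∑ k : Fin n, (inner ℂ (e k) ξ) • e k) = 0 := by
      rw [inner_sum]
      refine Finset.sum_eq_zero fun k _ => ?_
      rw [inner_smul_right, inner_eq_zero_symm.1 (hr0 ξ k k.2), mul_zero]
    have hp := norm_add_sq_eq_norm_sq_add_norm_sq_of_inner_eq_zero _ _ hor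
    have e1 : r ξ + ∑ k : Fin n, (inner ℂ (e k) ξ) • e k = ξ := sub_add_cancel _ _
    have e2 : ‖∑ k : Fin n, (inner ℂ (e k) ξ) • e k‖ ^ 2 = ∑ k : Fin n, ‖inner ℂ (e k) ξ‖ ^ 2 := by
      have h3 := he'.inner_sum (fun k : Fin n => inner ℂ (e k) ξ) (fun k => inner ℂ (e k) ξ)
        Finset.univ
      rw [← inner_self_eq_norm_sq (𝕜 := ℂ), h3, map_sum]
      refine Finset.sum_congr rfl fun k _ => ?_
      rw [RCLike.conj_mul]
      simp [← Complex.ofReal_pow]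
    rw [e1] at hp
    rw [← e2]
    linarith
  -- `x'` is `x` with its first `n` singular values lowered to `s n`. Its two summands are
  -- orthogonal, so Pythagoras gives the bound `s n`.
  let x' : H → H := fun ξ => (∑ k : Fin n, (s n * inner ℂ (e k) ξ : ℂ) • h k) + x (r ξ)
  have hx' : ∀ ξ, x ξ = (∑ k : Fin n, ((s k - s n : ℝ) * inner ℂ (e k) ξ : ℂ) • h k) + x' ξ := by
    intro ξ
    simp only [x']
    rw [← add_assoc, ← Finset.sum_add_distrib]
    have e1 : ∀ k : Fin n, ((s k - s n : ℝ) * inner ℂ (e k) ξ : ℂ) • h k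
        + (s n * inner ℂ (e k) ξ : ℂ) • h k = x ((inner ℂ (e k) ξ) • e k) := by
      intro k
      have e2 : x ((inner ℂ (e k) ξ) • e k) = (inner ℂ (e k) ξ * s k : ℂ) • h k := by
        rw [mul_smul, hsh, map_smul]
      rw [e2, ← add_smul]
      refine congrArg (· • h k) ?_
      push_cast
      ring
    simp only [e1]
    rw [← map_sum, ← map_add]
    congr 1
    simp [r]
  have hx'n : ∀ ξ, ‖x' ξ‖ ≤ s n * ‖ξ‖ := by
    intro ξ
    have hor : inner ℂ (∑ k : Fin n, (s n * inner ℂ (e k) ξ : ℂ) • h k) (x (r ξ)) = 0 := by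
      rw [sum_inner]
      refine Finset.sum_eq_zero fun k _ => ?_
      simp only [h, inner_smul_left]
      rw [hperp k _ (hr0 ξ k k.2)]
      simp
    have hp := norm_add_sq_eq_norm_sq_add_norm_sq_of_inner_eq_zero _ _ hor
    have h3 := norm_sum_smul_sq_le h1 h2 fun k => (s n * inner ℂ (e k) ξ : ℂ)
    have h4 : ‖x (r ξ)‖ ^ 2 ≤ (s n * ‖r ξ‖) ^ 2 := by
      gcongr
      exact hb n _ (hr0 ξ)
    simp only [norm_mul, Complex.norm_real, Real.norm_of_nonneg (hs0 n), mul_pow,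
      ← Finset.mul_sum] at h3 h4
    refine le_of_sq_le_sq ?_ (mul_nonneg (hs0 n) (norm_nonneg _))
    rw [mul_pow, ← hrn ξ]
    simp only [x']
    nlinarith
  have hmain : ∀ i, RCLike.re (inner ℂ (f i) (x (g i))) ≤
      (∑ k : Fin n, (s k - s n) * ((‖inner ℂ (f i) (h k)‖ ^ 2 + ‖inner ℂ (g i) (e k)‖ ^ 2) / 2))
        + s n := by
    intro i
    rw [hx', inner_add_right, map_add, inner_sum, map_sum]
    refine add_le_add (Finset.sum_le_sum fun k _ => ?_) ?_
    · rw [inner_smul_right]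
      refine (RCLike.re_le_norm _).trans ?_
      have hk : 0 ≤ s k - s n := sub_nonneg.2 (hanti k.2.le)
      rw [norm_mul, norm_mul, Complex.norm_real, Real.norm_of_nonneg hk, mul_assoc]
      refine mul_le_mul_of_nonneg_left ?_ hk
      rw [norm_inner_symm (e k)]
      nlinarith [sq_nonneg (‖inner ℂ (f i) (h k)‖ - ‖inner ℂ (g i) (e k)‖)]
    · refine (RCLike.re_le_norm _).trans ((norm_inner_le_norm _ _).trans ?_)
      have h3 := hx'n (g i)
      have h4 := hf.norm_le i
      have h5 := hg.norm_le i
      calc ‖f i‖ * ‖x' (g i)‖ ≤ 1 * (s n * 1) := by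
            have := hs0 n
            gcongr
            exact h3.trans (by gcongr)
        _ = s n := by ring
  refine (Finset.sum_le_sum fun i _ => hmain i).trans ?_
  rw [Finset.sum_add_distrib, Finset.sum_comm]
  have hk : ∀ k : Fin n, ∑ i, (s k - s n) *
      ((‖inner ℂ (f i) (h k)‖ ^ 2 + ‖inner ℂ (g i) (e k)‖ ^ 2) / 2) ≤ s k - s n := by
    intro k
    have hk : 0 ≤ s k - s n := sub_nonneg.2 (hanti k.2.le)
    rw [← Finset.mul_sum, ← Finset.sum_div, Finset.sum_add_distrib]
    have h3 := hf (h k)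
    have h4 := hg (e k)
    rw [he.1 k] at h4
    have h5 := pow_le_one₀ (norm_nonneg _) (h1 k) (n := 2)
    refine mul_le_of_le_one_right hk ?_
    linarith
  refine (add_le_add_left (Finset.sum_le_sum fun k _ => hk k) _).trans ?_
  rw [Finset.sum_sub_distrib, Finset.sum_range]
  simp

/-- The converse half: the bound is tested on the Schmidt vectors `e k` and the normalized images `x
(e k)`. -/
theorem IsCompactOperator.sum_singularValue_le (hH : ¬ FiniteDimensional ℂ H) {x : H →L[ℂ] H}
    (hx : IsCompactOperator x) {n : ℕ} {C : ℝ} (hC : KyFanBound n C x) :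
    ∑ k ∈ Finset.range n, singularValue x k ≤ C := by
  obtain ⟨e, he, hanti, hs0, hin, hperp, hb⟩ := hx.exists_singularVectors hH
  set s := singularValue x
  have hxe : ∀ k, inner ℂ (x (e k)) (x (e k)) = (s k : ℂ) ^ 2 := fun k => by
    rw [hin k k, if_pos rfl]
  let h : Fin n → H := fun k => ((s k)⁻¹ : ℂ) • x (e k)
  have h1 : ∀ k, ‖h k‖ ≤ 1 := by
    intro k
    have h' : ‖x (e k)‖ = s k := norm_eq_of_inner_self_eq (hs0 k) (hxe k)
    simp only [h, norm_smul, norm_inv, Complex.norm_real, h', Real.norm_of_nonneg (hs0 k)]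
    exact inv_mul_le_one
  have h2 : ∀ i j, i ≠ j → inner ℂ (h i) (h j) = 0 := by
    intro i j hij
    simp only [h, inner_smul_left, inner_smul_right, hin]
    rw [if_neg (by intro h; exact hij (Fin.ext h))]
    simp
  have he' : Orthonormal ℂ fun k : Fin n => e k := he.comp _ Fin.val_injective
  refine le_trans (le_of_eq ?_) (hC h _ (isBesselFamily_of_orthogonal h1 h2) he'.isBesselFamily)
  rw [Finset.sum_range]
  refine Finset.sum_congr rfl fun k _ => ?_
  simp only [h]
  rw [inner_smul_left, hxe]
  by_cases h0 : s k = 0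
  · simp [h0]
  · rw [map_inv₀, Complex.conj_ofReal, pow_two, inv_mul_cancel_left₀ (by exact_mod_cast h0)]
    simp

end KyFan

/-! ### The diagonal expectation does not increase Ky Fan sums -/

section Pinching

variable {H : Type*} [NormedAddCommGroup H] [InnerProductSpace ℂ H] [CompleteSpace H]

theorem eigProj_mul_self (a : H →L[ℂ] H) (z : ℂ) : eigProj a z * eigProj a z = eigProj a z := by
  ext ξ
  exact Submodule.starProjection_eq_self_iff.2 (eigProj_mem a z ξ)

theorem star_eigProj (a : H →L[ℂ] H) (z : ℂ) : star (eigProj a z) = eigProj a z :=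
  (isSelfAdjoint_starProjection (eigSpace a z)).star_eq

theorem eigProj_mul_of_ne {a : H →L[ℂ] H} (ha : IsStarNormal a) {z w : ℂ} (h : z ≠ w) :
    eigProj a z * eigProj a w = 0 := by
  ext ξ
  refine (Submodule.starProjection_apply_eq_zero_iff _).2 ?_
  intro η hη
  exact orthogonalFamily_eigSpace a ha h ⟨η, hη⟩ ⟨_, eigProj_mem a w ξ⟩

/-- The reflection `u = 2 p - 1` is a self-adjoint isometry, and the pinched operator is the
midpoint of `x` and `u x u`. -/
theorem KyFanBound.pinch {n : ℕ} {C : ℝ} {x : H →L[ℂ] H} (hx : KyFanBound n C x)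
    (K : Submodule ℂ H) [K.HasOrthogonalProjection] :
    KyFanBound n C (K.starProjection * x * K.starProjection
      + (1 - K.starProjection) * x * (1 - K.starProjection)) := by
  set p := K.starProjection
  have hu : ∀ η, ‖(2 * p - 1) η‖ ≤ ‖η‖ := fun η => by
    have : (2 * p - 1) η = K.reflection η := by
      rw [Submodule.reflection_apply, two_smul, two_mul]
      rfl
    rw [this]
    exact (LinearIsometryEquiv.norm_map _ _).le
  have hs : star (2 * p - 1) = 2 * p - 1 := by
    have hp : star p = p := (isSelfAdjoint_starProjection K).star_eq
    rw [two_mul, star_sub, star_add, hp, star_one]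
  refine hx.midpoint (hx.mul_mul hu (c := 2 * p - 1) (by rwa [hs])) ?_
  rw [two_smul]
  noncomm_ring

/-- Successive pinchings by the eigenprojections in `F` produce the blocks together with the
remainder `(1 - P) x (1 - P)`, where `P` is the sum of these projections. The remainder is kept
during the induction, since the next block is cut out of it. -/
theorem KyFanBound.sum_block {a : H →L[ℂ] H} (ha : IsStarNormal a) {n : ℕ} {C : ℝ}
    {x : H →L[ℂ] H} (hx : KyFanBound n C x) (F : Finset ℂ) :
    KyFanBound n C (∑ z ∈ F, eigProj a z * x * eigProj a z) := by
  have key : KyFanBound n C ((∑ z ∈ F, eigProj a z * x * eigProj a z)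
      + (1 - ∑ z ∈ F, eigProj a z) * x * (1 - ∑ z ∈ F, eigProj a z)) := by
    induction F using Finset.induction_on with
    | empty => simpa using hx
    | insert w F hw ih =>
      have h := ih.pinch (eigSpace a w)
      change KyFanBound n C (eigProj a w * _ * eigProj a w
        + (1 - eigProj a w) * _ * (1 - eigProj a w)) at h
      rw [Finset.sum_insert hw, Finset.sum_insert hw]
      set p := eigProj a w
      set B := ∑ z ∈ F, eigProj a z * x * eigProj a z
      set P := ∑ z ∈ F, eigProj a z
      have hpp : p * p = p := eigProj_mul_self a w
      have hpP : p * P = 0 := by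
        rw [Finset.mul_sum]
        exact Finset.sum_eq_zero fun z hz =>
          eigProj_mul_of_ne ha (by rintro rfl; exact hw hz)
      have hPp : P * p = 0 := by
        rw [Finset.sum_mul]
        exact Finset.sum_eq_zero fun z hz =>
          eigProj_mul_of_ne ha (by rintro rfl; exact hw hz)
      have hpB : p * B = 0 := by
        rw [Finset.mul_sum]
        refine Finset.sum_eq_zero fun z hz => ?_
        rw [← mul_assoc, ← mul_assoc, eigProj_mul_of_ne ha (by rintro rfl; exact hw hz),
          zero_mul, zero_mul]
      have hBp : B * p = 0 := by
        rw [Finset.sum_mul]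
        refine Finset.sum_eq_zero fun z hz => ?_
        rw [mul_assoc, eigProj_mul_of_ne ha (by rintro rfl; exact hw hz), mul_zero]
      have e1 : p * (1 - P) = p := by rw [mul_sub, hpP]; simp
      have e2 : (1 - P) * p = p := by rw [sub_mul, hPp]; simp
      have e3 : (1 - p) * (1 - P) = 1 - (p + P) := by rw [sub_mul, e1]; noncomm_ring
      have e4 : (1 - P) * (1 - p) = 1 - (p + P) := by rw [mul_sub, e2]; noncomm_ring
      have h1 : p * (B + (1 - P) * x * (1 - P)) * p = p * x * p := by
        rw [mul_add, hpB, zero_add, mul_assoc, mul_assoc _ _ p, e2, ← mul_assoc, ← mul_assoc, e1]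
      have h2 : (1 - p) * (B + (1 - P) * x * (1 - P)) * (1 - p)
          = B + (1 - (p + P)) * x * (1 - (p + P)) := by
        rw [mul_add, add_mul]
        congr 1
        · rw [sub_mul, hpB, sub_zero, one_mul, mul_sub, hBp, mul_one, sub_zero]
        · rw [mul_assoc, mul_assoc _ _ (1 - p), e4, ← mul_assoc, ← mul_assoc, e3]
      rw [h1, h2, ← add_assoc] at h
      exact h
  set P := ∑ z ∈ F, eigProj a z
  set B := ∑ z ∈ F, eigProj a z * x * eigProj a z
  have hP : ∀ η, ‖P η‖ ≤ ‖η‖ := by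
    intro η
    have h1 : ‖∑ z ∈ F, eigProj a z η‖ ^ 2 = ∑ z ∈ F, ‖eigProj a z η‖ ^ 2 :=
      (orthogonalFamily_eigSpace a ha).norm_sum (fun z => ⟨eigProj a z η, eigProj_mem a z η⟩) F
    have h2 := h1.le.trans (sum_norm_eigProj_sq_le a ha η F)
    simp only [P, sum_apply]
    exact le_of_sq_le_sq h2 (norm_nonneg _)
  have hmul : ∀ w ∈ F, P * eigProj a w = eigProj a w := by
    intro w hw
    rw [Finset.sum_mul, Finset.sum_eq_single w (fun z _ hz => eigProj_mul_of_ne ha hz)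
      (fun h => absurd hw h), eigProj_mul_self]
  have hPP : P * P = P := by
    conv_lhs => rw [Finset.mul_sum]
    exact Finset.sum_congr rfl hmul
  have hPB : P * B = B := by
    rw [Finset.mul_sum]
    refine Finset.sum_congr rfl fun w hw => ?_
    rw [← mul_assoc, ← mul_assoc, hmul w hw]
  -- Left multiplication by the contraction `P` fixes the blocks and removes the remainder.
  have h := key.mul_mul hP (c := 1) (by simp)
  have hP0 : P * (1 - P) = 0 := by rw [mul_sub, hPP, mul_one, sub_self]
  rw [mul_one, mul_add, hPB, ← mul_assoc, ← mul_assoc, hP0, zero_mul, zero_mul, add_zero] at h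
  exact h

theorem KyFanBound.diagonalExpectation {a : H →L[ℂ] H} (ha : IsStarNormal a) {n : ℕ} {C : ℝ}
    {x : H →L[ℂ] H} (hx : KyFanBound n C x) : KyFanBound n C (diagonalExpectation a ha x) := by
  refine kyFanBound_of_tendsto (l := Filter.atTop) (hx.sum_block ha) fun ξ => ?_
  have h := hasSum_diagonalExpectation a ha x ξ
  simpa [HasSum] using h

theorem norm_diagonalExpectation_le {a : H →L[ℂ] H} (ha : IsStarNormal a) (x : H →L[ℂ] H) :
    ‖diagonalExpectation a ha x‖ ≤ ‖x‖ :=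
  ContinuousLinearMap.opNorm_le_bound _ (norm_nonneg _) (norm_tsum_block_le a ha x)

theorem continuous_diagonalExpectation {a : H →L[ℂ] H} (ha : IsStarNormal a) :
    Continuous (diagonalExpectation a ha) :=
  AddMonoidHomClass.continuous_of_bound _ 1 fun x => by
    simpa using norm_diagonalExpectation_le ha x

omit [CompleteSpace H] in
theorem isCompactOperator_rankOne (ξ η : H) :
    IsCompactOperator (InnerProductSpace.rankOne ℂ ξ η : H →L[ℂ] H) := by
  have h : IsCompactOperator (innerSL ℂ η : H →L[ℂ] ℂ) :=
    isCompactOperator_of_locallyCompactSpace_dom (innerSL ℂ η)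
  exact h.clm_comp (ContinuousLinearMap.toSpanSingleton ℂ ξ)

/-- The blocks are the rank-one operators of `p_z ξ` and `p_z η`. Their norms `‖p_z ξ‖ ‖p_z η‖` are
summable by Bessel's inequality, so the sum converges in norm and not merely strongly. -/
theorem isCompactOperator_diagonalExpectation_rankOne {a : H →L[ℂ] H} (ha : IsStarNormal a)
    (ξ η : H) :
    IsCompactOperator (diagonalExpectation a ha (InnerProductSpace.rankOne ℂ ξ η)) := by
  have hblock : ∀ z ζ, eigProj a z (InnerProductSpace.rankOne ℂ ξ η (eigProj a z ζ)) =
      InnerProductSpace.rankOne ℂ (eigProj a z ξ) (eigProj a z η) ζ := by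
    intro z ζ
    simp only [InnerProductSpace.rankOne_apply, map_smul]
    congr 1
    exact (Submodule.inner_starProjection_left_eq_right (eigSpace a z) η ζ).symm
  have hs : ∀ ξ, Summable fun z => ‖eigProj a z ξ‖ ^ 2 := fun ξ =>
    summable_of_sum_le (fun z => by positivity) (sum_norm_eigProj_sq_le a ha ξ)
  have hsum : Summable fun z => (InnerProductSpace.rankOne ℂ (eigProj a z ξ) (eigProj a z η) :
      H →L[ℂ] H) := by
    refine Summable.of_norm_bounded (g := fun z => ‖eigProj a z ξ‖ ^ 2 + ‖eigProj a z η‖ ^ 2)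
      ((hs ξ).add (hs η)) fun z => ?_
    rw [InnerProductSpace.norm_rankOne]
    nlinarith [sq_nonneg (‖eigProj a z ξ‖ - ‖eigProj a z η‖), sq_nonneg (‖eigProj a z ξ‖),
      sq_nonneg (‖eigProj a z η‖)]
  have heq : diagonalExpectation a ha (InnerProductSpace.rankOne ℂ ξ η) =
      ∑' z, (InnerProductSpace.rankOne ℂ (eigProj a z ξ) (eigProj a z η) : H →L[ℂ] H) := by
    ext ζ
    refine (hasSum_diagonalExpectation a ha _ ζ).unique ?_
    simp only [hblock]
    exact hsum.hasSum.mapL (ContinuousLinearMap.apply ℂ H ζ)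
  rw [heq]
  refine isCompactOperator_of_tendsto (l := Filter.atTop) hsum.hasSum
    (Filter.Eventually.of_forall fun F => ?_)
  exact (compactOperator (RingHom.id ℂ) H H).sum_mem fun z _ => isCompactOperator_rankOne _ _

-- `M` is spanned by a finite `ε`-net of a compact set containing the image of the unit ball.
omit [CompleteSpace H] in
theorem IsCompactOperator.exists_norm_sub_starProjection_mul_le {x : H →L[ℂ] H}
    (hx : IsCompactOperator x) {ε : ℝ} (hε : 0 < ε) :
    ∃ (M : Submodule ℂ H) (_ : FiniteDimensional ℂ M), ‖x - M.starProjection * x‖ ≤ ε := by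
  obtain ⟨K, hK, hKx⟩ := hx.image_closedBall_subset_compact 1
  obtain ⟨t, ht, hcov⟩ := Metric.totallyBounded_iff.1 hK.totallyBounded ε hε
  have : Finite t := ht
  have hfd : FiniteDimensional ℂ (Submodule.span ℂ t) := FiniteDimensional.span_of_finite ℂ ht
  refine ⟨Submodule.span ℂ t, hfd, ContinuousLinearMap.opNorm_le_of_unit_norm hε.le fun ξ hξ => ?_⟩
  obtain ⟨y, hy, hxy⟩ := Set.mem_iUnion₂.1 (hcov (hKx ⟨ξ, by simp [hξ], rfl⟩))
  have h1 : ‖x ξ - (Submodule.span ℂ t).starProjection (x ξ)‖ ≤ ‖x ξ - y‖ := by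
    rw [Submodule.starProjection_minimal]
    exact ciInf_le ⟨0, by rintro _ ⟨w, rfl⟩; exact norm_nonneg _⟩
      (⟨y, Submodule.subset_span hy⟩ : Submodule.span ℂ t)
  rw [Metric.mem_ball, dist_eq_norm] at hxy
  exact h1.trans hxy.le

/-- Strong limits need not preserve compactness. Instead, `x` is approximated in norm by finite-rank
operators and `E` is contractive for the operator norm, which reduces the claim to rank one. -/
theorem IsCompactOperator.diagonalExpectation {a : H →L[ℂ] H} (ha : IsStarNormal a)
    {x : H →L[ℂ] H} (hx : IsCompactOperator x) :
    IsCompactOperator (diagonalExpectation a ha x) := by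
  have hclosed : IsClosed {y : H →L[ℂ] H | IsCompactOperator y} :=
    isClosed_setOfPred_isCompactOperator
  refine hclosed.closure_subset (Metric.mem_closure_iff.2 fun ε hε => ?_)
  obtain ⟨M, hM, h⟩ := hx.exists_norm_sub_starProjection_mul_le (half_pos hε)
  refine ⟨_root_.diagonalExpectation a ha (M.starProjection * x), ?_, ?_⟩
  · let b := stdOrthonormalBasis ℂ M
    have e : M.starProjection * x =
        ∑ i, (InnerProductSpace.rankOne ℂ (b i : H) (star x (b i : H)) : H →L[ℂ] H) := by
      ext ξ
      rw [mul_apply_eq_comp, b.starProjection_eq_sum_rankOne, sum_apply, sum_apply]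
      refine Finset.sum_congr rfl fun i _ => ?_
      rw [InnerProductSpace.rankOne_apply, InnerProductSpace.rankOne_apply,
        ContinuousLinearMap.star_eq_adjoint, ContinuousLinearMap.adjoint_inner_left]
    rw [e, map_sum]
    exact (compactOperator (RingHom.id ℂ) H H).sum_mem fun i _ =>
      isCompactOperator_diagonalExpectation_rankOne ha _ _
  · rw [dist_eq_norm, ← map_sub]
    exact ((norm_diagonalExpectation_le ha _).trans h).trans_lt (half_lt_self hε)

theorem sum_singularValue_diagonalExpectation_le (hH : ¬ FiniteDimensional ℂ H)
    {a : H →L[ℂ] H} (ha : IsStarNormal a) {x : H →L[ℂ] H} (hx : IsCompactOperator x) (n : ℕ) :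
    ∑ k ∈ Finset.range n, singularValue (diagonalExpectation a ha x) k
      ≤ ∑ k ∈ Finset.range n, singularValue x k :=
  (hx.diagonalExpectation ha).sum_singularValue_le hH ((hx.kyFanBound hH n).diagonalExpectation ha)

end Pinching

/-! ### Ideals containing a noncompact operator -/

section Calkin

variable {H : Type*} [NormedAddCommGroup H] [InnerProductSpace ℂ H]

/-- Distinct orthonormal vectors are at distance `√2`, so the balls of radius `1 / 2` about them are
disjoint open sets. -/
theorem Orthonormal.countable_index [TopologicalSpace.SeparableSpace H] {ι : Type*} {v : ι → H}
    (hv : Orthonormal ℂ v) : Countable ι := by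
  have h := Set.PairwiseDisjoint.countable_of_isOpen (a := (Set.univ : Set ι))
    (s := fun i => Metric.ball (v i) (1 / 2)) (fun i _ j _ hij => ?_)
    (fun _ _ => Metric.isOpen_ball) (fun i _ => ⟨v i, Metric.mem_ball_self (by norm_num)⟩)
  · exact Set.countable_univ_iff.1 h
  · refine Metric.ball_disjoint_ball ?_
    have h2 := @norm_sub_sq ℂ H _ _ _ (v i) (v j)
    rw [hv.2 hij, hv.1, hv.1] at h2
    rw [dist_eq_norm]
    have h3 : ‖v i - v j‖ ^ 2 = 2 := by rw [h2]; norm_num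
    nlinarith [norm_nonneg (v i - v j)]

variable [CompleteSpace H]

omit [CompleteSpace H] in
theorem HilbertBasis.infinite_index (hH : ¬ FiniteDimensional ℂ H) {ι : Type*}
    (b : HilbertBasis ι ℂ H) : Infinite ι := by
  by_contra h
  rw [not_infinite_iff_finite] at h
  have : Fintype ι := Fintype.ofFinite ι
  exact hH b.toOrthonormalBasis.toBasis.finiteDimensional_of_finite

/-- A separable Hilbert space embeds isometrically into every infinite-dimensional Hilbert space. -/
theorem exists_linearIsometry_of_infinite [TopologicalSpace.SeparableSpace H]
    {E : Type*} [NormedAddCommGroup E] [InnerProductSpace ℂ E] [CompleteSpace E]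
    (hE : ¬ FiniteDimensional ℂ E) : Nonempty (H →ₗᵢ[ℂ] E) := by
  obtain ⟨w, b, -⟩ := exists_hilbertBasis ℂ H
  obtain ⟨w', b', -⟩ := exists_hilbertBasis ℂ E
  have : Countable w := b.orthonormal.countable_index
  have : Infinite w' := b'.infinite_index hE
  obtain ⟨f, hf⟩ := exists_injective_nat w
  have hv : Orthonormal ℂ fun i : w => b' (Infinite.natEmbedding w' (f i)) :=
    b'.orthonormal.comp _ ((Infinite.natEmbedding w').injective.comp hf)
  exact ⟨hv.orthogonalFamily.linearIsometry.comp b.repr.toLinearIsometry⟩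

/-- A noncompact `T = |x|` is bounded below on an infinite-dimensional closed subspace `M`, into
which `H` embeds by an isometry `W`. A left inverse `g` of `T` on `M` then gives `W⋆ g T W = 1`.
Continuous functions of `T` play the role of spectral projections. -/
theorem exists_mul_mul_eq_one_of_not_isCompactOperator [TopologicalSpace.SeparableSpace H]
    {x : H →L[ℂ] H} (hx : ¬ IsCompactOperator x) : ∃ b c : H →L[ℂ] H, b * x * c = 1 := by
  set T : H →L[ℂ] H := CFC.abs x
  have hT : ¬ IsCompactOperator T := fun h => hx (isCompactOperator_cfcAbs.1 h)
  have hT0 : 0 ≤ T := CFC.abs_nonneg x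
  have hsa : IsSelfAdjoint T := hT0.isSelfAdjoint
  -- The cutoff `(T - ε)₊` is within `ε` of `T`; if all cutoffs were compact, so would be `T`.
  obtain ⟨ε, hε, hnc⟩ : ∃ ε : ℝ, 0 < ε ∧
      ¬ IsCompactOperator (cfc (fun t : ℝ => max (t - ε) 0) T : H →L[ℂ] H) := by
    by_contra! hcon
    refine hT ?_
    have hclosed : IsClosed {y : H →L[ℂ] H | IsCompactOperator y} :=
      isClosed_setOfPred_isCompactOperator
    refine hclosed.closure_subset (Metric.mem_closure_iff.2 fun ε hε => ?_)
    refine ⟨_, hcon (ε / 2) (half_pos hε), ?_⟩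
    rw [dist_eq_norm]
    have e1 : T - cfc (fun t : ℝ => max (t - ε / 2) 0) T
        = cfc (fun t : ℝ => t - max (t - ε / 2) 0) T := by
      rw [cfc_sub (fun t : ℝ => t) (fun t : ℝ => max (t - ε / 2) 0) T (by fun_prop) (by fun_prop),
        cfc_id' ℝ T]
    rw [e1]
    refine lt_of_le_of_lt (norm_cfc_le (half_pos hε).le fun t ht => ?_) (half_lt_self hε)
    have ht0 : 0 ≤ t := spectrum_nonneg_of_nonneg hT0 ht
    rw [Real.norm_eq_abs, abs_le]
    constructor <;> rcases max_cases (t - ε / 2) 0 with h | h <;> linarith [h.1, h.2]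
  set f : H →L[ℂ] H := cfc (fun t : ℝ => max (t - ε) 0) T
  set g : H →L[ℂ] H := cfc (fun t : ℝ => (max t ε)⁻¹) T
  have hgc : Continuous fun t : ℝ => (max t ε)⁻¹ :=
    (continuous_id.max continuous_const).inv₀ fun t => (hε.trans_le (le_max_right _ _)).ne'
  -- On the support of `(t - ε)₊` the function `(max t ε)⁻¹` is `t⁻¹`.
  have hgf : g * T * f = f := by
    have e1 : g * T = cfc (fun t : ℝ => (max t ε)⁻¹ * t) T := by
      rw [cfc_mul (fun t : ℝ => (max t ε)⁻¹) (fun t : ℝ => t) T hgc.continuousOn (by fun_prop),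
        cfc_id' ℝ T]
    rw [e1, ← cfc_mul (fun t : ℝ => (max t ε)⁻¹ * t) (fun t : ℝ => max (t - ε) 0) T
      (hgc.mul continuous_id).continuousOn (by fun_prop)]
    refine cfc_congr fun t _ => ?_
    rcases le_total t ε with h | h
    · rw [max_eq_right (sub_nonpos.2 h), mul_zero]
    · rw [max_eq_left h, inv_mul_cancel₀ (hε.trans_le h).ne', one_mul]
  let M : Submodule ℂ H := (LinearMap.range f.toLinearMap).topologicalClosure
  have hMc : IsClosed (M : Set H) := Submodule.isClosed_topologicalClosure _
  have : CompleteSpace M := hMc.completeSpace_coe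
  have hM : ¬ FiniteDimensional ℂ M := by
    intro hfd
    refine hnc ?_
    let f' : H →L[ℂ] M := f.codRestrict M fun ξ => Submodule.le_topologicalClosure _ ⟨ξ, rfl⟩
    have : ProperSpace M := FiniteDimensional.proper ℂ M
    have h : IsCompactOperator M.subtypeL := isCompactOperator_of_locallyCompactSpace_rng M.subtypeL
    exact h.comp_clm f'
  have hgT : ∀ η ∈ M, (g * T) η = η := by
    intro η hη
    have hcl : IsClosed {η : H | (g * T) η = η} := isClosed_eq (g * T).continuous continuous_id
    refine hcl.closure_subset_iff.2 ?_ hη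
    rintro _ ⟨ξ, rfl⟩
    exact congrArg (fun y : H →L[ℂ] H => y ξ) hgf
  obtain ⟨V⟩ := exists_linearIsometry_of_infinite (H := H) hM
  let W : H →L[ℂ] H := M.subtypeL ∘L V.toContinuousLinearMap
  have hW : star W * W = 1 := by
    rw [ContinuousLinearMap.star_eq_adjoint]
    exact (ContinuousLinearMap.norm_map_iff_adjoint_comp_self W).1 fun ξ => V.norm_map ξ
  obtain ⟨w, hw⟩ := exists_cfcAbs_eq_mul x
  refine ⟨star W * g * w, W, ?_⟩
  have h1 : g * T * W = W := by
    ext ξ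
    exact hgT _ (V ξ).2
  calc star W * g * w * x * W = star W * (g * (w * x) * W) := by simp only [mul_assoc]
    _ = 1 := by rw [← hw, h1, hW]

end Calkin

/-! ### Stability of the ideal under the expectation, and automatic continuity -/

namespace SymmetricallyNormedIdeal

variable {H : Type*} [NormedAddCommGroup H] [InnerProductSpace ℂ H] [CompleteSpace H]
  {J : SymmetricallyNormedIdeal H}

/-- For compact `x` this is the comparison of Ky Fan sums. A noncompact `x` in the ideal puts `1` in
it, and then every operator belongs to it. -/
theorem IsArithmeticallyMeanClosed.diagonalExpectation_mem [TopologicalSpace.SeparableSpace H]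
    (hH : ¬ FiniteDimensional ℂ H) (hJ : J.IsArithmeticallyMeanClosed) {a : H →L[ℂ] H}
    (ha : IsStarNormal a) {x : H →L[ℂ] H} (hx : x ∈ J.ideal) :
    diagonalExpectation a ha x ∈ J.ideal := by
  by_cases hc : IsCompactOperator x
  · exact hJ _ _ (hc.diagonalExpectation ha) hc
      (sum_singularValue_diagonalExpectation_le hH ha hc) hx
  · obtain ⟨b, c, h⟩ := exists_mul_mul_eq_one_of_not_isCompactOperator hc
    have h1 : (1 : H →L[ℂ] H) ∈ J.ideal := by
      rw [← h]
      exact J.mul_mem_right _ _ (J.mul_mem_left _ _ hx)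
    simpa using J.mul_mem_left (diagonalExpectation a ha x) 1 h1

variable (J)

/-- A linear endomorphism of the ideal that is the restriction of a continuous map of bounded
operators is continuous. -/
theorem continuous_of_incl_eq (L : J.Space →ₗ[ℝ] J.Space) {Λ : (H →L[ℂ] H) → (H →L[ℂ] H)}
    -- Closed graph theorem: limits in `J` are limits in operator norm, where `Λ` is continuous, and
    -- `incl` is injective. No estimate of `L` in the norm of `J` is required.
    (hΛ : Continuous Λ) (h : ∀ x, J.incl (L x) = Λ (J.incl x)) : Continuous L := by
  refine L.continuous_of_seq_closed_graph fun u x y hu hL => J.incl_injective ?_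
  have h1 := (J.continuous_incl.tendsto y).comp hL
  have h2 := ((hΛ.comp J.continuous_incl).tendsto x).comp hu
  rw [h]
  refine tendsto_nhds_unique h1 (h2.congr fun n => ?_)
  exact (h _).symm

/-- The involution of the ideal, as a linear map. -/
def starₗ : J.Space →ₗ[ℝ] J.Space where
  toFun x := ⟨star (J.incl x), J.star_mem (J.incl_mem x)⟩
  map_add' x y := J.incl_injective ((congrArg star (map_add J.incl x y)).trans (star_add _ _))
  map_smul' c x := J.incl_injective <| by
    refine (congrArg star (J.incl.map_smul (c : ℂ) x)).trans ?_
    rw [star_smul]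
    refine Eq.trans ?_ (J.incl.map_smul (c : ℂ) _).symm
    simp
    rfl

/-- The involution of the ideal. -/
def starL : J.Space →L[ℝ] J.Space :=
  ⟨J.starₗ, J.continuous_of_incl_eq J.starₗ continuous_star fun _ => rfl⟩

theorem incl_starL (x : J.Space) : J.incl (J.starL x) = star (J.incl x) := rfl

end SymmetricallyNormedIdeal

/-! ### Spectral theorem for compact normal operators and the commutant -/

section CompactNormal

variable {H : Type*} [NormedAddCommGroup H] [InnerProductSpace ℂ H] [CompleteSpace H]

theorem star_apply_of_mem_eigSpace {a : H →L[ℂ] H} (ha : IsStarNormal a) {z : ℂ} {ξ : H}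
    (hξ : ξ ∈ eigSpace a z) : star a ξ = (starRingEnd ℂ z) • ξ := by
  have hn : IsStarNormal (a - algebraMap ℂ (H →L[ℂ] H) z) := by
    refine ⟨?_⟩
    have h := ha.star_comm_self
    rw [star_sub, ← algebraMap_star_comm]
    exact ((h.sub_right (Algebra.commutes z _).symm).sub_left
      ((Algebra.commutes (star z) _)))
  have h0 : (a - algebraMap ℂ (H →L[ℂ] H) z) ξ = 0 := by
    simp [Algebra.algebraMap_eq_smul_one, mem_eigSpace.1 hξ]
  have h1 := (ContinuousLinearMap.IsStarNormal.adjoint_apply_eq_zero_iff hn ξ).2 h0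
  rw [← ContinuousLinearMap.star_eq_adjoint, star_sub, ← algebraMap_star_comm,
    sub_apply, sub_eq_zero] at h1
  rw [h1]
  simp [Algebra.algebraMap_eq_smul_one]

theorem eigProj_mul {a : H →L[ℂ] H} (ha : IsStarNormal a) (z : ℂ) :
    eigProj a z * a = z • eigProj a z := by
  have h : star a * eigProj a z = (starRingEnd ℂ z) • eigProj a z := by
    ext ξ
    exact star_apply_of_mem_eigSpace ha (eigProj_mem a z ξ)
  have h2 := congrArg star h
  rw [star_mul, star_star, star_smul, star_eigProj] at h2
  simpa using h2

theorem orthogonal_iSup_eigSpace_invariant (a : H →L[ℂ] H) (ha : IsStarNormal a) :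
    (∀ ξ ∈ (⨆ z, eigSpace a z)ᗮ, a ξ ∈ (⨆ z, eigSpace a z)ᗮ) ∧
      ∀ ξ ∈ (⨆ z, eigSpace a z)ᗮ, star a ξ ∈ (⨆ z, eigSpace a z)ᗮ := by
  simp only [← Submodule.iInf_orthogonal, Submodule.mem_iInf]
  refine ⟨fun ξ hξ z η hη => ?_, fun ξ hξ z η hη => ?_⟩
  · rw [← ContinuousLinearMap.adjoint_inner_left, ← ContinuousLinearMap.star_eq_adjoint,
      star_apply_of_mem_eigSpace ha hη, inner_smul_left, hξ z η hη, mul_zero]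
  · rw [ContinuousLinearMap.star_eq_adjoint, ContinuousLinearMap.adjoint_inner_right,
      mem_eigSpace.1 hη, inner_smul_left, hξ z η hη, mul_zero]

/-- The eigenspaces of a compact normal operator span a dense subspace. -/
theorem orthogonal_iSup_eigSpace_eq_bot {a : H →L[ℂ] H} (hac : IsCompactOperator a)
    (ha : IsStarNormal a) : (⨆ z, eigSpace a z)ᗮ = ⊥ := by
  obtain ⟨hWa, hWs⟩ := orthogonal_iSup_eigSpace_invariant a ha
  set W := (⨆ z, eigSpace a z)ᗮ
  have hWe : ∀ z, ∀ ξ ∈ W, ξ ∈ eigSpace a z → ξ = 0 := by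
    intro z ξ hξ hz
    exact inner_self_eq_zero.1 (hξ ξ (Submodule.mem_iSup_of_mem z hz))
  let T : H →L[ℂ] H := star a * a
  have hWT : ∀ ξ ∈ W, T ξ ∈ W := fun ξ hξ => hWs _ (hWa _ hξ)
  have hTs : T.IsSymmetric := (IsSelfAdjoint.star_mul_self a).isSymmetric
  have hTc : IsCompactOperator T := hac.mul_left _
  let S : W →L[ℂ] W := T.restrict hWT
  have hSc : IsCompactOperator S := hTc.restrict' hWT
  have hSs : S.IsSymmetric := hTs.restrict_invariant hWT
  -- A nonzero eigenvalue of `a⋆ a` on `W` would have a finite-dimensional eigenspace `N` in `W`. By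
  -- normality `a` preserves `N`, hence has an eigenvector there, against `hWe`.
  have hS0 : S = 0 := by
    rw [← ContinuousLinearMap.eq_zero_of_forall_hasEigenvalue_eq_zero hSc hSs]
    intro μ hμ
    by_contra hμ0
    let N : Submodule ℂ H := Module.End.eigenspace T.toLinearMap μ ⊓ W
    have hfd := ContinuousLinearMap.finite_dimensional_eigenspace (T := T) hTc μ hμ0
    have hN : FiniteDimensional ℂ N := Submodule.finiteDimensional_of_le inf_le_left
    obtain ⟨v, hv⟩ := hμ.exists_hasEigenvector
    have hvN : (v : H) ∈ N :=
      ⟨Module.End.mem_eigenspace_iff.2 (congrArg Subtype.val hv.apply_eq_smul), v.2⟩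
    have : Nontrivial N := ⟨⟨v, hvN⟩, 0, fun h => hv.2 (Subtype.ext (congrArg (fun u : N => (u : H)) h))⟩
    have hNa : ∀ ξ ∈ N, a.toLinearMap ξ ∈ N := by
      rintro ξ ⟨h1, h2⟩
      refine ⟨Module.End.mem_eigenspace_iff.2 ?_, hWa ξ h2⟩
      have h3 : T ξ = μ • ξ := Module.End.mem_eigenspace_iff.1 h1
      have h4 : T * a = a * T := by
        simp only [T]
        rw [← mul_assoc a, ← ha.star_comm_self.eq]
      change (T * a) ξ = μ • a ξ
      rw [h4, mul_apply_eq_comp, h3, map_smul]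
    obtain ⟨c, hc⟩ := Module.End.exists_eigenvalue (a.toLinearMap.restrict hNa)
    obtain ⟨w, hw⟩ := hc.exists_hasEigenvector
    refine hw.2 (Subtype.ext (hWe c w w.2.2 (mem_eigSpace.2 ?_)))
    exact congrArg Subtype.val hw.apply_eq_smul
  rw [Submodule.eq_bot_iff]
  intro ξ hξ
  refine hWe 0 ξ hξ (mem_eigSpace.2 ?_)
  have h1 : T ξ = 0 := congrArg Subtype.val (congrArg (fun R : W →L[ℂ] W => R ⟨ξ, hξ⟩) hS0)
  have h2 : inner ℂ (a ξ) (a ξ) = 0 := by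
    rw [← ContinuousLinearMap.adjoint_inner_right, ← ContinuousLinearMap.star_eq_adjoint]
    change inner ℂ ξ (T ξ) = 0
    rw [h1, inner_zero_right]
  rw [inner_self_eq_zero.1 h2, zero_smul]

/-- By Bessel's inequality the sum converges. Its difference from `ξ` is killed by every
eigenprojection, so it is orthogonal to all eigenspaces and vanishes. -/
theorem hasSum_eigProj {a : H →L[ℂ] H} (hac : IsCompactOperator a) (ha : IsStarNormal a) (ξ : H) :
    HasSum (fun z => eigProj a z ξ) ξ := by
  have hs : Summable fun z => eigProj a z ξ := by
    refine ((orthogonalFamily_eigSpace a ha).summable_iff_norm_sq_summable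
      (fun z => ⟨eigProj a z ξ, eigProj_mem a z _⟩)).2 ?_
    exact summable_of_sum_le (fun z => by positivity) (sum_norm_eigProj_sq_le a ha ξ)
  have h0 : ξ - ∑' z, eigProj a z ξ ∈ (⨆ z, eigSpace a z)ᗮ := by
    rw [← Submodule.iInf_orthogonal, Submodule.mem_iInf]
    intro w
    rw [← Submodule.starProjection_apply_eq_zero_iff]
    change eigProj a w _ = 0
    rw [map_sub, ContinuousLinearMap.map_tsum _ hs, tsum_eq_single w, sub_eq_zero]
    · exact (congrArg (fun y : H →L[ℂ] H => y ξ) (eigProj_mul_self a w)).symm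
    · intro z hz
      exact congrArg (fun y : H →L[ℂ] H => y ξ) (eigProj_mul_of_ne ha hz.symm)
  rw [orthogonal_iSup_eigSpace_eq_bot hac ha, Submodule.mem_bot, sub_eq_zero] at h0
  have h := hs.hasSum
  rwa [← h0] at h

/-- An operator commuting with `a` preserves the eigenspaces, so `p_z x p_z = x p_z`, and the
projections `p_z` sum to `1`. This is where compactness of `a` is needed. -/
theorem diagonalExpectation_of_commute {a : H →L[ℂ] H} (hac : IsCompactOperator a)
    (ha : IsStarNormal a) {x : H →L[ℂ] H} (hx : x * a = a * x) :
    diagonalExpectation a ha x = x := by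
  ext ξ
  refine (hasSum_diagonalExpectation a ha x ξ).unique ?_
  have h : ∀ z, eigProj a z (x (eigProj a z ξ)) = x (eigProj a z ξ) := by
    intro z
    refine Submodule.starProjection_eq_self_iff.2 (mem_eigSpace.2 ?_)
    have h1 : a (x (eigProj a z ξ)) = x (a (eigProj a z ξ)) :=
      congrArg (fun y : H →L[ℂ] H => y (eigProj a z ξ)) hx.symm
    rw [h1, mem_eigSpace.1 (eigProj_mem a z ξ), map_smul]
  simp only [h]
  exact (hasSum_eigProj hac ha ξ).mapL x

/-- Block by block: `a p_z = z p_z = p_z a`, the second equality by normality. -/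
theorem diagonalExpectation_commute {a : H →L[ℂ] H} (ha : IsStarNormal a) (x : H →L[ℂ] H) :
    diagonalExpectation a ha x * a = a * diagonalExpectation a ha x := by
  ext ξ
  have h1 := hasSum_diagonalExpectation a ha x (a ξ)
  have h2 := (hasSum_diagonalExpectation a ha x ξ).mapL a
  have e : ∀ z, a (eigProj a z (x (eigProj a z ξ))) = eigProj a z (x (eigProj a z (a ξ))) := by
    intro z
    have e1 : eigProj a z (a ξ) = z • eigProj a z ξ :=
      congrArg (fun y : H →L[ℂ] H => y ξ) (eigProj_mul ha z)
    rw [e1, map_smul, map_smul, mem_eigSpace.1 (eigProj_mem a z _)]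
  simp only [e] at h2
  exact h1.unique h2

theorem star_diagonalExpectation {a : H →L[ℂ] H} (ha : IsStarNormal a) (x : H →L[ℂ] H) :
    star (diagonalExpectation a ha x) = diagonalExpectation a ha (star x) := by
  refine ContinuousLinearMap.ext fun ξ => ext_inner_right ℂ fun η => ?_
  rw [ContinuousLinearMap.star_eq_adjoint, ContinuousLinearMap.adjoint_inner_left]
  have h1 := (hasSum_diagonalExpectation a ha x η).mapL (innerSL ℂ ξ)
  have h2 := (hasSum_diagonalExpectation a ha (star x) ξ).mapL (innerSL ℂ η)
  have h3 := h2.mapL (Complex.conjCLE : ℂ →L[ℝ] ℂ)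
  have e : ∀ ζ, (Complex.conjCLE : ℂ →L[ℝ] ℂ) (innerSL ℂ η ζ) = inner ℂ ζ η := fun ζ =>
    inner_conj_symm _ _
  simp only [e] at h3
  refine h1.unique ?_
  convert! h3 using 2 with z
  have hp : ∀ u v : H, inner ℂ u (eigProj a z v) = inner ℂ (eigProj a z u) v := fun u v =>
    (Submodule.inner_starProjection_left_eq_right (eigSpace a z) u v).symm
  rw [innerSL_apply_apply, hp, ← hp _ η, ContinuousLinearMap.star_eq_adjoint,
    ContinuousLinearMap.adjoint_inner_left]

end CompactNormal

/-! ### The topological splitting of `𝔲_J` -/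

namespace SymmetricallyNormedIdeal

variable {H : Type*} [NormedAddCommGroup H] [InnerProductSpace ℂ H] [CompleteSpace H]
  {J : SymmetricallyNormedIdeal H}

theorem exists_expectation [TopologicalSpace.SeparableSpace H]
    (hH : ¬ FiniteDimensional ℂ H) (hJ : J.IsArithmeticallyMeanClosed) {a : H →L[ℂ] H}
    (ha : IsStarNormal a) :
    ∃ L : J.skew →L[ℝ] J.skew, ∀ x, J.incl (L x) = diagonalExpectation a ha (J.incl x) := by
  let L₀ : J.Space →ₗ[ℝ] J.Space :=
    { toFun := fun x => ⟨diagonalExpectation a ha (J.incl x),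
        hJ.diagonalExpectation_mem hH ha (J.incl_mem x)⟩
      map_add' := fun x y => J.incl_injective <|
        (congrArg _ (map_add J.incl x y)).trans (map_add (diagonalExpectation a ha) _ _)
      map_smul' := fun c x => J.incl_injective <|
        (congrArg _ (J.incl.map_smul (c : ℂ) x)).trans
          ((map_smul (diagonalExpectation a ha) (c : ℂ) _).trans
            (J.incl.map_smul (c : ℂ) (⟨diagonalExpectation a ha (J.incl x),
              hJ.diagonalExpectation_mem hH ha (J.incl_mem x)⟩ : J.ideal)).symm) }
  have hL₀ : ∀ x, J.incl (L₀ x) = diagonalExpectation a ha (J.incl x) := fun _ => rfl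
  have hc : Continuous L₀ := J.continuous_of_incl_eq L₀ (continuous_diagonalExpectation ha) hL₀
  have hskew : ∀ x : J.skew, L₀ x ∈ J.skew := fun x => by
    change star (J.incl (L₀ x)) = -J.incl (L₀ x)
    have hx : star (J.incl x) = -J.incl x := x.2
    rw [hL₀, star_diagonalExpectation, hx, map_neg]
  exact ⟨(⟨L₀, hc⟩ ∘L J.skew.subtypeL : J.skew →L[ℝ] J.Space).codRestrict J.skew hskew,
    fun x => rfl⟩

/-- On `𝔲_J` the expectation is a continuous idempotent. Its range is the commutant of `a`, as
`E(x)` commutes with `a` and `E` fixes what commutes with `a`. -/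
theorem isTopCompl_kerCommutator_kerExpectation [TopologicalSpace.SeparableSpace H]
    (hH : ¬ FiniteDimensional ℂ H) (hJ : J.IsArithmeticallyMeanClosed) {a : H →L[ℂ] H}
    (hac : IsCompactOperator a) (ha : IsStarNormal a) :
    (J.kerCommutator a).toSubmodule.IsTopCompl (J.kerExpectation a ha) := by
  obtain ⟨L, hL⟩ := exists_expectation hH hJ ha
  have hcomm : ∀ x : J.skew, x ∈ (J.kerCommutator a).toSubmodule ↔
      J.incl x * a = a * J.incl x := fun x => sub_eq_zero
  have hfix : ∀ x ∈ (J.kerCommutator a).toSubmodule, L x = x := fun x hx =>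
    J.skew_ext ((hL x).trans (diagonalExpectation_of_commute hac ha ((hcomm x).1 hx)))
  have hmem : ∀ x, L x ∈ (J.kerCommutator a).toSubmodule := fun x => by
    rw [hcomm, hL]
    exact diagonalExpectation_commute ha _
  have hidem : IsIdempotentElem L := by
    ext x : 1
    exact hfix _ (hmem x)
  have h1 : L.range = (J.kerCommutator a).toSubmodule := by
    ext x
    constructor
    · rintro ⟨y, rfl⟩
      exact hmem y
    · intro hx
      exact ⟨x, hfix x hx⟩
  have h2 : L.ker = J.kerExpectation a ha := by
    ext x
    change L x = 0 ↔ diagonalExpectation a ha (J.incl x) = 0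
    rw [← hL]
    constructor
    · intro h
      rw [h]
      exact map_zero J.incl
    · intro h
      exact J.skew_ext (h.trans (map_zero J.incl).symm)
  rw [← h1, ← h2]
  exact ContinuousLinearMap.IsIdempotentElem.isTopCompl hidem

end SymmetricallyNormedIdeal

/-! ### Split analytic submanifolds given by slice charts -/

section Submanifold

variable {E V M : Type*} [NormedAddCommGroup E] [NormedSpace ℝ E] [NormedAddCommGroup V]
  [NormedSpace ℝ V] [TopologicalSpace M]

/-- Slice charts exhibiting a topologically embedded subset `ι : M → V` of a Banach space as a split
real-analytic submanifold with model space `E`, included into `V` by `j` and complemented by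
means of `r`. -/
structure SliceData (ι : M → V) (j : E →L[ℝ] V) (r : V →L[ℝ] E) where
  isEmbedding : Topology.IsEmbedding ι
  leftInverse : ∀ e, r (j e) = e
  /-- the slice chart around a point -/
  slice : M → OpenPartialHomeomorph V V
  mem_source : ∀ m, ι m ∈ (slice m).source
  contDiffOn : ∀ m, ContDiffOn ℝ ω (slice m) (slice m).source
  contDiffOn_symm : ∀ m, ContDiffOn ℝ ω (slice m).symm (slice m).target
  mem_range_iff : ∀ m, ∀ v ∈ (slice m).source, v ∈ Set.range ι ↔ slice m v ∈ Set.range j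

namespace SliceData

variable {ι : M → V} {j : E →L[ℝ] V} {r : V →L[ℝ] E} (S : SliceData ι j r)
include S

theorem slice_eq (m u : M) (hu : ι u ∈ (S.slice m).source) :
    j (r (S.slice m (ι u))) = S.slice m (ι u) := by
  obtain ⟨e, he⟩ := (S.mem_range_iff m _ hu).1 ⟨u, rfl⟩
  rw [← he, S.leftInverse]

theorem ι_invFun (m : M) (e : E) (he : j e ∈ (S.slice m).target) :
    ι (@Function.invFun M V ⟨m⟩ ι ((S.slice m).symm (j e))) = (S.slice m).symm (j e) := by
  refine @Function.invFun_eq M V ⟨m⟩ ι _ ?_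
  refine (S.mem_range_iff m _ ((S.slice m).map_target he)).2 ⟨e, ?_⟩
  rw [(S.slice m).right_inv he]

/-- The chart of the submanifold induced by a slice chart. -/
def chart (m : M) : OpenPartialHomeomorph M E where
  toFun u := r (S.slice m (ι u))
  invFun e := @Function.invFun M V ⟨m⟩ ι ((S.slice m).symm (j e))
  source := ι ⁻¹' (S.slice m).source
  target := j ⁻¹' (S.slice m).target
  map_source' u hu := by
    change j (r (S.slice m (ι u))) ∈ (S.slice m).target
    rw [S.slice_eq m u hu]
    exact (S.slice m).map_source hu
  map_target' e he := by
    change ι (@Function.invFun M V ⟨m⟩ ι ((S.slice m).symm (j e))) ∈ (S.slice m).source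
    rw [S.ι_invFun m e he]
    exact (S.slice m).map_target he
  left_inv' u hu := by
    refine S.isEmbedding.injective ?_
    rw [S.ι_invFun m, S.slice_eq m u hu, (S.slice m).left_inv hu]
    rw [S.slice_eq m u hu]
    exact (S.slice m).map_source hu
  right_inv' e he := by
    rw [S.ι_invFun m e he, (S.slice m).right_inv he, S.leftInverse]
  open_source := (S.slice m).open_source.preimage S.isEmbedding.continuous
  open_target := (S.slice m).open_target.preimage j.continuous
  continuousOn_toFun := r.continuous.comp_continuousOn
    ((S.slice m).continuousOn.comp S.isEmbedding.continuous.continuousOn fun _ hu => hu)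
  continuousOn_invFun := by
    rw [S.isEmbedding.isInducing.continuousOn_iff]
    have h : ContinuousOn (fun e => (S.slice m).symm (j e)) (j ⁻¹' (S.slice m).target) :=
      (S.slice m).continuousOn_symm.comp j.continuous.continuousOn fun _ he => he
    exact h.congr fun e he => S.ι_invFun m e he

theorem chart_apply (m u : M) : S.chart m u = r (S.slice m (ι u)) := rfl

theorem chart_source (m : M) : (S.chart m).source = ι ⁻¹' (S.slice m).source := rfl

theorem ι_chart_symm (m : M) {e : E} (he : e ∈ (S.chart m).target) :
    ι ((S.chart m).symm e) = (S.slice m).symm (j e) := S.ι_invFun m e he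

theorem j_chart (m : M) {u : M} (hu : u ∈ (S.chart m).source) :
    j (S.chart m u) = S.slice m (ι u) := S.slice_eq m u hu

/-- The manifold structure defined by slice charts. -/
@[reducible]
def chartedSpace : ChartedSpace E M where
  atlas := Set.range S.chart
  chartAt := S.chart
  mem_chart_source := S.mem_source
  chart_mem_atlas m := ⟨m, rfl⟩

/-- A change of charts is `r ∘ slice' ∘ slice⁻¹ ∘ j`, a composition of analytic maps of the ambient
spaces. -/
theorem isManifold : @IsManifold ℝ _ E _ _ E _ 𝓘(ℝ, E) ω M _ S.chartedSpace := by
  let _ := S.chartedSpace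
  refine isManifold_of_contDiffOn 𝓘(ℝ, E) ω M ?_
  rintro _ _ ⟨m, rfl⟩ ⟨m', rfl⟩
  simp only [modelWithCornersSelf_coe, modelWithCornersSelf_coe_symm, Function.comp_id,
    Function.id_comp, Set.range_id, Set.inter_univ, Set.preimage_id_eq, id]
  have h : ContDiffOn ℝ ω (fun e => r (S.slice m' ((S.slice m).symm (j e))))
      ((S.chart m).symm ≫ₕ S.chart m').source := by
    refine r.contDiff.comp_contDiffOn ((S.contDiffOn m').comp ((S.contDiffOn_symm m).comp
      j.contDiff.contDiffOn fun e he => he.1) fun e he => ?_)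
    have h2 : ι ((S.chart m).symm e) ∈ (S.slice m').source := he.2
    rwa [S.ι_chart_symm m he.1] at h2
  refine h.congr fun e he => ?_
  rw [← S.ι_chart_symm m he.1]
  rfl

theorem chart_mem_maximalAtlas (m : M) :
    letI := S.chartedSpace
    S.chart m ∈ IsManifold.maximalAtlas 𝓘(ℝ, E) ω M := by
  let _ := S.chartedSpace
  have := S.isManifold
  exact IsManifold.subset_maximalAtlas ⟨m, rfl⟩

theorem slice_mem_maximalAtlas (m : M) :
    S.slice m ∈ IsManifold.maximalAtlas 𝓘(ℝ, V) ω V := by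
  refine StructureGroupoid.mem_maximalAtlas_of_mem_groupoid _ ?_
  rw [contDiffGroupoid, mem_groupoid_of_pregroupoid]
  simp only [contDiffPregroupoid, modelWithCornersSelf_coe,
    modelWithCornersSelf_coe_symm, Function.comp_id,
    Function.id_comp, Set.range_id, Set.inter_univ, Set.preimage_id_eq, id]
  exact ⟨S.contDiffOn m, S.contDiffOn_symm m⟩

/-- Since `r` is a left inverse of `j`, `V` is `E × ker r`; in a chart and its slice chart, `ι` is
`e ↦ (e, 0)`. -/
theorem isSmoothEmbedding :
    letI := S.chartedSpace
    IsSmoothEmbedding 𝓘(ℝ, E) 𝓘(ℝ, V) ω ι := by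
  let _ := S.chartedSpace
  refine ⟨?_, S.isEmbedding⟩
  let φ : (E × r.ker) ≃L[ℝ] V :=
    (ContinuousLinearEquiv.equivOfRightInverse r j S.leftInverse).symm
  refine ⟨r.ker, inferInstance, inferInstance, fun m => ?_⟩
  refine IsImmersionAtOfComplement.mk_of_charts φ (S.chart m) (S.slice m) (S.mem_source m)
    (S.mem_source m) (S.chart_mem_maximalAtlas m) (S.slice_mem_maximalAtlas m) (fun u hu => hu) ?_
  intro e he
  have he' : e ∈ (S.chart m).target := by simpa using he
  have h1 : S.slice m (ι ((S.chart m).symm e)) = j e := by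
    rw [S.ι_chart_symm m he', (S.slice m).right_inv he']
  simpa [φ, ContinuousLinearEquiv.equivOfRightInverse_symm_apply] using h1

theorem hasMFDerivAt {m : M} {D : V →L[ℝ] V}
    (hD : HasFDerivAt (S.slice m).symm D (S.slice m (ι m))) :
    letI := S.chartedSpace
    HasMFDerivAt 𝓘(ℝ, E) 𝓘(ℝ, V) ι m (D ∘L j) := by
  let _ := S.chartedSpace
  refine ⟨S.isEmbedding.continuous.continuousAt, HasFDerivAt.hasFDerivWithinAt ?_⟩
  change HasFDerivAt (fun e => ι ((S.chart m).symm e)) (D ∘L j) (S.chart m m)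
  have hm : m ∈ (S.chart m).source := S.mem_source m
  rw [← S.j_chart m hm] at hD
  refine (hD.comp _ j.hasFDerivAt).congr_of_eventuallyEq ?_
  filter_upwards [(S.chart m).open_target.mem_nhds ((S.chart m).map_source hm)] with e he
  exact S.ι_chart_symm m he

end SliceData

end Submanifold

/-! ### Brackets of related vector fields -/

section Related

open VectorField Filter Topology

variable {E V M : Type*} [NormedAddCommGroup E] [NormedSpace ℝ E] [NormedAddCommGroup V]
  [NormedSpace ℝ V]

/-- Differentiating the relations `Dc(ξ) = X ∘ c` and `Dc(η) = Y ∘ c` produces second derivatives of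
`c`, which cancel in the bracket by symmetry. -/
theorem fderiv_lieBracket_of_related {c : E → V} {ξ η : E → E} {X Y : V → V} {e : E}
    (hc : ContDiffAt ℝ ω c e) (hξ : DifferentiableAt ℝ ξ e) (hη : DifferentiableAt ℝ η e)
    (hX : DifferentiableAt ℝ X (c e)) (hY : DifferentiableAt ℝ Y (c e))
    (hξX : ∀ᶠ e' in 𝓝 e, fderiv ℝ c e' (ξ e') = X (c e'))
    (hηY : ∀ᶠ e' in 𝓝 e, fderiv ℝ c e' (η e') = Y (c e')) :
    fderiv ℝ c e (lieBracket ℝ ξ η e) = lieBracket ℝ X Y (c e) := by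
  have hsymm : IsSymmSndFDerivAt ℝ c e := hc.isSymmSndFDerivAt (by simp)
  have hc1 : DifferentiableAt ℝ c e := hc.differentiableAt (by simp)
  have hc2 : DifferentiableAt ℝ (fderiv ℝ c) e :=
    (hc.fderiv_right (m := 1) (by simp)).differentiableAt (by simp)
  have key : ∀ {ζ : E → E} {Z : V → V}, DifferentiableAt ℝ ζ e → DifferentiableAt ℝ Z (c e) →
      (∀ᶠ e' in 𝓝 e, fderiv ℝ c e' (ζ e') = Z (c e')) → ∀ h : E,
      fderiv ℝ (fderiv ℝ c) e h (ζ e) + fderiv ℝ c e (fderiv ℝ ζ e h)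
        = fderiv ℝ Z (c e) (fderiv ℝ c e h) := by
    intro ζ Z hζ hZ hζZ h
    have h1 := (hc2.hasFDerivAt.clm_apply hζ.hasFDerivAt).congr_of_eventuallyEq
      (EventuallyEq.symm hζZ)
    have h2 := h1.unique (hZ.hasFDerivAt.comp e hc1.hasFDerivAt)
    have h3 := DFunLike.congr_fun h2 h
    simpa [add_comm] using h3
  have k1 := key hξ hX hξX (η e)
  have k2 := key hη hY hηY (ξ e)
  rw [lieBracket, lieBracket, ← hξX.self_of_nhds, ← hηY.self_of_nhds, ← k1, ← k2, map_sub,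
    hsymm.eq (η e) (ξ e)]
  abel

variable [TopologicalSpace M] [ChartedSpace E M] [IsManifold 𝓘(ℝ, E) ω M] [CompleteSpace E]

/-- The flat case, read in a chart. It allows the bracket of left-invariant fields to be computed in
the ambient Banach space. -/
theorem mfderiv_mlieBracket_of_related {ι : M → V} {m : M}
    {ξ η : ∀ u : M, TangentSpace 𝓘(ℝ, E) u} {X Y : V → V}
    (hι : ContMDiff 𝓘(ℝ, E) 𝓘(ℝ, V) ω ι)
    (hξ : MDifferentiableAt 𝓘(ℝ, E) 𝓘(ℝ, E).tangent
      (fun u => (⟨u, ξ u⟩ : TangentBundle 𝓘(ℝ, E) M)) m)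
    (hη : MDifferentiableAt 𝓘(ℝ, E) 𝓘(ℝ, E).tangent
      (fun u => (⟨u, η u⟩ : TangentBundle 𝓘(ℝ, E) M)) m)
    (hX : DifferentiableAt ℝ X (ι m)) (hY : DifferentiableAt ℝ Y (ι m))
    (hξX : ∀ u, mfderiv 𝓘(ℝ, E) 𝓘(ℝ, V) ι u (ξ u) = X (ι u))
    (hηY : ∀ u, mfderiv 𝓘(ℝ, E) 𝓘(ℝ, V) ι u (η u) = Y (ι u)) :
    mfderiv 𝓘(ℝ, E) 𝓘(ℝ, V) ι m (mlieBracket 𝓘(ℝ, E) ξ η m) = lieBracket ℝ X Y (ι m) := by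
  have : IsManifold 𝓘(ℝ, E) 2 M := IsManifold.of_le (n := ω) (by simp)
  have : IsManifold 𝓘(ℝ, E) 1 M := IsManifold.of_le (n := ω) (by simp)
  set φ := extChartAt 𝓘(ℝ, E) m with hφ
  set c : E → V := fun e => ι (φ.symm e) with hcdef
  have htgt : ∀ e ∈ φ.target, ContMDiffAt 𝓘(ℝ, E) 𝓘(ℝ, E) ω φ.symm e := fun e he =>
    (contMDiffOn_extChartAt_symm m).contMDiffAt
      ((isOpen_extChartAt_target m).mem_nhds he)
  have hmem : φ.target ∈ 𝓝 (φ m) := extChartAt_target_mem_nhds m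
  have hc : ContDiffAt ℝ ω c (φ m) := by
    rw [← contMDiffAt_iff_contDiffAt]
    exact (hι.contMDiffAt).comp _ (htgt _ (mem_extChartAt_target m))
  have hchain : ∀ e ∈ φ.target, fderiv ℝ c e =
      (mfderiv 𝓘(ℝ, E) 𝓘(ℝ, V) ι (φ.symm e)).comp (mfderiv 𝓘(ℝ, E) 𝓘(ℝ, E) φ.symm e) := by
    intro e he
    rw [← mfderiv_eq_fderiv]
    exact mfderiv_comp e (hι.mdifferentiableAt (by simp)) ((htgt e he).mdifferentiableAt (by simp))
  have hrel : ∀ {ζ : ∀ u : M, TangentSpace 𝓘(ℝ, E) u} {Z : V → V},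
      (∀ u, mfderiv 𝓘(ℝ, E) 𝓘(ℝ, V) ι u (ζ u) = Z (ι u)) →
      ∀ᶠ e in 𝓝 (φ m), fderiv ℝ c e (mpullback 𝓘(ℝ, E) 𝓘(ℝ, E) φ.symm ζ e) = Z (c e) := by
    intro ζ Z h
    filter_upwards [hmem] with e he
    rw [hchain e he, ← h, mpullback_apply]
    have hinv : (mfderiv 𝓘(ℝ, E) 𝓘(ℝ, E) φ.symm e).IsInvertible := by
      have := isInvertible_mfderivWithin_extChartAt_symm (I := 𝓘(ℝ, E)) he
      rwa [modelWithCornersSelf_coe, Set.range_id, mfderivWithin_univ] at this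
    exact congrArg (mfderiv 𝓘(ℝ, E) 𝓘(ℝ, V) ι (φ.symm e)) (hinv.inverse_apply_eq.1 rfl).symm
  have hd : ∀ {ζ : ∀ u : M, TangentSpace 𝓘(ℝ, E) u}, MDifferentiableAt 𝓘(ℝ, E) 𝓘(ℝ, E).tangent
      (fun u => (⟨u, ζ u⟩ : TangentBundle 𝓘(ℝ, E) M)) m →
      DifferentiableAt ℝ (mpullback 𝓘(ℝ, E) 𝓘(ℝ, E) φ.symm ζ) (φ m) := by
    intro ζ h
    have := MDifferentiableWithinAt.differentiableWithinAt_mpullbackWithin_vectorField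
      (I := 𝓘(ℝ, E)) (s := Set.univ) (V := ζ) (x := m) h.mdifferentiableWithinAt
    rw [modelWithCornersSelf_coe, Set.range_id, mpullbackWithin_univ, Set.preimage_univ,
      Set.univ_inter] at this
    exact differentiableWithinAt_univ.1 this
  have hm : φ.symm (φ m) = m := extChartAt_to_inv m
  have hb := fderiv_lieBracket_of_related hc (hd hξ) (hd hη) (by simpa [hcdef, hm] using hX)
    (by simpa [hcdef, hm] using hY) (hrel hξX) (hrel hηY)
  have hcm : c (φ m) = ι m := by simp [hcdef, hm]
  rw [hcm] at hb
  have hι' : mfderiv 𝓘(ℝ, E) 𝓘(ℝ, V) ι m =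
      (fderiv ℝ c (φ m)).comp (mfderiv 𝓘(ℝ, E) 𝓘(ℝ, E) φ m) := by
    have h1 : c ∘ φ =ᶠ[𝓝 m] ι := by
      filter_upwards [extChartAt_source_mem_nhds (I := 𝓘(ℝ, E)) m] with u hu
      exact congrArg ι (φ.left_inv hu)
    rw [← h1.mfderiv_eq, ← mfderiv_eq_fderiv]
    exact mfderiv_comp m (hc.contMDiffAt.mdifferentiableAt (by simp))
      (mdifferentiableAt_extChartAt (mem_chart_source E m))
  have hinv := isInvertible_mfderiv_extChartAt (I := 𝓘(ℝ, E)) (mem_extChartAt_source m)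
  rw [← hb, ← mlieBracketWithin_univ, mlieBracketWithin_apply, hι', modelWithCornersSelf_coe,
    Set.range_id, mpullbackWithin_univ, mpullbackWithin_univ, Set.preimage_univ,
    Set.univ_inter]
  exact (congrArg (fderiv ℝ c (φ m)) (hinv.inverse_apply_eq.1 rfl).symm).trans
    (congrArg (fun F : E → E => fderiv ℝ c (φ m) (F (φ m))) lieBracketWithin_univ)
end Related

/-! ### Analytic maps on the ideal: products, Cayley transform, slice charts -/

theorem one_sub_smul_mul_inverse {R : Type*} [Ring R] [Algebra ℝ R] {r : ℝ} {b : R}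
    (h : IsUnit (1 + r • b)) :
    1 + (-r) • (b * Ring.inverse (1 + r • b)) = Ring.inverse (1 + r • b) := by
  have h1 := Ring.mul_inverse_cancel _ h
  rw [add_mul, one_mul, smul_mul_assoc] at h1
  rw [← h1, neg_smul]
  nth_rewrite 2 [h1]
  nth_rewrite 1 [← h1]
  abel_nf

namespace SymmetricallyNormedIdeal

variable {H : Type*} [NormedAddCommGroup H] [InnerProductSpace ℂ H] [CompleteSpace H]
  (J : SymmetricallyNormedIdeal H)

/-- The inclusion of `J` into the bounded operators as a continuous real-linear map. -/
def inclL : J.Space →L[ℝ] (H →L[ℂ] H) where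
  toLinearMap := J.incl.restrictScalars ℝ
  cont := J.continuous_incl

@[simp]
theorem inclL_apply (x : J.Space) : J.inclL x = J.incl x := rfl

theorem norm_mul_mul_le (b c : H →L[ℂ] H) (x y : J.Space) (h : J.incl y = b * J.incl x * c) :
    ‖y‖ ≤ ‖b‖ * ‖x‖ * ‖c‖ := by
  refine le_of_eq_of_le ?_ (J.idealNorm_mul_mul_le b c x)
  exact congrArg J.idealNorm (Subtype.ext h)

/-- Multiplication of elements of `J` by bounded operators from the left. -/
def mulLeft : (H →L[ℂ] H) →L[ℝ] J.Space →L[ℝ] J.Space :=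
  LinearMap.mkContinuous₂ (LinearMap.mk₂ ℝ
    (fun b x => (⟨b * J.incl x, J.mul_mem_left b _ (J.incl_mem x)⟩ : J.Space))
    (fun b c x => J.incl_injective (add_mul b c (J.incl x)))
    (fun r b x => J.incl_injective (smul_mul_assoc r b (J.incl x)))
    (fun b x y => J.incl_injective (mul_add b (J.incl x) (J.incl y)))
    (fun r b x => J.incl_injective (mul_smul_comm r b (J.incl x)))) 1 fun b x => by
      have h := J.norm_mul_mul_le b 1 x ⟨b * J.incl x, J.mul_mem_left b _ (J.incl_mem x)⟩
        (mul_one _).symm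
      rw [one_mul]
      refine h.trans (mul_le_of_le_one_right (by positivity) ContinuousLinearMap.norm_id_le)

/-- Multiplication of elements of `J` by bounded operators from the right. -/
def mulRight : (H →L[ℂ] H) →L[ℝ] J.Space →L[ℝ] J.Space :=
  LinearMap.mkContinuous₂ (LinearMap.mk₂ ℝ
    (fun b x => (⟨J.incl x * b, J.mul_mem_right _ b (J.incl_mem x)⟩ : J.Space))
    (fun b c x => J.incl_injective (mul_add (J.incl x) b c))
    (fun r b x => J.incl_injective (mul_smul_comm r (J.incl x) b))
    (fun b x y => J.incl_injective (add_mul (J.incl x) (J.incl y) b))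
    (fun r b x => J.incl_injective (smul_mul_assoc r (J.incl x) b))) 1 fun b x => by
      have h := J.norm_mul_mul_le 1 b x ⟨J.incl x * b, J.mul_mem_right _ b (J.incl_mem x)⟩
        (by rw [one_mul]; rfl)
      rw [one_mul, mul_comm]
      refine h.trans ?_
      gcongr
      exact mul_le_of_le_one_left (by positivity) ContinuousLinearMap.norm_id_le

@[simp]
theorem incl_mulLeft (b : H →L[ℂ] H) (x : J.Space) : J.incl (J.mulLeft b x) = b * J.incl x := rfl

@[simp]
theorem incl_mulRight (b : H →L[ℂ] H) (x : J.Space) : J.incl (J.mulRight b x) = J.incl x * b := rfl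

/-! ### The Cayley transform -/

/-- The map `v ↦ v (1 + r v)⁻¹`. -/
def mobiusFun (r : ℝ) (v : J.Space) : J.Space :=
  J.mulRight (Ring.inverse (1 + r • J.incl v)) v

theorem incl_mobiusFun (r : ℝ) (v : J.Space) :
    J.incl (J.mobiusFun r v) = J.incl v * Ring.inverse (1 + r • J.incl v) := rfl

variable {J}

theorem one_add_mobiusFun {r : ℝ} {v : J.Space} (hv : IsUnit (1 + r • J.incl v)) :
    1 + (-r) • J.incl (J.mobiusFun r v) = Ring.inverse (1 + r • J.incl v) :=
  one_sub_smul_mul_inverse hv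

theorem isUnit_one_add_mobiusFun {r : ℝ} {v : J.Space} (hv : IsUnit (1 + r • J.incl v)) :
    IsUnit (1 + (-r) • J.incl (J.mobiusFun r v)) := by
  rw [one_add_mobiusFun hv]
  exact hv.ringInverse

/-- For `w = v (1 + r v)⁻¹` one has `1 - r w = (1 + r v)⁻¹`, so `w (1 - r w)⁻¹ = v`. -/
theorem mobiusFun_neg_mobiusFun {r : ℝ} {v : J.Space} (hv : IsUnit (1 + r • J.incl v)) :
    J.mobiusFun (-r) (J.mobiusFun r v) = v := by
  apply J.incl_injective
  rw [incl_mobiusFun, one_add_mobiusFun hv, Ring.inverse_inverse hv, incl_mobiusFun,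
    Ring.inverse_mul_cancel_right _ _ hv]

theorem contDiffAt_mobiusFun {r : ℝ} {v : J.Space} (hv : IsUnit (1 + r • J.incl v)) :
    ContDiffAt ℝ ω (J.mobiusFun r) v := by
  have h : ContDiffAt ℝ ω (fun v => J.mulRight (Ring.inverse (1 + r • J.inclL v)) v) v := by
    refine ContDiffAt.clm_apply ?_ contDiffAt_id
    refine J.mulRight.contDiff.contDiffAt.comp _ ?_
    refine ContDiffAt.comp (g := Ring.inverse) v (contDiffAt_ringInverse ℝ hv.unit) ?_
    fun_prop
  exact h

variable (J) in
theorem isOpen_isUnit_one_add (r : ℝ) : IsOpen {v : J.Space | IsUnit (1 + r • J.incl v)} :=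
  Units.isOpen.preimage (by fun_prop : Continuous fun v => 1 + r • J.inclL v)

variable (J) in
/-- The map `v ↦ v (1 + r v)⁻¹` as a local diffeomorphism. For `r = 1 / 2` it is the map
`u - 1 ↦ 2 (u - 1) (u + 1)⁻¹`, the Cayley transform. -/
def mobius (r : ℝ) : OpenPartialHomeomorph J.Space J.Space where
  toFun := J.mobiusFun r
  invFun := J.mobiusFun (-r)
  source := {v | IsUnit (1 + r • J.incl v)}
  target := {v | IsUnit (1 + (-r) • J.incl v)}
  map_source' v hv := isUnit_one_add_mobiusFun hv
  map_target' v hv := by simpa using isUnit_one_add_mobiusFun (r := -r) hv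
  left_inv' v hv := mobiusFun_neg_mobiusFun hv
  right_inv' v hv := by simpa using mobiusFun_neg_mobiusFun (r := -r) hv
  open_source := J.isOpen_isUnit_one_add r
  open_target := J.isOpen_isUnit_one_add (-r)
  continuousOn_toFun v hv := (contDiffAt_mobiusFun hv).continuousAt.continuousWithinAt
  continuousOn_invFun v hv := (contDiffAt_mobiusFun hv).continuousAt.continuousWithinAt

theorem hasFDerivAt_mobiusFun_zero (r : ℝ) :
    HasFDerivAt (J.mobiusFun r) (ContinuousLinearMap.id ℝ J.Space) 0 := by
  have h0 : IsUnit (1 + r • J.incl 0) := by simp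
  have h1 : DifferentiableAt ℝ (fun v => Ring.inverse (1 + r • J.inclL v)) 0 :=
    (ContDiffAt.comp (g := Ring.inverse) 0 (contDiffAt_ringInverse ℝ h0.unit (n := ω))
      (by fun_prop)).differentiableAt (by simp)
  have h2 : HasFDerivAt (fun v => J.mulRight (Ring.inverse (1 + r • J.inclL v)))
      (J.mulRight ∘L fderiv ℝ (fun v => Ring.inverse (1 + r • J.inclL v)) 0) 0 :=
    J.mulRight.hasFDerivAt.comp 0 h1.hasFDerivAt
  refine (h2.clm_apply (hasFDerivAt_id 0)).congr_fderiv ?_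
  ext v
  apply J.incl_injective
  simp

theorem mobiusFun_zero (r : ℝ) : J.mobiusFun r 0 = 0 := by
  apply J.incl_injective
  rw [incl_mobiusFun, map_zero, zero_mul]

/-! ### Unitary operators and the Cayley transform -/

theorem incl_subOne (u : J.UnitaryGroup) : J.incl (J.subOne u) = (J.toUnitary u : H →L[ℂ] H) - 1 :=
  rfl

theorem one_add_incl_subOne (u : J.UnitaryGroup) :
    1 + J.incl (J.subOne u) = (J.toUnitary u : H →L[ℂ] H) := by
  rw [incl_subOne, add_sub_cancel]

theorem mem_range_subOne {v : J.Space} :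
    v ∈ Set.range J.subOne ↔ 1 + J.incl v ∈ unitary (H →L[ℂ] H) := by
  constructor
  · rintro ⟨u, rfl⟩
    rw [one_add_incl_subOne]
    exact (J.toUnitary u).2
  · intro h
    refine ⟨⟨⟨1 + J.incl v, h⟩, ?_⟩, J.incl_injective ?_⟩
    · change 1 + J.incl v - 1 ∈ J.ideal
      rw [add_sub_cancel_left]
      exact J.incl_mem v
    · exact add_sub_cancel_left _ _

theorem mem_skew_iff {v : J.Space} : v ∈ J.skew ↔ star (J.incl v) = -J.incl v := Iff.rfl

/-- With `T = 1 + b / 2` and `w T = b` one finds `T⋆ (w⋆ + w) T = (1 + b)⋆ (1 + b) - 1`. As `T` is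
invertible, `w` is skew-adjoint exactly if `1 + b` is isometric. In that case `1 + b = (1 + w / 2)
T` is also invertible, hence unitary: the first factor is the adjoint of `1 - w / 2 = T⁻¹`. -/
theorem mobiusFun_mem_skew_iff {v : J.Space} (hv : IsUnit (1 + (2⁻¹ : ℝ) • J.incl v)) :
    J.mobiusFun 2⁻¹ v ∈ J.skew ↔ 1 + J.incl v ∈ unitary (H →L[ℂ] H) := by
  rw [mem_skew_iff]
  set b := J.incl v with hb
  set T := 1 + (2⁻¹ : ℝ) • b with hT
  set w := J.incl (J.mobiusFun 2⁻¹ v) with hw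
  have hwT : w * T = b := Ring.inverse_mul_cancel_right T b hv
  have hT' : IsUnit (star T) := hv.star
  have key : star T * (star w + w) * T = (1 + star b) * (1 + b) - 1 := by
    have e : star T * (star w + w) * T = star (w * T) * T + star T * (w * T) := by
      rw [star_mul]; noncomm_ring
    rw [e, hwT, hT]
    simp only [star_add, star_one, star_smul, star_trivial, mul_add, add_mul, mul_one, one_mul,
      smul_mul_assoc, mul_smul_comm]
    have : star b * b = (2⁻¹ : ℝ) • (star b * b) + (2⁻¹ : ℝ) • (star b * b) := by
      rw [← add_smul]; norm_num
    nth_rewrite 3 [this]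
    abel
  constructor
  · intro h
    have h1 : star (1 + b) * (1 + b) = 1 := by
      rw [h, neg_add_cancel, mul_zero, zero_mul] at key
      rw [star_add, star_one]
      exact (sub_eq_zero.1 key.symm)
    have h2 : 1 + b = (1 + (2⁻¹ : ℝ) • w) * T := by
      rw [add_mul, one_mul, smul_mul_assoc, hwT, hT, add_assoc, ← add_smul]
      norm_num
    have h3 : 1 + (2⁻¹ : ℝ) • w = star (1 + (-2⁻¹ : ℝ) • w) := by
      rw [star_add, star_smul, h]; simp
    have h4 : IsUnit (1 + b) := by
      rw [h2, h3]
      exact (isUnit_one_add_mobiusFun hv).star.mul hv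
    exact Unitary.mem_iff.2 ⟨h1, by
      rw [← h4.mul_left_inj, mul_assoc, h1, mul_one, one_mul]⟩
  · intro h
    have h1 := (Unitary.mem_iff.1 h).1
    rw [star_add, star_one] at h1
    rw [h1, sub_self, hv.mul_left_eq_zero, hT'.mul_right_eq_zero] at key
    exact eq_neg_of_add_eq_zero_left key

theorem _root_.Commute.ringInverse_left {R : Type*} [Ring R] {x y : R} (h : Commute x y) :
    Commute (Ring.inverse x) y := by
  by_cases hx : IsUnit x
  · obtain ⟨u, rfl⟩ := hx
    rw [Ring.inverse_unit]
    exact h.units_inv_left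
  · rw [Ring.inverse_non_unit x hx]
    exact Commute.zero_left y

theorem Commute.incl_mobiusFun {v : J.Space} {r : ℝ} {a : H →L[ℂ] H} (h : Commute (J.incl v) a) :
    Commute (J.incl (J.mobiusFun r v)) a :=
  h.mul_left (Commute.ringInverse_left ((Commute.one_left a).add_left (h.smul_left r)))

/-- In the Cayley chart the isotropy condition is therefore linear, which makes one chart serve both
groups. -/
theorem commute_mobiusFun_iff {v : J.Space} (hv : IsUnit (1 + (2⁻¹ : ℝ) • J.incl v))
    {a : H →L[ℂ] H} : Commute (J.incl (J.mobiusFun 2⁻¹ v)) a ↔ Commute (J.incl v) a :=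
  ⟨fun h => by simpa [mobiusFun_neg_mobiusFun hv] using Commute.incl_mobiusFun (r := -2⁻¹) h,
    Commute.incl_mobiusFun⟩

/-! ### Left translations -/

variable (J) in
/-- Left translation by `g`, transported to `J` by means of `u ↦ u - 1`. -/
def translate (g : J.UnitaryGroup) (v : J.Space) : J.Space :=
  J.subOne g + J.mulLeft (J.toUnitary g : H →L[ℂ] H) v

theorem one_add_incl_translate (g : J.UnitaryGroup) (v : J.Space) :
    1 + J.incl (J.translate g v) = (J.toUnitary g : H →L[ℂ] H) * (1 + J.incl v) := by
  rw [translate, map_add, incl_mulLeft, ← add_assoc, one_add_incl_subOne, mul_add, mul_one]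

theorem ext_one_add {v w : J.Space} (h : 1 + J.incl v = 1 + J.incl w) : v = w :=
  J.incl_injective (add_left_cancel h)

theorem translate_mul (g h : J.UnitaryGroup) (v : J.Space) :
    J.translate g (J.translate h v) = J.translate (g * h) v := by
  apply ext_one_add
  simp only [one_add_incl_translate, map_mul, Submonoid.coe_mul, mul_assoc]

theorem translate_one (v : J.Space) : J.translate 1 v = v := by
  apply ext_one_add
  simp only [one_add_incl_translate, map_one, OneMemClass.coe_one, one_mul]

theorem translate_subOne (g u : J.UnitaryGroup) :
    J.translate g (J.subOne u) = J.subOne (g * u) := by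
  apply ext_one_add
  simp only [one_add_incl_translate, one_add_incl_subOne, map_mul, Submonoid.coe_mul]

theorem contDiff_translate (g : J.UnitaryGroup) : ContDiff ℝ ω (J.translate g) :=
  contDiff_const.add (J.mulLeft _).contDiff

theorem hasFDerivAt_translate (g : J.UnitaryGroup) (v : J.Space) :
    HasFDerivAt (J.translate g) (J.mulLeft (J.toUnitary g : H →L[ℂ] H)) v :=
  (J.mulLeft _).hasFDerivAt.const_add _

theorem subOne_one : J.subOne 1 = 0 := by
  apply ext_one_add
  rw [one_add_incl_subOne]
  simp

/-- Left translation by `g` as a homeomorphism of `J`. -/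
def translateHomeomorph (g : J.UnitaryGroup) : J.Space ≃ₜ J.Space where
  toFun := J.translate g
  invFun := J.translate g⁻¹
  left_inv v := by rw [translate_mul, inv_mul_cancel, translate_one]
  right_inv v := by rw [translate_mul, mul_inv_cancel, translate_one]
  continuous_toFun := (contDiff_translate g).continuous
  continuous_invFun := (contDiff_translate g⁻¹).continuous

/-- The slice chart of `U_J` around `g`. -/
def unitarySlice (g : J.UnitaryGroup) : OpenPartialHomeomorph J.Space J.Space :=
  (translateHomeomorph g⁻¹).transOpenPartialHomeomorph (J.mobius 2⁻¹)

theorem unitarySlice_apply (g : J.UnitaryGroup) (v : J.Space) :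
    unitarySlice g v = J.mobiusFun 2⁻¹ (J.translate g⁻¹ v) := rfl

theorem unitarySlice_symm_apply (g : J.UnitaryGroup) (w : J.Space) :
    (unitarySlice g).symm w = J.translate g (J.mobiusFun (-2⁻¹) w) := by
  change J.translate g⁻¹⁻¹ _ = _
  rw [inv_inv]
  rfl

theorem mem_unitarySlice_source {g : J.UnitaryGroup} {v : J.Space} :
    v ∈ (unitarySlice g).source ↔ IsUnit (1 + (2⁻¹ : ℝ) • J.incl (J.translate g⁻¹ v)) := Iff.rfl

theorem subOne_mem_unitarySlice_source (g : J.UnitaryGroup) :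
    J.subOne g ∈ (unitarySlice g).source := by
  rw [mem_unitarySlice_source, translate_subOne, inv_mul_cancel, subOne_one]
  simp

theorem unitarySlice_subOne (g : J.UnitaryGroup) : unitarySlice g (J.subOne g) = 0 := by
  rw [unitarySlice_apply, translate_subOne, inv_mul_cancel, subOne_one, mobiusFun_zero]

theorem contDiffOn_unitarySlice (g : J.UnitaryGroup) :
    ContDiffOn ℝ ω (unitarySlice g) (unitarySlice g).source := fun v hv =>
  (ContDiffAt.comp v (contDiffAt_mobiusFun hv)
    (contDiff_translate g⁻¹).contDiffAt).contDiffWithinAt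

theorem contDiffOn_unitarySlice_symm (g : J.UnitaryGroup) :
    ContDiffOn ℝ ω (unitarySlice g).symm (unitarySlice g).target := by
  intro w hw
  have h : ContDiffAt ℝ ω (fun w => J.translate g (J.mobiusFun (-2⁻¹) w)) w :=
    (contDiff_translate g).contDiffAt.comp w (contDiffAt_mobiusFun hw)
  refine (h.congr_of_eventuallyEq ?_).contDiffWithinAt
  exact Filter.Eventually.of_forall fun w => unitarySlice_symm_apply g w

theorem hasFDerivAt_unitarySlice_symm (g : J.UnitaryGroup) :
    HasFDerivAt (unitarySlice g).symm (J.mulLeft (J.toUnitary g : H →L[ℂ] H))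
      (unitarySlice g (J.subOne g)) := by
  rw [unitarySlice_subOne]
  have h := (hasFDerivAt_translate g _).comp 0 (hasFDerivAt_mobiusFun_zero (J := J) (-2⁻¹))
  rw [ContinuousLinearMap.comp_id] at h
  refine h.congr_of_eventuallyEq ?_
  exact Filter.Eventually.of_forall fun w => unitarySlice_symm_apply g w

theorem translate_mem_range_subOne_iff {g : J.UnitaryGroup} {v : J.Space} :
    J.translate g v ∈ Set.range J.subOne ↔ v ∈ Set.range J.subOne := by
  constructor
  · rintro ⟨u, hu⟩
    refine ⟨g⁻¹ * u, ?_⟩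
    rw [← translate_subOne, hu, translate_mul, inv_mul_cancel, translate_one]
  · rintro ⟨u, rfl⟩
    exact ⟨g * u, (translate_subOne g u).symm⟩

theorem isEmbedding_subOne : Topology.IsEmbedding J.subOne :=
  ⟨⟨rfl⟩, fun u v h => by
    have h1 : (J.toUnitary u : H →L[ℂ] H) = J.toUnitary v := by
      rw [← one_add_incl_subOne, ← one_add_incl_subOne, h]
    exact Subtype.ext (Subtype.ext h1)⟩

/-- The skew-adjoint part `x ↦ (x - x⋆) / 2`. -/
def skewPart : J.Space →L[ℝ] J.skew :=
  (2⁻¹ : ℝ) • (ContinuousLinearMap.id ℝ J.Space - J.starL).codRestrict J.skew fun x => by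
    rw [mem_skew_iff]
    change star (J.incl (x - J.starL x)) = -J.incl (x - J.starL x)
    rw [map_sub, incl_starL, star_sub, star_star]
    abel

theorem skewPart_coe (x : J.skew) : skewPart (x : J.Space) = x := by
  apply J.skew_ext
  have h : J.starL (x : J.Space) = -x := J.incl_injective (by
    rw [incl_starL, map_neg]; exact x.2)
  change J.inclL ((2⁻¹ : ℝ) • ((x : J.Space) - J.starL x)) = J.inclL x
  rw [h, sub_neg_eq_add, ← two_smul ℝ, smul_smul]
  norm_num

/-- The slice charts of the submanifold `U_J` of `1 + J`. -/
def unitarySliceData : SliceData J.subOne J.skew.subtypeL skewPart where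
  isEmbedding := isEmbedding_subOne
  leftInverse := skewPart_coe
  slice := unitarySlice
  mem_source := subOne_mem_unitarySlice_source
  contDiffOn := contDiffOn_unitarySlice
  contDiffOn_symm := contDiffOn_unitarySlice_symm
  mem_range_iff g v hv := by
    rw [← translate_mem_range_subOne_iff (g := g⁻¹), mem_range_subOne,
      ← mobiusFun_mem_skew_iff (mem_unitarySlice_source.1 hv), Submodule.coe_subtypeL, Submodule.coe_subtype,
      Subtype.range_coe]
    rfl

theorem mem_isotropy_iff {a : H →L[ℂ] H} {u : J.UnitaryGroup} :
    u ∈ J.isotropy a ↔ Commute (J.incl (J.subOne u)) a := by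
  have h1 : u ∈ J.isotropy a ↔ (J.toUnitary u : H →L[ℂ] H) * a *
      star (J.toUnitary u : H →L[ℂ] H) = a := Iff.rfl
  have h2 : Commute (J.incl (J.subOne u)) a ↔ Commute (J.toUnitary u : H →L[ℂ] H) a := by
    rw [incl_subOne]
    exact ⟨fun h => by simpa using h.add_left (Commute.one_left a),
      fun h => h.sub_left (Commute.one_left a)⟩
  rw [h1, h2]
  constructor
  · intro h
    have := congrArg (· * (J.toUnitary u : H →L[ℂ] H)) h
    rw [mul_assoc _ (star _), Unitary.star_mul_self_of_mem (J.toUnitary u).2, mul_one] at this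
    exact this
  · intro h
    rw [h.eq, mul_assoc, Unitary.mul_star_self_of_mem (J.toUnitary u).2, mul_one]

theorem mem_kerCommutator_iff {a : H →L[ℂ] H} {x : J.skew} :
    x ∈ (J.kerCommutator a).toSubmodule ↔ Commute (J.incl x) a := sub_eq_zero

/-- The slice charts of the submanifold `U_J(a)` of `1 + J`. -/
def isotropySliceData (a : H →L[ℂ] H) (p : J.skew →L[ℝ] (J.kerCommutator a).toSubmodule)
    (hp : ∀ x : (J.kerCommutator a).toSubmodule, p x = x) :
    SliceData (fun u : J.isotropy a => J.subOne u)
      (J.skew.subtypeL ∘L (J.kerCommutator a).toSubmodule.subtypeL) (p ∘L skewPart) where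
  isEmbedding := isEmbedding_subOne.comp .subtypeVal
  leftInverse x := by
    change p (skewPart ((x : J.skew) : J.Space)) = x
    rw [skewPart_coe, hp]
  slice g := unitarySlice g.1
  mem_source g := subOne_mem_unitarySlice_source g.1
  contDiffOn g := contDiffOn_unitarySlice g.1
  contDiffOn_symm g := contDiffOn_unitarySlice_symm g.1
  mem_range_iff g v hv := by
    -- Membership in `U_J` is settled by the slice chart of `U_J`. What remains is that `g⁻¹ u`
    -- fixes `a` exactly if its Cayley transform commutes with `a`.
    have h1 := unitarySliceData.mem_range_iff g.1 v hv
    constructor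
    · rintro ⟨u, rfl⟩
      obtain ⟨x, hx⟩ := h1.1 ⟨u.1, rfl⟩
      refine ⟨⟨x, ?_⟩, hx⟩
      rw [mem_kerCommutator_iff]
      change Commute (J.incl (J.skew.subtypeL x)) a
      rw [hx]
      change Commute (J.incl (J.mobiusFun 2⁻¹ (J.translate g.1⁻¹ (J.subOne u.1)))) a
      rw [translate_subOne]
      exact Commute.incl_mobiusFun (mem_isotropy_iff.1 (g⁻¹ * u).2)
    · rintro ⟨x, hx⟩
      obtain ⟨u, hu⟩ := h1.2 ⟨x.1, hx⟩
      have h2 := mem_kerCommutator_iff.1 x.2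
      have h3 : J.incl x.1 = J.incl (J.mobiusFun 2⁻¹ (J.translate g.1⁻¹ v)) := congrArg J.incl hx
      rw [h3, commute_mobiusFun_iff (mem_unitarySlice_source.1 hv), ← hu, translate_subOne, ← mem_isotropy_iff] at h2
      refine ⟨⟨u, ?_⟩, hu⟩
      simpa using mul_mem g.2 h2

end SymmetricallyNormedIdeal

/-! ### Analytic maps into and between submanifolds -/

namespace SliceData

variable {E V M : Type*} [NormedAddCommGroup E] [NormedSpace ℝ E] [NormedAddCommGroup V]
  [NormedSpace ℝ V] [TopologicalSpace M]
variable {ι : M → V} {j : E →L[ℝ] V} {r : V →L[ℝ] E} (S : SliceData ι j r)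

/-- Analyticity of a map into the submanifold can be tested in the ambient space, as `ι` is both an
immersion and a topological embedding. -/
theorem contMDiff_of_comp {F X N : Type*} [NormedAddCommGroup F] [NormedSpace ℝ F]
    [TopologicalSpace X] {I : ModelWithCorners ℝ F X}
    [TopologicalSpace N] [ChartedSpace X N] {f : N → M}
    (hf : ContMDiff I 𝓘(ℝ, V) ω (fun n => ι (f n))) :
    letI := S.chartedSpace
    ContMDiff I 𝓘(ℝ, E) ω f := by
  let _ := S.chartedSpace
  have := S.isManifold
  exact (ContMDiff.iff_comp_isImmersion S.isSmoothEmbedding.isImmersion).2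
    ⟨S.isEmbedding.continuous_iff.2 hf.continuous, hf⟩

theorem contMDiff : letI := S.chartedSpace
    ContMDiff 𝓘(ℝ, E) 𝓘(ℝ, V) ω ι := by
  let _ := S.chartedSpace
  have := S.isManifold
  exact S.isSmoothEmbedding.isImmersion.contMDiff

/-- Both submanifolds use the same slice charts, so in the induced charts `i` is the linear map `k`,
whose range is complemented by means of `φ`. -/
theorem isSmoothEmbedding_of_comp {E' M' F : Type*} [NormedAddCommGroup E'] [NormedSpace ℝ E']
    [NormedAddCommGroup F] [NormedSpace ℝ F] [TopologicalSpace M'] {i : M' → M}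
    {k : E' →L[ℝ] E} {r' : V →L[ℝ] E'} (S : SliceData ι j r)
    (S' : SliceData (fun m => ι (i m)) (j ∘L k) r') (hslice : ∀ m, S'.slice m = S.slice (i m))
    (φ : (E' × F) ≃L[ℝ] E) (hφ : ∀ e, φ (e, 0) = k e) :
    letI := S.chartedSpace
    letI := S'.chartedSpace
    IsSmoothEmbedding 𝓘(ℝ, E') 𝓘(ℝ, E) ω i := by
  let _ := S.chartedSpace
  let _ := S'.chartedSpace
  have := S.isManifold
  refine ⟨?_, Topology.IsEmbedding.of_comp ?_ S.isEmbedding.continuous S'.isEmbedding⟩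
  · refine IsImmersionOfComplement.isImmersion (F := F) fun m => ?_
    have hsource : (S'.chart m).source ⊆ i ⁻¹' (S.chart (i m)).source := fun u hu => by
      rw [S'.chart_source, hslice] at hu
      exact hu
    refine IsImmersionAtOfComplement.mk_of_charts φ (S'.chart m) (S.chart (i m)) (S'.mem_source m)
      (S.mem_source (i m)) (S'.chart_mem_maximalAtlas m) (S.chart_mem_maximalAtlas (i m))
      hsource ?_
    intro e he
    have he' : e ∈ (S'.chart m).target := by simpa using he
    have h1 : S.chart (i m) (i ((S'.chart m).symm e)) = k e := by
      rw [S.chart_apply, S'.ι_chart_symm m he', ← hslice, (S'.slice m).right_inv he']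
      exact S.leftInverse (k e)
    simpa [hφ] using h1
  · exact S.isEmbedding.isInducing.continuous_iff.2 S'.isEmbedding.continuous

end SliceData

/-! ### The Lie group `U_J`, its Lie algebra and the differential of the orbit map -/

namespace SymmetricallyNormedIdeal

variable {H : Type*} [NormedAddCommGroup H] [InnerProductSpace ℂ H] [CompleteSpace H]
  {J : SymmetricallyNormedIdeal H}

theorem subOne_mul (u v : J.UnitaryGroup) : J.subOne (u * v) =
    J.subOne u + J.subOne v + J.mulLeft (J.incl (J.subOne u)) (J.subOne v) := by
  rw [← translate_subOne, translate, ← one_add_incl_subOne, map_add, add_assoc]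
  congr 2

theorem subOne_inv (u : J.UnitaryGroup) : J.subOne u⁻¹ = J.starL (J.subOne u) := by
  apply J.incl_injective
  rw [incl_starL, incl_subOne, incl_subOne, star_sub, star_one]
  rfl

section Lie

variable {G E : Type*} [NormedAddCommGroup E] [NormedSpace ℝ E] [TopologicalSpace G] [Group G]
  {j : E →L[ℝ] J.Space} {r : J.Space →L[ℝ] E} (f : G →* J.UnitaryGroup)
  (S : SliceData (fun g => J.subOne (f g)) j r)

/-- In the coordinate `x = u - 1` the product is `x + y + x y` and the inverse is `x⋆`. The
homomorphism `f` is the identity of `U_J` or the inclusion of `U_J(a)`, so that one argument covers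
both. -/
theorem lieGroup_of_sliceData : letI := S.chartedSpace
    LieGroup 𝓘(ℝ, E) ω G := by
  let _ := S.chartedSpace
  have := S.isManifold
  exact
  { contMDiff_mul := by
      refine S.contMDiff_of_comp ?_
      have h1 : ContMDiff (𝓘(ℝ, E).prod 𝓘(ℝ, E)) 𝓘(ℝ, J.Space) ω
        fun p : G × G => J.subOne (f p.1) := S.contMDiff.comp contMDiff_fst
      have h2 : ContMDiff (𝓘(ℝ, E).prod 𝓘(ℝ, E)) 𝓘(ℝ, J.Space) ω
        fun p : G × G => J.subOne (f p.2) := S.contMDiff.comp contMDiff_snd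
      simp only [map_mul, subOne_mul]
      refine (h1.add h2).add (ContMDiff.clm_apply ?_ h2)
      exact (J.mulLeft ∘L J.inclL).contDiff.contMDiff.comp h1
    contMDiff_inv := by
      refine S.contMDiff_of_comp ?_
      simp only [map_inv, subOne_inv]
      exact J.starL.contDiff.contMDiff.comp S.contMDiff }

theorem hasMFDerivAt_subOne (hS : ∀ g, S.slice g = unitarySlice (f g)) (g : G) :
    letI := S.chartedSpace
    HasMFDerivAt 𝓘(ℝ, E) 𝓘(ℝ, J.Space) (fun g => J.subOne (f g)) g
      (J.mulLeft (J.toUnitary (f g) : H →L[ℂ] H) ∘L j) := by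
  refine S.hasMFDerivAt ?_
  rw [hS]
  exact hasFDerivAt_unitarySlice_symm (f g)

theorem mfderiv_subOne_one (hS : ∀ g, S.slice g = unitarySlice (f g)) (X : E) :
    letI := S.chartedSpace
    mfderiv 𝓘(ℝ, E) 𝓘(ℝ, J.Space) (fun g => J.subOne (f g)) 1 X = j X := by
  let _ := S.chartedSpace
  rw [(hasMFDerivAt_subOne f S hS 1).mfderiv]
  apply J.incl_injective
  change (J.toUnitary (f 1) : H →L[ℂ] H) * J.incl (j X) = _
  simp

end Lie

/-- The manifold structure of `U_J`. -/
@[reducible]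
def unitaryChartedSpace (J : SymmetricallyNormedIdeal H) : ChartedSpace J.skew J.UnitaryGroup :=
  unitarySliceData.chartedSpace

attribute [local instance] unitaryChartedSpace

instance lieGroup_unitaryGroup : LieGroup 𝓘(ℝ, J.skew) ω J.UnitaryGroup :=
  lieGroup_of_sliceData (MonoidHom.id J.UnitaryGroup) unitarySliceData

theorem contMDiff_subOne : ContMDiff 𝓘(ℝ, J.skew) 𝓘(ℝ, J.Space) ω J.subOne :=
  unitarySliceData.contMDiff

theorem mfderiv_subOne_apply (X : J.skew) :
    mfderiv 𝓘(ℝ, J.skew) 𝓘(ℝ, J.Space) J.subOne 1 X = (X : J.Space) :=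
  mfderiv_subOne_one (MonoidHom.id J.UnitaryGroup) unitarySliceData (fun _ => rfl) X

/-- The derivative at `1` of `subOne (g * u) = translate g (subOne u)`. It identifies the
left-invariant field with the restriction of the affine field `v ↦ (1 + v) x` on `J`. -/
theorem mfderiv_subOne_mulInvariantVectorField
    (X : GroupLieAlgebra 𝓘(ℝ, J.skew) J.UnitaryGroup) (g : J.UnitaryGroup) :
    mfderiv 𝓘(ℝ, J.skew) 𝓘(ℝ, J.Space) J.subOne g (mulInvariantVectorField X g) =
      J.mulLeft (1 + J.incl (J.subOne g)) (mfderiv 𝓘(ℝ, J.skew) 𝓘(ℝ, J.Space) J.subOne 1 X) := by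
  have h1 : HasMFDerivAt 𝓘(ℝ, J.skew) 𝓘(ℝ, J.Space) (fun u => J.subOne (g * u)) 1
      ((mfderiv 𝓘(ℝ, J.skew) 𝓘(ℝ, J.Space) J.subOne (g * 1)).comp
        (mfderiv 𝓘(ℝ, J.skew) 𝓘(ℝ, J.skew) (g * ·) 1)) :=
    HasMFDerivAt.comp (g := J.subOne) (1 : J.UnitaryGroup)
      (contMDiff_subOne.mdifferentiableAt (by simp)).hasMFDerivAt
      ((contMDiff_mul_left (I := 𝓘(ℝ, J.skew)) (n := ω)).mdifferentiableAt (by simp)).hasMFDerivAt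
  have h2 : HasMFDerivAt 𝓘(ℝ, J.skew) 𝓘(ℝ, J.Space) (fun u => J.translate g (J.subOne u)) 1
      ((J.mulLeft (J.toUnitary g : H →L[ℂ] H)).comp
        (mfderiv 𝓘(ℝ, J.skew) 𝓘(ℝ, J.Space) J.subOne 1)) :=
    HasMFDerivAt.comp (g := J.translate g) (1 : J.UnitaryGroup)
      (hasFDerivAt_translate g _).hasMFDerivAt
      (contMDiff_subOne.mdifferentiableAt (by simp)).hasMFDerivAt
  have h3 := hasMFDerivAt_unique h1 (h2.congr_of_eventuallyEq
    (Filter.Eventually.of_forall fun u => (translate_subOne g u).symm))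
  rw [one_add_incl_subOne]
  rw [mul_one] at h3
  exact DFunLike.congr_fun h3 X

/-- The fields `v ↦ (1 + v) x` and `v ↦ (1 + v) y` have derivatives `h ↦ h x` and `h ↦ h y`, so
their bracket at `0` is `x y - y x`. -/
theorem mfderiv_subOne_bracket (X Y : GroupLieAlgebra 𝓘(ℝ, J.skew) J.UnitaryGroup)
    {x y : J.skew}
    (hX : mfderiv 𝓘(ℝ, J.skew) 𝓘(ℝ, J.Space) J.subOne 1 X = (x : J.Space))
    (hY : mfderiv 𝓘(ℝ, J.skew) 𝓘(ℝ, J.Space) J.subOne 1 Y = (y : J.Space)) :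
    mfderiv 𝓘(ℝ, J.skew) 𝓘(ℝ, J.Space) J.subOne 1 ⁅X, Y⁆ = ((⁅x, y⁆ : J.skew) : J.Space) := by
  have hd : ∀ (z : J.Space) (v : J.Space), HasFDerivAt
      (fun v => J.mulLeft (1 + J.inclL v) z) ((J.mulLeft ∘L J.inclL).flip z) v := fun z v => by
    have h : (fun v => J.mulLeft (1 + J.inclL v) z) =
        fun v => J.mulLeft 1 z + (J.mulLeft ∘L J.inclL).flip z v := by
      ext v; simp
    rw [h]
    exact (ContinuousLinearMap.hasFDerivAt _).const_add _
  have : LieGroup 𝓘(ℝ, J.skew) (minSmoothness ℝ 3) J.UnitaryGroup := LieGroup.of_le le_top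
  rw [GroupLieAlgebra.bracket_def, mfderiv_mlieBracket_of_related contMDiff_subOne
    (mdifferentiableAt_mulInvariantVectorField X) (mdifferentiableAt_mulInvariantVectorField Y)
    (hd (x : J.Space) _).differentiableAt (hd (y : J.Space) _).differentiableAt
    (fun u => (mfderiv_subOne_mulInvariantVectorField X u).trans (by rw [hX]; rfl))
    (fun u => (mfderiv_subOne_mulInvariantVectorField Y u).trans (by rw [hY]; rfl)),
    VectorField.lieBracket, (hd _ _).fderiv, (hd _ _).fderiv, subOne_one]
  apply J.incl_injective
  change J.inclL (J.mulLeft (J.inclL (J.mulLeft (1 + J.inclL 0) x)) y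
    - J.mulLeft (J.inclL (J.mulLeft (1 + J.inclL 0) y)) x) = J.incl x * J.incl y - J.incl y * J.incl x
  simp

/-- The map `v ↦ (1 + v) a (1 + v)⋆` on `J`. -/
def conjFun (a : H →L[ℂ] H) (v : J.Space) : H →L[ℂ] H :=
  (1 + J.inclL v) * a * (1 + J.inclL (J.starL v))

theorem conjFun_subOne (a : H →L[ℂ] H) (u : J.UnitaryGroup) :
    conjFun a (J.subOne u) = J.adjointAction u a := by
  have h : 1 + J.incl (J.starL (J.subOne u)) = star (J.toUnitary u : H →L[ℂ] H) := by
    rw [incl_starL, ← one_add_incl_subOne, star_add, star_one]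
  rw [conjFun, inclL_apply, inclL_apply, h, one_add_incl_subOne]
  rfl

theorem contDiff_conjFun (a : H →L[ℂ] H) :
    ContDiff ℝ ω fun v : J.Space => conjFun a v := by
  unfold conjFun
  fun_prop

theorem contMDiff_adjointAction (a : H →L[ℂ] H) :
    ContMDiff 𝓘(ℝ, J.skew) 𝓘(ℝ, H →L[ℂ] H) ω (fun u => J.adjointAction u a) := by
  simp only [← conjFun_subOne]
  exact (contDiff_conjFun a).contMDiff.comp contMDiff_subOne

theorem fderiv_conjFun (a : H →L[ℂ] H) (v : J.Space) :
    fderiv ℝ (conjFun a) 0 v = J.inclL v * a + a * J.inclL (J.starL v) := by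
  have h1 : HasFDerivAt (fun v => (1 + J.inclL v) * a)
      ((ContinuousLinearMap.mul ℝ (H →L[ℂ] H)).flip a ∘L J.inclL) 0 :=
    ((ContinuousLinearMap.mul ℝ (H →L[ℂ] H)).flip a).hasFDerivAt.comp 0
      (J.inclL.hasFDerivAt.const_add 1)
  have h2 : HasFDerivAt (fun v => 1 + J.inclL (J.starL v)) (J.inclL ∘L J.starL) 0 :=
    (J.inclL ∘L J.starL).hasFDerivAt.const_add 1
  have h3 : HasFDerivAt (conjFun a) _ 0 := h1.mul' h2
  rw [h3.fderiv]
  simp [add_comm]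

/-- The derivative of `(1 + v) a (1 + v)⋆` at `0` is `x a + a x⋆`, and `x⋆ = -x`. -/
theorem mfderiv_adjointAction (a : H →L[ℂ] H)
    (X : TangentSpace 𝓘(ℝ, J.skew) (1 : J.UnitaryGroup)) {x : J.skew}
    (hX : mfderiv 𝓘(ℝ, J.skew) 𝓘(ℝ, J.Space) J.subOne 1 X = (x : J.Space)) :
    mfderiv 𝓘(ℝ, J.skew) 𝓘(ℝ, H →L[ℂ] H) (fun u => J.adjointAction u a) 1 X =
      J.commutatorMap a x := by
  have h1 : HasMFDerivAt 𝓘(ℝ, J.skew) 𝓘(ℝ, H →L[ℂ] H) (fun u => conjFun a (J.subOne u)) 1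
      ((fderiv ℝ (conjFun a) (J.subOne 1)).comp
        (mfderiv 𝓘(ℝ, J.skew) 𝓘(ℝ, J.Space) J.subOne 1)) :=
    HasMFDerivAt.comp (g := conjFun a) (1 : J.UnitaryGroup)
      (((contDiff_conjFun a).differentiable (by simp)) _).hasFDerivAt.hasMFDerivAt
      (contMDiff_subOne.mdifferentiableAt (by simp)).hasMFDerivAt
  have h2 := h1.congr_of_eventuallyEq
    (Filter.Eventually.of_forall fun u => (conjFun_subOne a u).symm)
  rw [h2.mfderiv]
  change fderiv ℝ (conjFun a) (J.subOne 1)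
    (mfderiv 𝓘(ℝ, J.skew) 𝓘(ℝ, J.Space) J.subOne 1 X) = _
  rw [hX, subOne_one, fderiv_conjFun]
  have hx : J.inclL (J.starL (x : J.Space)) = -J.incl x := x.2
  rw [hx, mul_neg, ← sub_eq_add_neg]
  rfl

/-! ### The isotropy group as a Lie subgroup -/

section Isotropy

variable {a : H →L[ℂ] H} {m : Submodule ℝ J.skew}
  (h : (J.kerCommutator a).toSubmodule.IsTopCompl m)

/-- The slice charts of the isotropy group defined by a complement of its Lie algebra. -/
def isotropySliceDataOfIsTopCompl :
    SliceData (fun u : J.isotropy a => J.subOne u)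
      (J.skew.subtypeL ∘L (J.kerCommutator a).toSubmodule.subtypeL)
      ((J.kerCommutator a).toSubmodule.projectionOntoL m h ∘L skewPart) :=
  isotropySliceData a _ fun x => Submodule.projectionOntoL_apply_left h x

/-- The manifold structure of the isotropy group. -/
@[reducible]
def isotropyChartedSpace : ChartedSpace (J.kerCommutator a).toSubmodule (J.isotropy a) :=
  (isotropySliceDataOfIsTopCompl h).chartedSpace

theorem lieGroup_isotropy : letI := isotropyChartedSpace h
    LieGroup 𝓘(ℝ, (J.kerCommutator a).toSubmodule) ω (J.isotropy a) :=
  lieGroup_of_sliceData (J.isotropy a).subtype (isotropySliceDataOfIsTopCompl h)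

theorem isSmoothEmbedding_isotropy : letI := isotropyChartedSpace h
    IsSmoothEmbedding 𝓘(ℝ, (J.kerCommutator a).toSubmodule) 𝓘(ℝ, J.skew) ω
      (Subtype.val : J.isotropy a → J.UnitaryGroup) :=
  unitarySliceData.isSmoothEmbedding_of_comp (isotropySliceDataOfIsTopCompl h) (fun _ => rfl)
    (Submodule.prodEquivOfIsTopCompl _ _ h) fun e => by simp

theorem range_mfderiv_subOne_isotropy : letI := isotropyChartedSpace h
    (Set.range fun X : TangentSpace 𝓘(ℝ, (J.kerCommutator a).toSubmodule) (1 : J.isotropy a) =>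
      (mfderiv 𝓘(ℝ, (J.kerCommutator a).toSubmodule) 𝓘(ℝ, J.Space)
        (fun u : J.isotropy a => J.subOne u) 1 X : J.Space)) =
      Subtype.val '' ((J.kerCommutator a).toSubmodule : Set J.skew) := by
  let _ := isotropyChartedSpace h
  have h1 : ∀ X : (J.kerCommutator a).toSubmodule,
      mfderiv 𝓘(ℝ, (J.kerCommutator a).toSubmodule) 𝓘(ℝ, J.Space)
        (fun u : J.isotropy a => J.subOne u) 1 X = ((X : J.skew) : J.Space) :=
    mfderiv_subOne_one (J.isotropy a).subtype (isotropySliceDataOfIsTopCompl h) fun _ => rfl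
  ext v
  constructor
  · rintro ⟨X, rfl⟩
    exact ⟨_, SetLike.coe_mem (show (J.kerCommutator a).toSubmodule from X), (h1 X).symm⟩
  · rintro ⟨x, hx, rfl⟩
    exact ⟨(⟨x, hx⟩ : (J.kerCommutator a).toSubmodule), h1 ⟨x, hx⟩⟩

theorem range_mfderiv_subOne :
    (Set.range fun X : TangentSpace 𝓘(ℝ, J.skew) (1 : J.UnitaryGroup) =>
      (mfderiv 𝓘(ℝ, J.skew) 𝓘(ℝ, J.Space) J.subOne 1 X : J.Space)) = (J.skew : Set J.Space) := by
  ext v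
  constructor
  · rintro ⟨X, rfl⟩
    have := SetLike.coe_mem (show J.skew from X)
    rwa [← mfderiv_subOne_apply] at this
  · intro hv
    exact ⟨(⟨v, hv⟩ : J.skew), mfderiv_subOne_apply ⟨v, hv⟩⟩

end Isotropy

end SymmetricallyNormedIdeal

/-! ### Analytic homogeneous spaces from one adapted chart -/

section Homogeneous

open Topology

variable {E E' F G X : Type*} [NormedAddCommGroup E] [NormedSpace ℝ E] [NormedAddCommGroup F]
  [NormedSpace ℝ F] [TopologicalSpace G] [ChartedSpace E G] [Group G]
  [TopologicalSpace X] [MulAction G X] [NormedAddCommGroup E'] [NormedSpace ℝ E']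

/-- A chart `Θ` of a Lie group `G` around `1` which exhibits the homogeneous space `π : G → X` near the
base point as the image of a slice: in the chart, two points have the same image in `X` exactly
if they have the same image under the linear projection `P` onto the model space `F`. -/
structure HomogeneousChart (π : G → X) (P : E →L[ℝ] F) (k : F →L[ℝ] E) where
  /-- the chart of the group -/
  Θ : OpenPartialHomeomorph G E
  isOpenQuotientMap : IsOpenQuotientMap π
  map_mul : ∀ g u, π (g * u) = g • π u
  leftInverse : ∀ y, P (k y) = y
  one_mem : 1 ∈ Θ.source
  mem_maximalAtlas : Θ ∈ IsManifold.maximalAtlas 𝓘(ℝ, E) ω G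
  section_mem : ∀ x ∈ Θ.target, k (P x) ∈ Θ.target
  map_eq_iff : ∀ u ∈ Θ.source, ∀ v ∈ Θ.source, π u = π v ↔ P (Θ u) = P (Θ v)

namespace HomogeneousChart

variable {π : G → X} {P : E →L[ℝ] F} {k : F →L[ℝ] E} (S : HomogeneousChart π P k)

/-- The local section of `π` near the base point. -/
def localSection (y : F) : G := S.Θ.symm (k y)

/-- The inverse of the local section of `π`. -/
def coord (b : X) : F := P (S.Θ (Function.invFunOn π S.Θ.source b))

/-- The preimage chosen in `coord` is immaterial, because two points of the chart with the same
image have the same `P`-coordinate. -/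
theorem coord_apply {u : G} (hu : u ∈ S.Θ.source) : S.coord (π u) = P (S.Θ u) :=
  (S.map_eq_iff _ (Function.invFunOn_mem ⟨u, hu, rfl⟩) u hu).1 (Function.invFunOn_eq ⟨u, hu, rfl⟩)

theorem π_localSection {u : G} (hu : u ∈ S.Θ.source) : π (S.localSection (P (S.Θ u))) = π u := by
  have h := S.section_mem _ (S.Θ.map_source hu)
  rw [localSection, S.map_eq_iff _ (S.Θ.map_target h) _ hu, S.Θ.right_inv h, S.leftInverse]

theorem contMDiffAt_chart {u : G} (hu : u ∈ S.Θ.source) :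
    ContMDiffAt 𝓘(ℝ, E) 𝓘(ℝ, E) ω S.Θ u :=
  contMDiffAt_of_mem_maximalAtlas S.mem_maximalAtlas hu

theorem contMDiffAt_localSection {y : F} (hy : k y ∈ S.Θ.target) :
    ContMDiffAt 𝓘(ℝ, F) 𝓘(ℝ, E) ω S.localSection y :=
  (contMDiffAt_symm_of_mem_maximalAtlas S.mem_maximalAtlas hy).comp y
    k.contDiff.contMDiff.contMDiffAt

/-- The chart of the homogeneous space around the base point. -/
def baseChart : OpenPartialHomeomorph X F where
  toFun := S.coord
  invFun y := π (S.localSection y)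
  source := π '' S.Θ.source
  target := k ⁻¹' S.Θ.target
  map_source' := by
    rintro _ ⟨u, hu, rfl⟩
    rw [S.coord_apply hu]
    exact S.section_mem _ (S.Θ.map_source hu)
  map_target' y hy := ⟨_, S.Θ.map_target hy, rfl⟩
  left_inv' := by
    rintro _ ⟨u, hu, rfl⟩
    rw [S.coord_apply hu, S.π_localSection hu]
  right_inv' y hy := by
    rw [localSection, S.coord_apply (S.Θ.map_target hy), S.Θ.right_inv hy, S.leftInverse]
  open_source := S.isOpenQuotientMap.isOpenMap _ S.Θ.open_source
  open_target := S.Θ.open_target.preimage k.continuous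
  continuousOn_toFun := by
    rintro _ ⟨u, hu, rfl⟩
    refine ContinuousAt.continuousWithinAt ?_
    -- Continuity is tested after composition with the quotient map, where the coordinate is `P ∘
    -- Θ`.
    rw [← S.isOpenQuotientMap.continuousAt_comp_iff]
    have h : ContinuousAt (fun v => P (S.Θ v)) u :=
      P.continuous.continuousAt.comp (S.Θ.continuousAt hu)
    refine h.congr ?_
    filter_upwards [S.Θ.open_source.mem_nhds hu] with v hv
    exact (S.coord_apply hv).symm
  continuousOn_invFun y hy := (S.isOpenQuotientMap.continuous.continuousAt.comp
    (S.contMDiffAt_localSection hy).continuousAt).continuousWithinAt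

variable [LieGroup 𝓘(ℝ, E) ω G]

include S in
theorem continuous_smul (g : G) : Continuous fun b : X => g • b := by
  rw [← S.isOpenQuotientMap.continuous_comp_iff]
  have h : Continuous fun u : G => π (g * u) := S.isOpenQuotientMap.continuous.comp
    (contMDiff_mul_left (I := 𝓘(ℝ, E)) (n := ω)).continuous
  exact h.congr fun u => S.map_mul g u

/-- The chart of the homogeneous space around `π g`. -/
def chart (g : G) : OpenPartialHomeomorph X F :=
  Homeomorph.transOpenPartialHomeomorph
    { MulAction.toPerm g⁻¹ with
      continuous_toFun := S.continuous_smul g⁻¹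
      continuous_invFun := S.continuous_smul g⁻¹⁻¹ } S.baseChart

theorem chart_apply (g : G) (b : X) : S.chart g b = S.coord (g⁻¹ • b) := rfl

theorem mem_chart_source {g : G} {b : X} :
    b ∈ (S.chart g).source ↔ ∃ u ∈ S.Θ.source, π u = g⁻¹ • b := Iff.rfl

theorem chart_symm_apply (g : G) (y : F) : (S.chart g).symm y = π (g * S.localSection y) := by
  change g⁻¹⁻¹ • π (S.localSection y) = _
  rw [inv_inv, S.map_mul]

/-- The point `g⁻¹ * u` may lie outside the chart domain; only some `w` in its fibre is known to lie
there. Right translation by `u⁻¹ * g * w`, which fixes the base point, moves `g⁻¹ * u` to `w`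
without changing images under `π`. -/
theorem contMDiffAt_chart_π {g u : G} (hu : π u ∈ (S.chart g).source) :
    ContMDiffAt 𝓘(ℝ, E) 𝓘(ℝ, F) ω (fun v => S.chart g (π v)) u := by
  obtain ⟨w, hw, hwu⟩ := S.mem_chart_source.1 hu
  have hmul : ∀ v, π (g⁻¹ * v * (u⁻¹ * g * w)) = g⁻¹ • π v := fun v => by
    have e : g⁻¹ * v * (u⁻¹ * g * w) = (g⁻¹ * v * u⁻¹ * g) * w := by group
    rw [e, S.map_mul, hwu, ← S.map_mul, ← S.map_mul, ← S.map_mul]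
    congr 1
    group
  have hu' : g⁻¹ * u * (u⁻¹ * g * w) = w := by group
  have hc : ContMDiff 𝓘(ℝ, E) 𝓘(ℝ, E) ω fun v : G => g⁻¹ * v * (u⁻¹ * g * w) :=
    (contMDiff_const.mul contMDiff_id).mul contMDiff_const
  have h : ContMDiffAt 𝓘(ℝ, E) 𝓘(ℝ, F) ω (fun v => P (S.Θ (g⁻¹ * v * (u⁻¹ * g * w)))) u := by
    refine P.contDiff.contMDiff.contMDiffAt.comp u
      (ContMDiffAt.comp (g := S.Θ) u ?_ hc.contMDiffAt)
    rw [hu']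
    exact S.contMDiffAt_chart hw
  refine h.congr_of_eventuallyEq ?_
  have hn : ∀ᶠ v in 𝓝 u, g⁻¹ * v * (u⁻¹ * g * w) ∈ S.Θ.source := by
    refine hc.continuous.continuousAt.eventually_mem (S.Θ.open_source.mem_nhds ?_)
    rwa [hu']
  filter_upwards [hn] with v hv
  rw [S.chart_apply, ← hmul, S.coord_apply hv]

/-- The manifold structure of the homogeneous space. -/
@[reducible]
def chartedSpace : ChartedSpace F X where
  atlas := Set.range S.chart
  chartAt b := S.chart (S.isOpenQuotientMap.surjective b).choose
  mem_chart_source b := by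
    refine S.mem_chart_source.2 ⟨1, S.one_mem, ?_⟩
    have h := (S.isOpenQuotientMap.surjective b).choose_spec
    nth_rewrite 3 [← h]
    rw [← S.map_mul, inv_mul_cancel]
  chart_mem_atlas b := ⟨_, rfl⟩

/-- The inverse of a chart is `π` after an analytic map into `G`, and a chart after `π` is analytic
on `G`. -/
theorem isManifold : @IsManifold ℝ _ F _ _ F _ 𝓘(ℝ, F) ω X _ S.chartedSpace := by
  let _ := S.chartedSpace
  refine isManifold_of_contDiffOn 𝓘(ℝ, F) ω X ?_
  rintro _ _ ⟨g, rfl⟩ ⟨g', rfl⟩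
  simp only [modelWithCornersSelf_coe, modelWithCornersSelf_coe_symm, Function.comp_id,
    Function.id_comp, Set.range_id, Set.inter_univ, Set.preimage_id_eq, id]
  intro y hy
  refine ContDiffAt.contDiffWithinAt ?_
  rw [← contMDiffAt_iff_contDiffAt]
  have hy1 : k y ∈ S.Θ.target := hy.1
  have hy2 : (S.chart g).symm y ∈ (S.chart g').source := hy.2
  rw [S.chart_symm_apply] at hy2
  have h : ContMDiffAt 𝓘(ℝ, F) 𝓘(ℝ, F) ω
      (fun y => S.chart g' (π (g * S.localSection y))) y :=
    ContMDiffAt.comp (f := fun y => g * S.localSection y) y (S.contMDiffAt_chart_π hy2)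
      (contMDiffAt_const.mul (S.contMDiffAt_localSection hy1))
  refine h.congr_of_eventuallyEq (Filter.Eventually.of_forall fun z => ?_)
  exact congrArg (S.chart g') (S.chart_symm_apply g z)

theorem chart_mem_maximalAtlas (g : G) :
    letI := S.chartedSpace
    S.chart g ∈ IsManifold.maximalAtlas 𝓘(ℝ, F) ω X := by
  let _ := S.chartedSpace
  have := S.isManifold
  exact IsManifold.subset_maximalAtlas ⟨g, rfl⟩

theorem π_mem_chart_source (g : G) : π g ∈ (S.chart g).source :=
  S.mem_chart_source.2 ⟨1, S.one_mem, by rw [← S.map_mul, inv_mul_cancel]⟩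

theorem contMDiff_π : letI := S.chartedSpace
    ContMDiff 𝓘(ℝ, E) 𝓘(ℝ, F) ω π := by
  let _ := S.chartedSpace
  have := S.isManifold
  intro u
  have h := S.contMDiffAt_chart_π (S.π_mem_chart_source u)
  have h2 := (contMDiffAt_symm_of_mem_maximalAtlas (S.chart_mem_maximalAtlas u)
    ((S.chart u).map_source (S.π_mem_chart_source u))).comp u h
  refine h2.congr_of_eventuallyEq ?_
  filter_upwards [S.isOpenQuotientMap.continuous.continuousAt.eventually_mem
    ((S.chart u).open_source.mem_nhds (S.π_mem_chart_source u))] with v hv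
  exact ((S.chart u).left_inv hv).symm

/-- Near `π g`, a point `b` lifts analytically to `g * localSection (chart g b)`, so the action is a
product in `G` followed by `π`. -/
theorem contMDiff_smul : letI := S.chartedSpace
    ContMDiff (𝓘(ℝ, E).prod 𝓘(ℝ, F)) 𝓘(ℝ, F) ω (fun p : G × X => p.1 • p.2) := by
  let _ := S.chartedSpace
  have := S.isManifold
  rintro ⟨u, b⟩
  obtain ⟨g, rfl⟩ := S.isOpenQuotientMap.surjective b
  have hg := S.π_mem_chart_source g
  have h1 : ContMDiffAt (𝓘(ℝ, E).prod 𝓘(ℝ, F)) 𝓘(ℝ, F) ω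
      (fun p : G × X => S.chart g p.2) (u, π g) :=
    ContMDiffAt.comp (g := S.chart g) (u, π g)
      (contMDiffAt_of_mem_maximalAtlas (S.chart_mem_maximalAtlas g) hg) contMDiffAt_snd
  have h2 : ContMDiffAt (𝓘(ℝ, E).prod 𝓘(ℝ, F)) 𝓘(ℝ, E) ω
      (fun p : G × X => S.localSection (S.chart g p.2)) (u, π g) :=
    ContMDiffAt.comp (g := S.localSection) (u, π g)
      (S.contMDiffAt_localSection ((S.chart g).map_source hg)) h1
  have h3 : ContMDiffAt (𝓘(ℝ, E).prod 𝓘(ℝ, F)) 𝓘(ℝ, F) ω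
      (fun p : G × X => π (p.1 * (g * S.localSection (S.chart g p.2)))) (u, π g) :=
    S.contMDiff_π.contMDiffAt.comp (u, π g) (contMDiffAt_fst.mul (contMDiffAt_const.mul h2))
  refine h3.congr_of_eventuallyEq ?_
  filter_upwards [continuousAt_snd.eventually_mem ((S.chart g).open_source.mem_nhds hg)] with p hp
  rw [S.map_mul, ← S.chart_symm_apply, (S.chart g).left_inv hp]

include S in
-- Between the left translate of `Θ` by `u` and the chart at `π u`, the map `π` is the linear
-- projection `P`.
theorem isSubmersion (φ : E ≃L[ℝ] (F × E')) (hφ : ∀ x, (φ x).1 = P x) :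
    letI := S.chartedSpace
    IsSubmersion 𝓘(ℝ, E) 𝓘(ℝ, F) ω π := by
  let _ := S.chartedSpace
  have := S.isManifold
  refine IsSubmersionOfComplement.isSubmersion (F := E') fun u => ?_
  have hc : ContMDiff 𝓘(ℝ, E) 𝓘(ℝ, E) ω fun v : G => u⁻¹ * v := contMDiff_mul_left
  have hc' : ContMDiff 𝓘(ℝ, E) 𝓘(ℝ, E) ω fun v : G => u⁻¹⁻¹ * v := contMDiff_mul_left
  let Ψ : OpenPartialHomeomorph G E := Homeomorph.transOpenPartialHomeomorph
    { Equiv.mulLeft u⁻¹ with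
      continuous_toFun := hc.continuous
      continuous_invFun := hc'.continuous } S.Θ
  have hsource : ∀ v ∈ Ψ.source, u⁻¹ * v ∈ S.Θ.source := fun v hv => hv
  have hΨ : Ψ ∈ IsManifold.maximalAtlas 𝓘(ℝ, E) ω G := by
    refine Ψ.mem_maximalAtlas_of_contMDiffOn
      (fun v hv => ContMDiffAt.contMDiffWithinAt ?_) fun x hx => ContMDiffAt.contMDiffWithinAt ?_
    · exact (S.contMDiffAt_chart (hsource v hv)).comp v hc.contMDiffAt
    · exact hc'.contMDiffAt.comp x (contMDiffAt_symm_of_mem_maximalAtlas S.mem_maximalAtlas hx)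
  refine IsSubmersionAtOfComplement.mk_of_charts φ Ψ (S.chart u) ?_
    (S.π_mem_chart_source u) hΨ (S.chart_mem_maximalAtlas u) ?_ ?_
  · change u⁻¹ * u ∈ S.Θ.source
    rw [inv_mul_cancel]
    exact S.one_mem
  · intro v hv
    exact S.mem_chart_source.2 ⟨_, hsource v hv, S.map_mul _ _⟩
  · intro x hx
    have hx1 : x ∈ Ψ.target := by simpa using hx
    have hx' : x ∈ S.Θ.target := hx1
    have h : S.chart u (π (Ψ.symm x)) = P x := by
      change S.chart u (π (u⁻¹⁻¹ * S.Θ.symm x)) = P x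
      rw [inv_inv, S.chart_apply, S.map_mul, inv_smul_smul, S.coord_apply (S.Θ.map_target hx'),
        S.Θ.right_inv hx']
    simpa [hφ] using h

end HomogeneousChart

end Homogeneous

/-! ### Product charts of `U_J` at the identity -/

open Topology in
/-- The inverse function theorem for a real-analytic map whose derivative at `a` is the identity. -/
theorem exists_openPartialHomeomorph_of_contDiffAt {E : Type*} [NormedAddCommGroup E]
    [NormedSpace ℝ E] [CompleteSpace E] {f : E → E} {a : E} (hf : ContDiffAt ℝ ω f a)
    (hf' : HasFDerivAt f (ContinuousLinearMap.id ℝ E) a) :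
    ∃ e : OpenPartialHomeomorph E E, a ∈ e.source ∧ (e : E → E) = f ∧
      ContDiffOn ℝ ω e e.source ∧ ContDiffOn ℝ ω e.symm e.target := by
  have hf'' : HasFDerivAt f ((ContinuousLinearEquiv.refl ℝ E : E ≃L[ℝ] E) : E →L[ℝ] E) a := hf'
  set e := hf.toOpenPartialHomeomorph f hf'' (by simp) with he
  have hcoe : (e : E → E) = f := rfl
  have ha : a ∈ e.source := hf.mem_toOpenPartialHomeomorph_source hf'' (by simp)
  have h1 : ∀ᶠ x in 𝓝 a, ContDiffAt ℝ ω e x := hf.eventually (by simp)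
  have h2 : ∀ᶠ y in 𝓝 (e a), ContDiffAt ℝ ω e.symm y :=
    (e.contDiffAt_symm (e.map_source ha) (by rw [e.left_inv ha]; exact hf'')
      (by rw [e.left_inv ha]; exact hf)).eventually (by simp)
  have h3 := h1.and ((e.continuousAt ha).eventually h2)
  -- Analyticity is an open condition, so the local inverse is restricted to where both directions
  -- are analytic.
  refine ⟨e.restr {x | ContDiffAt ℝ ω e x ∧ ContDiffAt ℝ ω e.symm (e x)},
    ⟨ha, mem_interior_iff_mem_nhds.2 h3⟩, rfl, fun x hx => ?_, fun y hy => ?_⟩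
  · exact (interior_subset hx.2).1.contDiffWithinAt
  · have h4 : ContDiffAt ℝ ω e.symm (e (e.symm y)) := (interior_subset hy.2).2
    rw [e.right_inv hy.1] at h4
    exact h4.contDiffWithinAt

namespace SymmetricallyNormedIdeal

variable {H : Type*} [NormedAddCommGroup H] [InnerProductSpace ℂ H] [CompleteSpace H]
  {J : SymmetricallyNormedIdeal H}

attribute [local instance] unitaryChartedSpace

/-- `1 - x / 2 = -(i / 2) (2 i - i x)`, and `i x` is self-adjoint, so `2 i` is outside its real
spectrum. Hence the Cayley charts are onto `𝔲_J`. -/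
theorem isUnit_one_add_skew (x : J.skew) : IsUnit (1 + (-2⁻¹ : ℝ) • J.incl x) := by
  have hx : star (J.incl x) = -J.incl x := x.2
  have hy : IsSelfAdjoint (Complex.I • J.incl x) := by
    rw [IsSelfAdjoint, star_smul, hx]
    simp
  have h1 : (2 * Complex.I) ∉ spectrum ℂ (Complex.I • J.incl x) := fun h => by
    have := hy.im_eq_zero_of_mem_spectrum h
    simp at this
  rw [spectrum.notMem_iff] at h1
  have hc : IsUnit (-(Complex.I / 2)) := by simp
  have h2 := (hc.map (algebraMap ℂ (H →L[ℂ] H))).mul h1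
  convert h2 using 1
  rw [← Algebra.smul_def, smul_sub, smul_smul, Algebra.algebraMap_eq_smul_one, smul_smul,
    sub_eq_add_neg, ← neg_smul]
  have e1 : -(Complex.I / 2) * (2 * Complex.I) = 1 := by
    linear_combination (-1 : ℂ) * Complex.I_mul_I
  have e2 : -(-(Complex.I / 2) * Complex.I) = ((-2⁻¹ : ℝ) : ℂ) := by
    push_cast
    linear_combination (1 / 2 : ℂ) * Complex.I_mul_I
  rw [e1, e2, one_smul]
  rfl

theorem unitaryChart_target (g : J.UnitaryGroup) :
    (unitarySliceData.chart g).target = Set.univ :=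
  Set.eq_univ_of_forall fun x => isUnit_one_add_skew x

/-- The inverse Cayley transform `x ↦ (1 + x / 2) (1 - x / 2)⁻¹` from `𝔲_J` to `U_J`. -/
def cayleyUnitary (x : J.skew) : J.UnitaryGroup := (unitarySliceData.chart 1).symm x

theorem subOne_cayleyUnitary (x : J.skew) :
    J.subOne (cayleyUnitary x) = J.mobiusFun (-2⁻¹) x := by
  have h := unitarySliceData.ι_chart_symm (1 : J.UnitaryGroup) (e := x)
    (by rw [unitaryChart_target]; trivial)
  refine h.trans ((unitarySlice_symm_apply 1 _).trans ?_)
  rw [translate_one]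
  rfl

theorem coe_chart_one {u : J.UnitaryGroup} (hu : u ∈ (unitarySliceData.chart 1).source) :
    ((unitarySliceData.chart 1 u : J.skew) : J.Space) = J.mobiusFun 2⁻¹ (J.subOne u) := by
  refine (unitarySliceData.j_chart 1 hu).trans ?_
  change J.mobiusFun 2⁻¹ (J.translate 1⁻¹ (J.subOne u)) = _
  rw [inv_one, translate_one]

theorem chart_one_apply (u : J.UnitaryGroup) :
    unitarySliceData.chart 1 u = skewPart (J.mobiusFun 2⁻¹ (J.subOne u)) := by
  change skewPart (J.mobiusFun 2⁻¹ (J.translate 1⁻¹ (J.subOne u))) = _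
  rw [inv_one, translate_one]

theorem continuous_cayleyUnitary : Continuous (cayleyUnitary (J := J)) := by
  have h := (unitarySliceData.chart (1 : J.UnitaryGroup)).continuousOn_symm
  rw [← (unitarySliceData.chart (1 : J.UnitaryGroup)).symm_source] at h
  rw [(unitarySliceData.chart (1 : J.UnitaryGroup)).symm_source, unitaryChart_target,
    continuousOn_univ] at h
  exact h

theorem cayleyUnitary_zero : cayleyUnitary (0 : J.skew) = 1 := by
  apply isEmbedding_subOne.injective
  rw [subOne_cayleyUnitary, subOne_one]
  exact mobiusFun_zero _

theorem cayleyUnitary_mem_isotropy {a : H →L[ℂ] H} {x : J.skew}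
    (hx : x ∈ (J.kerCommutator a).toSubmodule) : cayleyUnitary x ∈ J.isotropy a := by
  rw [mem_isotropy_iff, subOne_cayleyUnitary]
  exact Commute.incl_mobiusFun (mem_kerCommutator_iff.1 hx)

theorem chart_one_mem_kerCommutator {a : H →L[ℂ] H} {u : J.UnitaryGroup}
    (hu : u ∈ (unitarySliceData.chart 1).source) (hua : u ∈ J.isotropy a) :
    unitarySliceData.chart 1 u ∈ (J.kerCommutator a).toSubmodule := by
  rw [mem_kerCommutator_iff, coe_chart_one hu]
  exact Commute.incl_mobiusFun (mem_isotropy_iff.1 hua)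

theorem contDiffAt_skewPart_mobiusFun {E : Type*} [NormedAddCommGroup E] [NormedSpace ℝ E]
    {f : E → J.Space} {f' : E →L[ℝ] J.Space} {e : E} (hf : ContDiffAt ℝ ω f e)
    (hf' : HasFDerivAt f f' e) (h0 : f e = 0) :
    ContDiffAt ℝ ω (fun x => skewPart (J.mobiusFun 2⁻¹ (f x))) e ∧
    HasFDerivAt (fun x => skewPart (J.mobiusFun 2⁻¹ (f x))) (skewPart ∘L f') e := by
  constructor
  · refine skewPart.contDiff.contDiffAt.comp e (ContDiffAt.comp (g := J.mobiusFun 2⁻¹) e ?_ hf)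
    rw [h0]
    exact contDiffAt_mobiusFun (by simp)
  · have h1 := hasFDerivAt_mobiusFun_zero (J := J) 2⁻¹
    rw [← h0] at h1
    exact skewPart.hasFDerivAt.comp e (h1.comp e hf')

/-- The Cayley maps have derivative `1` at `0`, and the cross term of the product `x + y + x y` is
of second order. -/
theorem contDiffAt_chart_mul {p q : J.skew →L[ℝ] J.skew} :
    ContDiffAt ℝ ω (fun x => unitarySliceData.chart (1 : J.UnitaryGroup)
      (cayleyUnitary (p x) * cayleyUnitary (q x))) 0 ∧
    HasFDerivAt (fun x => unitarySliceData.chart (1 : J.UnitaryGroup)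
      (cayleyUnitary (p x) * cayleyUnitary (q x))) (p + q) 0 := by
  have hu : ∀ {r : ℝ}, IsUnit (1 + r • J.incl 0) := by simp
  have hY : ∀ p : J.skew →L[ℝ] J.skew,
      ContDiffAt ℝ ω (fun x => J.mobiusFun (-2⁻¹) (p x : J.Space)) 0 ∧
      HasFDerivAt (fun x => J.mobiusFun (-2⁻¹) (p x : J.Space)) (J.skew.subtypeL ∘L p) 0 := by
    intro p
    have h0 : (J.skew.subtypeL ∘L p) 0 = 0 := map_zero _
    constructor
    · refine ContDiffAt.comp (g := J.mobiusFun (-2⁻¹)) 0 ?_ (J.skew.subtypeL ∘L p).contDiff.contDiffAt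
      change ContDiffAt ℝ ω (J.mobiusFun (-2⁻¹)) ((J.skew.subtypeL ∘L p) 0)
      rw [h0]
      exact contDiffAt_mobiusFun hu
    · have h := hasFDerivAt_mobiusFun_zero (J := J) (-2⁻¹)
      rw [← h0] at h
      exact h.comp 0 (J.skew.subtypeL ∘L p).hasFDerivAt
  have hM0 : ∀ p : J.skew →L[ℝ] J.skew, J.mobiusFun (-2⁻¹) (p 0 : J.Space) = 0 := fun p => by
    rw [map_zero]; exact mobiusFun_zero _
  have hc : ContDiffAt ℝ ω (fun x => J.mobiusFun (-2⁻¹) (p x : J.Space) +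
      J.mobiusFun (-2⁻¹) (q x : J.Space) + J.mulLeft (J.inclL (J.mobiusFun (-2⁻¹) (p x : J.Space)))
        (J.mobiusFun (-2⁻¹) (q x : J.Space))) 0 :=
    ((hY p).1.add (hY q).1).add
      (((J.mulLeft ∘L J.inclL).contDiff.contDiffAt.comp 0 (hY p).1).clm_apply (hY q).1)
  have hd : HasFDerivAt (fun x => J.mobiusFun (-2⁻¹) (p x : J.Space) +
      J.mobiusFun (-2⁻¹) (q x : J.Space) + J.mulLeft (J.inclL (J.mobiusFun (-2⁻¹) (p x : J.Space)))
        (J.mobiusFun (-2⁻¹) (q x : J.Space))) (J.skew.subtypeL ∘L p + J.skew.subtypeL ∘L q) 0 := by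
    have h1 := ((J.mulLeft ∘L J.inclL).hasFDerivAt.comp 0 (hY p).2).clm_apply (hY q).2
    have h2 := ((hY p).2.add (hY q).2).add h1
    refine h2.congr_fderiv ?_
    ext x
    simp [mobiusFun_zero]
  have hval : ∀ x, unitarySliceData.chart (1 : J.UnitaryGroup)
      (cayleyUnitary (p x) * cayleyUnitary (q x)) = skewPart (J.mobiusFun 2⁻¹
        (J.mobiusFun (-2⁻¹) (p x : J.Space) + J.mobiusFun (-2⁻¹) (q x : J.Space) +
          J.mulLeft (J.inclL (J.mobiusFun (-2⁻¹) (p x : J.Space)))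
            (J.mobiusFun (-2⁻¹) (q x : J.Space)))) := fun x => by
    rw [chart_one_apply, subOne_mul, subOne_cayleyUnitary, subOne_cayleyUnitary]
    rfl
  simp only [hval]
  have h0 : J.mobiusFun (-2⁻¹) (p 0 : J.Space) +
      J.mobiusFun (-2⁻¹) (q 0 : J.Space) + J.mulLeft (J.inclL (J.mobiusFun (-2⁻¹) (p 0 : J.Space)))
        (J.mobiusFun (-2⁻¹) (q 0 : J.Space)) = 0 := by
    rw [hM0, hM0, map_zero, add_zero, add_zero]
  obtain ⟨h1, h2⟩ := contDiffAt_skewPart_mobiusFun hc hd h0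
  refine ⟨h1, h2.congr_fderiv ?_⟩
  ext1 x
  change skewPart ((p x : J.Space) + (q x : J.Space)) = p x + q x
  rw [map_add, skewPart_coe, skewPart_coe]

/-- Around `1`, the group `U_J` is parametrized by the product of the inverse Cayley transforms of
two complementary components. -/
theorem exists_product_chart {p q : J.skew →L[ℝ] J.skew}
    (hpq : p + q = ContinuousLinearMap.id ℝ J.skew) :
    ∃ Θ : OpenPartialHomeomorph J.UnitaryGroup J.skew,
      Θ ∈ IsManifold.maximalAtlas 𝓘(ℝ, J.skew) ω J.UnitaryGroup ∧ 0 ∈ Θ.target ∧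
      ∀ x ∈ Θ.target, Θ.symm x = cayleyUnitary (p x) * cayleyUnitary (q x) := by
  set F : J.skew → J.UnitaryGroup := fun x => cayleyUnitary (p x) * cayleyUnitary (q x) with hF
  have : IsTopologicalGroup J.UnitaryGroup := topologicalGroup_of_lieGroup 𝓘(ℝ, J.skew) ω
  have hFc : Continuous F := (continuous_cayleyUnitary.comp p.continuous).mul
    (continuous_cayleyUnitary.comp q.continuous)
  have hF0 : F 0 = 1 := by simp [hF, cayleyUnitary_zero]
  obtain ⟨hc, hd⟩ := contDiffAt_chart_mul (p := p) (q := q)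
  rw [hpq] at hd
  obtain ⟨e, h0, hcoe, he, he'⟩ := exists_openPartialHomeomorph_of_contDiffAt hc hd
  set φ := unitarySliceData.chart (1 : J.UnitaryGroup) with hφ
  -- The inverse function theorem concerns `φ ∘ F`. Keeping `F x` in the domain of `φ` allows `F` to
  -- be recovered from it.
  have hFs : IsOpen (F ⁻¹' φ.source) := φ.open_source.preimage hFc
  set e₁ := e.restrOpen _ hFs with he₁
  have hmem : φ ∈ IsManifold.maximalAtlas 𝓘(ℝ, J.skew) ω J.UnitaryGroup :=
    unitarySliceData.chart_mem_maximalAtlas 1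
  have htarget : ∀ x, x ∈ (φ ≫ₕ e₁.symm).target ↔ x ∈ e₁.source := fun x => by
    rw [OpenPartialHomeomorph.trans_target, hφ, unitaryChart_target]
    simp
  have hsymm : ∀ x ∈ e₁.source, φ.symm (e₁ x) = F x := fun x hx => by
    have : e₁ x = φ (F x) := congrFun hcoe x
    rw [this]
    exact φ.left_inv hx.2
  refine ⟨φ ≫ₕ e₁.symm, ?_, ?_, fun x hx => hsymm x ((htarget x).1 hx)⟩
  · refine OpenPartialHomeomorph.mem_maximalAtlas_of_contMDiffOn _ ?_ ?_
    · have h1 : ContMDiffOn 𝓘(ℝ, J.skew) 𝓘(ℝ, J.skew) ω e₁.symm e₁.target :=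
        (he'.mono fun y hy => hy.1).contMDiffOn
      exact h1.comp ((contMDiffOn_of_mem_maximalAtlas hmem).mono fun u hu => hu.1) fun u hu => hu.2
    · have h1 : ContMDiffOn 𝓘(ℝ, J.skew) 𝓘(ℝ, J.skew) ω e₁ e₁.source :=
        (he.mono fun y hy => hy.1).contMDiffOn
      exact (contMDiffOn_symm_of_mem_maximalAtlas hmem).comp
        (h1.mono fun x hx => (htarget x).1 hx) fun x hx => by
          have hx' : e₁ x ∈ φ.target := by rw [hφ, unitaryChart_target]; trivial
          exact hx'
  · rw [htarget]
    refine ⟨h0, ?_⟩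
    change F 0 ∈ φ.source
    rw [hF0]
    exact unitarySliceData.mem_source 1

end SymmetricallyNormedIdeal

/-! ### The orbit as a homogeneous space -/

namespace SymmetricallyNormedIdeal

variable {H : Type*} [NormedAddCommGroup H] [InnerProductSpace ℂ H] [CompleteSpace H]
  {J : SymmetricallyNormedIdeal H}

attribute [local instance] unitaryChartedSpace

section Orbit

variable {a : H →L[ℂ] H}

theorem orbitMap_surjective : Function.Surjective (J.orbitMap a) := by
  rintro ⟨b, u, rfl⟩
  exact ⟨u, rfl⟩

theorem orbitMap_mul (g u : J.UnitaryGroup) : J.orbitMap a (g * u) = g • J.orbitMap a u :=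
  Subtype.ext (J.adjointAction_mul g u a)

theorem orbitMap_eq_base_iff {u : J.UnitaryGroup} :
    J.orbitMap a u = J.orbitMap a 1 ↔ u ∈ J.isotropy a := by
  have h : J.orbitMap a u = J.orbitMap a 1 ↔ J.adjointAction u a = J.adjointAction 1 a :=
    Subtype.ext_iff
  rw [h, adjointAction_one]
  rfl

theorem orbitMap_eq_iff {u v : J.UnitaryGroup} :
    J.orbitMap a u = J.orbitMap a v ↔ u⁻¹ * v ∈ J.isotropy a := by
  rw [← orbitMap_eq_base_iff, orbitMap_mul, inv_smul_eq_iff, ← orbitMap_mul, mul_one, eq_comm]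

theorem isQuotientMap_orbitMap : Topology.IsQuotientMap (J.orbitMap a) :=
  ⟨⟨rfl⟩, orbitMap_surjective⟩

variable (J a) in
/-- The bijection between `U_J / U_J(a)` and the orbit. -/
def quotientEquiv : (J.UnitaryGroup ⧸ J.isotropy a) ≃ J.Orbit a :=
  Equiv.ofBijective
    (Quotient.lift (J.orbitMap a) fun _ _ h => orbitMap_eq_iff.2 (QuotientGroup.leftRel_apply.1 h))
    ⟨by
      rintro ⟨u⟩ ⟨v⟩ h
      exact QuotientGroup.eq.2 (orbitMap_eq_iff.1 h),
    fun b => by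
      obtain ⟨u, rfl⟩ := orbitMap_surjective b
      exact ⟨QuotientGroup.mk u, rfl⟩⟩

variable (J a) in
/-- The homeomorphism between `U_J / U_J(a)` and the orbit. -/
def quotientHomeomorph : (J.UnitaryGroup ⧸ J.isotropy a) ≃ₜ J.Orbit a where
  toEquiv := J.quotientEquiv a
  continuous_toFun := Continuous.quotient_lift isQuotientMap_orbitMap.continuous _
  continuous_invFun := isQuotientMap_orbitMap.continuous_iff.2 <|
    QuotientGroup.continuous_mk.congr fun u =>
      ((J.quotientEquiv a).symm_apply_apply (QuotientGroup.mk u)).symm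

theorem quotientHomeomorph_mk (u : J.UnitaryGroup) :
    J.quotientHomeomorph a (QuotientGroup.mk u) = J.orbitMap a u := rfl

theorem isOpenQuotientMap_orbitMap : IsOpenQuotientMap (J.orbitMap a) := by
  have : IsTopologicalGroup J.UnitaryGroup := topologicalGroup_of_lieGroup 𝓘(ℝ, J.skew) ω
  exact (J.quotientHomeomorph a).isOpenQuotientMap.comp QuotientGroup.isOpenQuotientMap_mk

/-- The quotient topology is finer than the one induced by the operator norm. -/
theorem t2Space_orbit : T2Space (J.Orbit a) := by
  refine T2Space.of_injective_continuous (f := fun b : J.Orbit a => b.1) Subtype.val_injective ?_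
  exact isQuotientMap_orbitMap.continuous_iff.2 (contMDiff_adjointAction a).continuous

theorem isPretransitive_orbit : MulAction.IsPretransitive J.UnitaryGroup (J.Orbit a) := by
  refine ⟨fun b c => ?_⟩
  obtain ⟨u, rfl⟩ := orbitMap_surjective b
  obtain ⟨v, rfl⟩ := orbitMap_surjective c
  exact ⟨v * u⁻¹, by rw [← orbitMap_mul, inv_mul_cancel_right]⟩

-- Write `c` for the inverse Cayley transform and `F x = c(p x) c(q x)`. The factor `c(q x)` fixes
-- `a`, so the image of `F x` depends on `p x` only. Conversely, if `F x` and `F x'` have the same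
-- image, then `t = c(p x)⁻¹ F x'` fixes `a`. If `t` lies in the domain of the Cayley chart, then `t
-- = c(z)` with `z` in the commutant, and `F x' = c(p x) c(z) = F (p x + z)`. Injectivity of the
-- product chart gives `x' = p x + z`, hence `p x' = p x`.
set_option maxHeartbeats 400000 in
theorem nonempty_homogeneousChart {m : Submodule ℝ J.skew}
    (h : (J.kerCommutator a).toSubmodule.IsTopCompl m) :
    Nonempty (HomogeneousChart (J.orbitMap a) (m.projectionOntoL _ h.symm) m.subtypeL) := by
  set k := (J.kerCommutator a).toSubmodule with hk
  set p := m.projectionL k h.symm with hp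
  set q := k.projectionL m h with hq
  have hpq : p + q = ContinuousLinearMap.id ℝ J.skew :=
    Submodule.projectionL_add_projectionL_eq_id h.symm
  have hpp : ∀ x, p (p x) = p x := fun x =>
    Submodule.projectionL_apply_left h.symm (m.projectionOntoL k h.symm x)
  have hqp : ∀ x, q (p x) = 0 := fun x =>
    Submodule.projectionL_apply_right h (m.projectionOntoL k h.symm x)
  have hpk : ∀ x ∈ k, p x = 0 := fun x hx => Submodule.projectionL_apply_right h.symm ⟨x, hx⟩
  have hqk : ∀ x ∈ k, q x = x := fun x hx => Submodule.projectionL_apply_left h ⟨x, hx⟩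
  have : IsTopologicalGroup J.UnitaryGroup := topologicalGroup_of_lieGroup 𝓘(ℝ, J.skew) ω
  obtain ⟨Θ, hΘ, hΘ0, hΘs⟩ := exists_product_chart hpq
  set φ := unitarySliceData.chart (1 : J.UnitaryGroup) with hφ
  set F : J.skew → J.UnitaryGroup := fun x => cayleyUnitary (p x) * cayleyUnitary (q x) with hF
  have hcont : Continuous F := (continuous_cayleyUnitary.comp p.continuous).mul
    (continuous_cayleyUnitary.comp q.continuous)
  have hF0 : F 0 = 1 := by simp [hF, cayleyUnitary_zero]
  -- the relative position of `F x'` with respect to the fibre through `F x`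
  set t : J.skew × J.skew → J.UnitaryGroup :=
    fun z => (cayleyUnitary (p z.1))⁻¹ * F z.2 with ht
  have htc : Continuous t := (continuous_cayleyUnitary.comp (p.continuous.comp continuous_fst)).inv.mul
    (hcont.comp continuous_snd)
  have ht0 : t (0, 0) = 1 := by simp [ht, hF0, cayleyUnitary_zero]
  have hφ1 : (1 : J.UnitaryGroup) ∈ φ.source := unitarySliceData.mem_source 1
  have hφ0 : φ 1 = 0 := by
    rw [hφ, chart_one_apply, subOne_one, mobiusFun_zero, map_zero]
  -- The two smallness conditions of the argument: `t` has a Cayley coordinate, and `p x + z` stays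
  -- in the product chart. The projection `q` is inserted to have a condition on all pairs; it fixes
  -- `z` when `t` fixes `a`.
  have hN : ∀ᶠ z in nhds ((0 : J.skew), (0 : J.skew)),
      t z ∈ φ.source ∧ p z.1 + q (φ (t z)) ∈ Θ.target := by
    refine (htc.continuousAt.eventually_mem (φ.open_source.mem_nhds (by rwa [ht0]))).and ?_
    have hc : ContinuousAt (fun z => p z.1 + q (φ (t z))) ((0 : J.skew), (0 : J.skew)) := by
      refine (p.continuous.comp continuous_fst).continuousAt.add
        (q.continuous.continuousAt.comp (ContinuousAt.comp (g := φ) ?_ htc.continuousAt))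
      rw [ht0]
      exact φ.continuousAt hφ1
    refine hc.eventually_mem (Θ.open_target.mem_nhds ?_)
    simpa [ht0, hφ0] using hΘ0
  rw [nhds_prod_eq] at hN
  obtain ⟨A, hA, hAN⟩ := Filter.mem_prod_self_iff.1 hN
  obtain ⟨B, hBA, hB, hB0⟩ := mem_nhds_iff.1 hA
  -- The preimage under the idempotent `p` makes `T` stable under `p`, as required for the section.
  set T := (B ∩ Θ.target) ∩ p ⁻¹' (B ∩ Θ.target) with hT
  have hTo : IsOpen T := (hB.inter Θ.open_target).inter
    ((hB.inter Θ.open_target).preimage p.continuous)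
  have hT0 : (0 : J.skew) ∈ T := ⟨⟨hB0, hΘ0⟩, by simpa using ⟨hB0, hΘ0⟩⟩
  set Ψ := (Θ.symm.restrOpen T hTo).symm with hΨ
  have hΨt : ∀ x, x ∈ Ψ.target ↔ x ∈ Θ.target ∧ x ∈ T := fun x => Iff.rfl
  have hΨs : ∀ u, u ∈ Ψ.source → u ∈ Θ.source ∧ Θ u ∈ T := fun u hu => hu
  refine ⟨{
    Θ := Ψ
    isOpenQuotientMap := isOpenQuotientMap_orbitMap
    map_mul := orbitMap_mul
    leftInverse := Submodule.projectionOntoL_apply_left h.symm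
    one_mem := ?_
    mem_maximalAtlas := ?_
    section_mem := ?_
    map_eq_iff := ?_ }⟩
  · have h1 : Θ.symm 0 = 1 := (hΘs 0 hΘ0).trans hF0
    have h2 := Ψ.map_target ((hΨt 0).2 ⟨hΘ0, hT0⟩)
    rwa [show Ψ.symm 0 = 1 from h1] at h2
  · refine Ψ.mem_maximalAtlas_of_contMDiffOn ?_ ?_
    · exact (contMDiffOn_of_mem_maximalAtlas hΘ).mono fun u hu => (hΨs u hu).1
    · exact (contMDiffOn_symm_of_mem_maximalAtlas hΘ).mono fun x hx => ((hΨt x).1 hx).1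
  · intro x hx
    have hx' := ((hΨt x).1 hx).2
    change p x ∈ Ψ.target
    refine (hΨt _).2 ⟨hx'.2.2, hx'.2, ?_⟩
    rw [Set.mem_preimage, hpp]
    exact hx'.2
  · intro u hu v hv
    obtain ⟨hu1, hu2⟩ := hΨs u hu
    obtain ⟨hv1, hv2⟩ := hΨs v hv
    have huF : F (Θ u) = u :=
      (hΘs _ (Θ.map_source hu1)).symm.trans (Θ.left_inv hu1)
    have hvF : F (Θ v) = v :=
      (hΘs _ (Θ.map_source hv1)).symm.trans (Θ.left_inv hv1)
    have hπF : ∀ x, J.orbitMap a (F x) = J.orbitMap a (cayleyUnitary (p x)) := fun x => by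
      rw [hF, orbitMap_mul, orbitMap_eq_base_iff.2
        (cayleyUnitary_mem_isotropy (Submodule.projectionL_apply_mem h x)), ← orbitMap_mul, mul_one]
    have hP : ∀ x y, m.projectionOntoL k h.symm x = m.projectionOntoL k h.symm y ↔ p x = p y :=
      fun x y => Subtype.ext_iff
    change _ ↔ m.projectionOntoL k h.symm (Θ u) = m.projectionOntoL k h.symm (Θ v)
    rw [hP]
    constructor
    -- Here `x = Θ u` and `x' = Θ v`; the Cayley coordinate `z` of `t` is `φ (t (Θ u, Θ v))`.
    · intro huv
      obtain ⟨hs, hmem⟩ := hAN (Set.mk_mem_prod (hBA hu2.1.1) (hBA hv2.1.1))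
      have htv : t (Θ u, Θ v) = (cayleyUnitary (p (Θ u)))⁻¹ * v :=
        congrArg ((cayleyUnitary (p (Θ u)))⁻¹ * ·) hvF
      have htK : t (Θ u, Θ v) ∈ J.isotropy a := by
        rw [htv, ← orbitMap_eq_iff, ← huv, ← hπF, huF]
      have hz := chart_one_mem_kerCommutator hs htK
      have hw := hΘs _ hmem
      have e1 : p (p (Θ u) + q (φ (t (Θ u, Θ v)))) = p (Θ u) := by
        rw [map_add, hpp, hqk _ hz, hpk _ hz, add_zero]
      have e2 : q (p (Θ u) + q (φ (t (Θ u, Θ v)))) = φ (t (Θ u, Θ v)) := by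
        rw [map_add, hqp, hqk _ hz, hqk _ hz, zero_add]
      have e3 : cayleyUnitary (φ (t (Θ u, Θ v))) = t (Θ u, Θ v) := φ.left_inv hs
      have e4 : Θ.symm (p (Θ u) + q (φ (t (Θ u, Θ v)))) = v := by
        rw [hw, e1, e2, e3, htv, mul_inv_cancel_left]
      have e5 : Θ v = p (Θ u) + q (φ (t (Θ u, Θ v))) :=
        (congrArg Θ e4).symm.trans (Θ.right_inv hmem)
      rw [e5, e1]
    · intro hp'
      rw [← huF, ← hvF, hπF, hπF, hp']

end Orbit

end SymmetricallyNormedIdeal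

end

theorem mainTheorem4 {H : Type*} [NormedAddCommGroup H] [InnerProductSpace ℂ H] [CompleteSpace H]
    [TopologicalSpace.SeparableSpace H] (hH : ¬ FiniteDimensional ℂ H)
    (J : SymmetricallyNormedIdeal H) (hJ : J.IsArithmeticallyMeanClosed)
    (a : H →L[ℂ] H) (hac : IsCompactOperator a) (han : IsStarNormal a) :
    -- the Banach-Lie group `U_J`, an embedded analytic submanifold of the affine space `1 + J`
    ∃ _ : ChartedSpace J.skew J.UnitaryGroup,
      LieGroup 𝓘(ℝ, J.skew) ω J.UnitaryGroup ∧
      IsSmoothEmbedding 𝓘(ℝ, J.skew) 𝓘(ℝ, J.Space) ω J.subOne ∧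
      -- its Lie algebra `T_1 U_J` is `𝔲_J` with the commutator bracket, and the differential at `1` of `π : u ↦ u a u⋆` is `δ_a : x ↦ [x, a]`
      (Set.range fun X : TangentSpace 𝓘(ℝ, J.skew) (1 : J.UnitaryGroup) =>
        (mfderiv 𝓘(ℝ, J.skew) 𝓘(ℝ, J.Space) J.subOne 1 X : J.Space)) = (J.skew : Set J.Space) ∧
      (∀ (X Y : GroupLieAlgebra 𝓘(ℝ, J.skew) J.UnitaryGroup) (x y : J.skew),
        mfderiv 𝓘(ℝ, J.skew) 𝓘(ℝ, J.Space) J.subOne 1 X = (x : J.Space) →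
        mfderiv 𝓘(ℝ, J.skew) 𝓘(ℝ, J.Space) J.subOne 1 Y = (y : J.Space) →
        mfderiv 𝓘(ℝ, J.skew) 𝓘(ℝ, J.Space) J.subOne 1 ⁅X, Y⁆ = ((⁅x, y⁆ : J.skew) : J.Space)) ∧
      ContMDiff 𝓘(ℝ, J.skew) 𝓘(ℝ, H →L[ℂ] H) ω (fun u => J.adjointAction u a) ∧
      (∀ (X : TangentSpace 𝓘(ℝ, J.skew) (1 : J.UnitaryGroup)) (x : J.skew),
        mfderiv 𝓘(ℝ, J.skew) 𝓘(ℝ, J.Space) J.subOne 1 X = (x : J.Space) →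
        mfderiv 𝓘(ℝ, J.skew) 𝓘(ℝ, H →L[ℂ] H) (fun u => J.adjointAction u a) 1 X =
          J.commutatorMap a x) ∧
      -- `U_J(a)` with its subspace topology is a Banach-Lie subgroup with Lie algebra `ker δ_a`
      (∃ _ : ChartedSpace (J.kerCommutator a).toSubmodule (J.isotropy a),
        LieGroup 𝓘(ℝ, (J.kerCommutator a).toSubmodule) ω (J.isotropy a) ∧
        IsSmoothEmbedding 𝓘(ℝ, (J.kerCommutator a).toSubmodule) 𝓘(ℝ, J.skew) ω
          (Subtype.val : J.isotropy a → J.UnitaryGroup) ∧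
        (Set.range fun X : TangentSpace 𝓘(ℝ, (J.kerCommutator a).toSubmodule) (1 : J.isotropy a) =>
          (mfderiv 𝓘(ℝ, (J.kerCommutator a).toSubmodule) 𝓘(ℝ, J.Space)
            (fun u : J.isotropy a => J.subOne u) 1 X : J.Space)) =
          Subtype.val '' ((J.kerCommutator a).toSubmodule : Set J.skew)) ∧
      -- `𝔲_J = Lie(U_J(a)) ⊕ ker (E|𝔲_J)`, a topological direct sum
      (J.kerCommutator a).toSubmodule.IsTopCompl (J.kerExpectation a han) ∧
      -- the orbit `O_J(a) ≅ U_J / U_J(a)` is a real-analytic homogeneous Banach manifold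
      (∃ φ : (J.UnitaryGroup ⧸ J.isotropy a) ≃ₜ J.Orbit a,
        ∀ u : J.UnitaryGroup, φ (QuotientGroup.mk u) = J.orbitMap a u) ∧
      ∃ _ : ChartedSpace (J.kerExpectation a han) (J.Orbit a),
        IsManifold 𝓘(ℝ, J.kerExpectation a han) ω (J.Orbit a) ∧
        T2Space (J.Orbit a) ∧
        IsSubmersion 𝓘(ℝ, J.skew) 𝓘(ℝ, J.kerExpectation a han) ω (J.orbitMap a) ∧
        ContMDiff (𝓘(ℝ, J.skew).prod 𝓘(ℝ, J.kerExpectation a han))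
          𝓘(ℝ, J.kerExpectation a han) ω
          (fun p : J.UnitaryGroup × J.Orbit a => p.1 • p.2) ∧
        MulAction.IsPretransitive J.UnitaryGroup (J.Orbit a) := by
  have h := SymmetricallyNormedIdeal.isTopCompl_kerCommutator_kerExpectation hH hJ hac han
  let _ := J.unitaryChartedSpace
  obtain ⟨S⟩ := SymmetricallyNormedIdeal.nonempty_homogeneousChart h
  refine ⟨J.unitaryChartedSpace, SymmetricallyNormedIdeal.lieGroup_unitaryGroup,
    SymmetricallyNormedIdeal.unitarySliceData.isSmoothEmbedding,
    SymmetricallyNormedIdeal.range_mfderiv_subOne,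
    fun X Y x y => SymmetricallyNormedIdeal.mfderiv_subOne_bracket X Y,
    SymmetricallyNormedIdeal.contMDiff_adjointAction a,
    fun X x => SymmetricallyNormedIdeal.mfderiv_adjointAction a X,
    ⟨SymmetricallyNormedIdeal.isotropyChartedSpace h, SymmetricallyNormedIdeal.lieGroup_isotropy h,
      SymmetricallyNormedIdeal.isSmoothEmbedding_isotropy h,
      SymmetricallyNormedIdeal.range_mfderiv_subOne_isotropy h⟩, h,
    ⟨J.quotientHomeomorph a, SymmetricallyNormedIdeal.quotientHomeomorph_mk⟩,
    S.chartedSpace, S.isManifold, SymmetricallyNormedIdeal.t2Space_orbit,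
    S.isSubmersion (Submodule.prodEquivOfIsTopCompl _ _ h.symm).symm fun x => ?_,
    S.contMDiff_smul, SymmetricallyNormedIdeal.isPretransitive_orbit⟩
  rw [Submodule.prodEquivOfIsTopCompl_symm_apply]
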